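/- Let $(W,S)$ be a Coxeter system of type $F_4$, with Coxeter diagram $s_1 - s_2 = s_3 - s_4$, and let $\sigma$ be the automorphism of $W$ of order $2$ with $\sigma(S)=S$ (so $\sigma(s_i)=s_{5-i}$). Put $\tilde W=W\rtimes\langle\sigma\rangle$, where $\sigma w\sigma^{-1}=\sigma(w)$, and write $W.\sigma=\{w\sigma : w\in W\}\subseteq\tilde W$. Let $l$ be the length function of $(W,S)$, let $I=\{t\in W: t^2=1\}$, and let $\tilde\rho$ be the character of the representation $\tilde R$ of $\tilde W$ on the $\mathbb{Q}$-vector space with basis $(a_t)_{t\in I}$ given, for $s\in S$ and $t\in I$, by $$\tilde R(s)a_t=\begin{cases}-a_t & \text{if } st=ts \text{ and } l(ts)<l(t),\\ a_{sts} & \text{otherwise,}\end{cases}\qquad \tilde R(\sigma)a_t=a_{\sigma(t)}.$$ Let $V$ be the complex reflection representation of $W$, of dimension $4$. Write $\phi_{d,b}$ for the irreducible complex character of $W$ of degree $d$ for which $b$ is the smallest $i$ such that the character occurs in the symmetric power $\mathrm{Sym}^i(V)$. There are two such characters for $(d,b)=(6,6)$: the one that occurs in $V\otimes V$ (namely $\Lambda^2V$)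 is $\phi''_{6,6}$, and the other one is $\phi'_{6,6}$. Then for each of $$\phi_{1,0},\ \phi_{9,2},\ \phi_{9,10},\ \phi_{1,24},\ \phi_{12,4},\ \phi''_{6,6},\ \phi'_{6,6}$$ there is exactly one character of $\tilde W$, denoted by adding a tilde, which restricts to the given character of $W$ and satisfies $$\tilde\phi_{1,0}(\sigma),\ \tilde\phi_{9,2}(\sigma),\ \tilde\phi_{9,10}(\sigma),\ \tilde\phi_{1,24}(\sigma),\ \tilde\phi_{12,4}(\sigma)>0,\qquad \tilde\phi''_{6,6}(\sigma)<0,\qquad \tilde\phi'_{6,6}(s_1s_2\sigma)>0 ,$$ respectively, and on $W.\sigma$ we have $$\tilde\rho=\tilde\phi_{1,0}+\tilde\phi_{9,2}+\tilde\phi_{9,10}+\tilde\phi_{1,24}+\tilde\phi_{12,4}-2\,\tilde\phi''_{6,6}+\tilde\phi'_{6,6}.$$ -/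

import Mathlib

namespace InvolutionModule

section General

variable {B W : Type*} [Group W] {M : CoxeterMatrix B} (cs : CoxeterSystem M W)

/-- The set `I` of elements `w` of the group with `w ^ 2 = 1`. -/
abbrev Invol (W : Type*) [Group W] : Type _ := {t : W // t ^ 2 = 1}

/-- The permutation of `I` induced by an automorphism of the group. -/
def involPerm : MulAut W →* Equiv.Perm (Invol W) where
  toFun τ :=
    { toFun := fun t => ⟨τ t.1, by rw [← map_pow, t.2, map_one]⟩
      invFun := fun t => ⟨τ⁻¹ t.1, by rw [← map_pow, t.2, map_one]⟩
      left_inv := fun t => Subtype.ext (MulAut.inv_apply_self W τ t.1)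
      right_inv := fun t => Subtype.ext (MulAut.apply_inv_self W τ t.1) }
  map_one' := rfl
  map_mul' _ _ := rfl

@[simp] theorem involPerm_coe (τ : MulAut W) (t : Invol W) :
    ((involPerm τ t : Invol W) : W) = τ t.1 := rfl

/-- The `ℚ`-vector space `V` with basis `a_t`, `t ∈ I`; here `a_t` is `Finsupp.single t 1`. -/
abbrev InvMod (W : Type*) [Group W] : Type _ := Invol W →₀ ℚ

open Classical in
/-- The operator `R(s)` of a simple reflection `s = s_i`: it sends `a_t` to `-a_t` if `s t = t s`
and `l(t s) < l(t)`, and to `a_{s t s}` otherwise. -/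
noncomputable def genOp (i : B) : Module.End ℚ (InvMod W) :=
  Finsupp.linearCombination ℚ fun t : Invol W =>
    if cs.simple i * t.1 = t.1 * cs.simple i ∧ cs.length (t.1 * cs.simple i) < cs.length t.1 then
      -Finsupp.single t 1
    else Finsupp.single (involPerm (MulAut.conj (cs.simple i)) t) 1

/-! ### The operators `R(s)` satisfy the Coxeter relations -/

/-- Signed permutation operator. -/
noncomputable def signedOp {X : Type*} (act : W →* Equiv.Perm X) (h : W → X → ℚ) (r : W) :
    Module.End ℚ (X →₀ ℚ) :=
  Finsupp.linearCombination ℚ fun x => Finsupp.single (act r x) (h r x)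

theorem signedOp_single {X : Type*} (act : W →* Equiv.Perm X) (h : W → X → ℚ) (r : W) (x : X)
    (a : ℚ) : signedOp act h r (Finsupp.single x a) = Finsupp.single (act r x) (a * h r x) := by
  simp [signedOp, Finsupp.linearCombination_single]

theorem rot_mul {s t : W} (hs : s * s = 1) (ht : t * t = 1) (k : ℕ) :
    (s * t) ^ k * t * (s * t) ^ k = t := by
  induction k with
  | zero => simp
  | succ k ih =>
    have : (s * t) ^ (k + 1) * t * (s * t) ^ (k + 1)
        = (s * t) * ((s * t) ^ k * t * (s * t) ^ k) * (s * t) := by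
      rw [pow_succ (s * t) k]
      nth_rewrite 1 [← pow_succ (s * t) k, pow_succ' (s * t) k]
      simp only [mul_assoc]
    rw [this, ih]
    have : s * t * t * (s * t) = s * (t * t) * s * t := by simp only [mul_assoc]
    rw [this, ht, mul_one, hs, one_mul]

theorem signedOp_pow {X : Type*} (act : W →* Equiv.Perm X) (h : W → X → ℚ)
    (hc : ∀ w r x, h (w * r * w⁻¹) (act w x) = h r x) {s t : W} (hs : s * s = 1) (ht : t * t = 1)
    (k : ℕ) (x : X) (a : ℚ) :
    ((signedOp act h s * signedOp act h t) ^ k) (Finsupp.single x a) =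
      Finsupp.single (act ((s * t) ^ k) x)
        (a * ∏ j ∈ Finset.range (2 * k), h (t * (s * t) ^ j) x) := by
  induction k with
  | zero => simp
  | succ k ih =>
    rw [pow_succ', Module.End.mul_apply, ih, Module.End.mul_apply, signedOp_single,
      signedOp_single]
    have e1 : h t (act ((s * t) ^ k) x) = h (t * (s * t) ^ (2 * k)) x := by
      rw [← hc ((s * t) ^ k) (t * (s * t) ^ (2 * k)) x]
      congr 1
      rw [two_mul, pow_add, ← mul_assoc, ← mul_assoc, mul_inv_cancel_right, rot_mul hs ht]
    have e2 : h s (act t (act ((s * t) ^ k) x)) = h (t * (s * t) ^ (2 * k + 1)) x := by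
      rw [← Equiv.Perm.mul_apply, ← map_mul, ← hc (t * (s * t) ^ k) (t * (s * t) ^ (2 * k + 1)) x]
      congr 1
      have : t * (s * t) ^ k * (t * (s * t) ^ (2 * k + 1)) * (t * (s * t) ^ k)⁻¹
          = t * ((s * t) ^ k * t * (s * t) ^ k) * ((s * t) ^ (k + 1) * ((s * t) ^ k)⁻¹) * t⁻¹ := by
        rw [show 2 * k + 1 = k + (k + 1) by ring, pow_add, mul_inv_rev]
        simp only [mul_assoc]
      rw [this, rot_mul hs ht, ht, one_mul, pow_succ', mul_inv_cancel_right, mul_inv_cancel_right]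
    rw [e1, e2, show 2 * (k + 1) = 2 * k + 1 + 1 by ring, Finset.prod_range_succ,
      Finset.prod_range_succ, ← Equiv.Perm.mul_apply, ← Equiv.Perm.mul_apply, ← map_mul,
      ← map_mul, pow_succ' (s * t) k]
    congr 1
    ring

theorem signedOp_liftable {X : Type*} (act : W →* Equiv.Perm X) (h : W → X → ℚ)
    (hc : ∀ w r x, h (w * r * w⁻¹) (act w x) = h r x) (h1 : ∀ r x, h r x * h r x = 1) :
    M.IsLiftable fun i => signedOp act h (cs.simple i) := by
  intro i j
  refine Finsupp.lhom_ext fun x a => ?_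
  rw [signedOp_pow act h hc (cs.simple_mul_simple_self i) (cs.simple_mul_simple_self j),
    cs.simple_mul_simple_pow, two_mul, Finset.prod_range_add]
  simp only [pow_add, cs.simple_mul_simple_pow, one_mul, map_one, Equiv.Perm.one_apply,
    Module.End.one_apply]
  rw [← Finset.prod_mul_distrib, Finset.prod_eq_one fun j _ => h1 _ _, mul_one]

open Classical in
noncomputable def eqSign {X : Type*} (r x : X) : ℚ := if x = r then -1 else 1

noncomputable def conjPerm : W →* Equiv.Perm W := (MulAut.toPerm W).comp MulAut.conj

theorem conjPerm_apply (w x : W) : conjPerm w x = w * x * w⁻¹ := rfl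

theorem eqSign_conj (w r x : W) : eqSign (w * r * w⁻¹) (conjPerm w x) = eqSign r x := by
  by_cases h : x = r <;> simp [eqSign, conjPerm_apply, h]

theorem eqSign_mul_self {X : Type*} (r x : X) : eqSign r x * eqSign r x = 1 := by
  unfold eqSign; split_ifs <;> norm_num

noncomputable def reflRep : W →* Module.End ℚ (W →₀ ℚ) :=
  cs.lift ⟨_, signedOp_liftable cs conjPerm eqSign eqSign_conj eqSign_mul_self⟩

theorem reflRep_simple (i : B) :
    reflRep cs (cs.simple i) = signedOp conjPerm eqSign (cs.simple i) := by
  unfold reflRep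
  rw [cs.lift_apply_simple]

theorem exists_reflSign (w : W) : ∃ η : W → ℚ, (∀ x, η x * η x = 1) ∧
    ∀ x a, reflRep cs w (Finsupp.single x a) = Finsupp.single (w * x * w⁻¹) (a * η x) := by
  induction w using cs.simple_induction_left with
  | one => exact ⟨fun _ => 1, by simp, by simp⟩
  | mul_simple_left w i ih =>
    obtain ⟨η, h1, h2⟩ := ih
    refine ⟨fun x => η x * eqSign (cs.simple i) (w * x * w⁻¹), fun x => ?_, fun x a => ?_⟩
    · rw [mul_mul_mul_comm, h1, eqSign_mul_self, one_mul]
    · rw [map_mul, Module.End.mul_apply, h2, reflRep_simple, signedOp_single]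
      simp [conjPerm_apply, mul_assoc]

noncomputable def reflSign (w : W) : W → ℚ := (exists_reflSign cs w).choose

theorem reflSign_mul_self (w x : W) : reflSign cs w x * reflSign cs w x = 1 :=
  (exists_reflSign cs w).choose_spec.1 x

theorem reflRep_single (w x : W) (a : ℚ) :
    reflRep cs w (Finsupp.single x a) = Finsupp.single (w * x * w⁻¹) (a * reflSign cs w x) :=
  (exists_reflSign cs w).choose_spec.2 x a

theorem reflSign_mul (u v x : W) :
    reflSign cs (u * v) x = reflSign cs v x * reflSign cs u (v * x * v⁻¹) := by
  have h := reflRep_single cs (u * v) x 1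
  rw [map_mul, Module.End.mul_apply, reflRep_single, reflRep_single] at h
  have e : u * (v * x * v⁻¹) * u⁻¹ = u * v * x * (u * v)⁻¹ := by simp [mul_assoc]
  rw [e] at h
  have := Finsupp.single_injective _ h
  simpa using this.symm

theorem reflSign_one (x : W) : reflSign cs 1 x = 1 := by
  have h := reflRep_single cs 1 x 1
  simp only [map_one, Module.End.one_apply, one_mul, inv_one, mul_one] at h
  exact (Finsupp.single_injective _ h).symm

theorem reflSign_simple (i : B) (x : W) :
    reflSign cs (cs.simple i) x = eqSign (cs.simple i) x := by
  have h := reflRep_single cs (cs.simple i) x 1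
  rw [reflRep_simple, signedOp_single] at h
  have := Finsupp.single_injective _ h
  simpa using this.symm

theorem reflSign_conj {w r : W} (hwr : r * w = w * r) (x : W) :
    reflSign cs (x * w * x⁻¹) (x * r * x⁻¹) = reflSign cs w r := by
  have e : w * r * w⁻¹ = r := by rw [← hwr, mul_inv_cancel_right]
  have h1 : reflSign cs (x * w * x⁻¹ * x) r = reflSign cs (x * w) r := by
    rw [inv_mul_cancel_right]
  rw [reflSign_mul, reflSign_mul cs x w, e, mul_comm] at h1
  have hx : reflSign cs x r ≠ 0 := fun h0 => by simpa [h0] using reflSign_mul_self cs x r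
  exact mul_right_cancel₀ hx h1

theorem reflSign_eq_one {ω : List B} {t : W} (h : t ∉ cs.rightInvSeq ω) :
    reflSign cs (cs.wordProd ω) t = 1 := by
  induction ω with
  | nil => simpa using reflSign_one cs t
  | cons i ω ih =>
    rw [CoxeterSystem.rightInvSeq, List.mem_cons, not_or] at h
    rw [cs.wordProd_cons, reflSign_mul, ih h.2, one_mul, reflSign_simple, eqSign, if_neg]
    intro h'
    apply h.1
    rw [← h']
    simp [mul_assoc]

theorem reflSign_simple_eq_one {w : W} {i : B}
    (h : cs.length w < cs.length (w * cs.simple i)) : reflSign cs w (cs.simple i) = 1 := by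
  obtain ⟨ω, hω, rfl⟩ := cs.exists_isReduced w
  apply reflSign_eq_one
  intro hm
  exact absurd (cs.isRightInversion_of_mem_rightInvSeq hω hm).2 (not_lt.mpr h.le)

theorem reflSign_simple_eq_neg_one {w : W} {i : B}
    (h : cs.length (w * cs.simple i) < cs.length w) : reflSign cs w (cs.simple i) = -1 := by
  have h' : reflSign cs (w * cs.simple i) (cs.simple i) = 1 := by
    apply reflSign_simple_eq_one
    simpa [mul_assoc] using h
  have : w = w * cs.simple i * cs.simple i := by simp [mul_assoc]
  rw [this, reflSign_mul, reflSign_simple]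
  simp [eqSign, h']

open Classical in
noncomputable def imagSign (r : W) (t : Invol W) : ℚ :=
  if r * t.1 = t.1 * r then reflSign cs t.1 r else 1

theorem imagSign_conj (w r : W) (t : Invol W) :
    imagSign cs (w * r * w⁻¹) (involPerm (MulAut.conj w) t) = imagSign cs r t := by
  have e : (w * r * w⁻¹ * (involPerm (MulAut.conj w) t).1 =
      (involPerm (MulAut.conj w) t).1 * (w * r * w⁻¹)) ↔ r * t.1 = t.1 * r := by
    rw [involPerm_coe, MulAut.conj_apply]
    simp only [mul_assoc, inv_mul_cancel_left, mul_right_inj]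
    simp only [← mul_assoc, mul_left_inj]
  unfold imagSign
  by_cases h : r * t.1 = t.1 * r
  · rw [if_pos (e.2 h), if_pos h, involPerm_coe, MulAut.conj_apply, reflSign_conj cs h]
  · rw [if_neg (mt e.1 h), if_neg h]

theorem imagSign_mul_self (r : W) (t : Invol W) : imagSign cs r t * imagSign cs r t = 1 := by
  unfold imagSign
  split_ifs
  · exact reflSign_mul_self cs _ _
  · norm_num

theorem genOp_eq (i : B) :
    genOp cs i = signedOp (involPerm.comp MulAut.conj) (imagSign cs) (cs.simple i) := by
  refine Finsupp.lhom_ext fun t a => ?_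
  rw [signedOp_single, genOp, Finsupp.linearCombination_single]
  simp only [MonoidHom.comp_apply, imagSign]
  by_cases hc : cs.simple i * t.1 = t.1 * cs.simple i
  · have ht : involPerm (MulAut.conj (cs.simple i)) t = t := by
      apply Subtype.ext
      simp [hc]
    rcases lt_or_gt_of_ne (cs.length_mul_simple_ne t.1 i) with hl | hl
    · rw [if_pos ⟨hc, hl⟩, if_pos hc, reflSign_simple_eq_neg_one cs hl, ht]
      simp
    · rw [if_neg (fun h => absurd h.2 (not_lt.mpr hl.le)), if_pos hc,
        reflSign_simple_eq_one cs hl, ht]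
      simp
  · rw [if_neg (fun h => hc h.1), if_neg hc]
    simp

theorem genOp_liftable : M.IsLiftable (genOp cs) := by
  have h := signedOp_liftable cs (involPerm.comp MulAut.conj) (imagSign cs) (imagSign_conj cs)
    (imagSign_mul_self cs)
  intro i j
  rw [genOp_eq, genOp_eq]
  exact h i j

/-! ### The involution module and its extension -/

/-- The involution module: the representation `R` of `W` on `V` given on simple reflections by the
operators `R(s)`. -/
noncomputable def invRep : Representation ℚ W (InvMod W) :=
  cs.lift ⟨genOp cs, genOp_liftable cs⟩

theorem invRep_simple (i : B) : invRep cs (cs.simple i) = genOp cs i := by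
  unfold invRep
  rw [cs.lift_apply_simple]

/-- The automorphisms of `W` as a Coxeter group: those stabilizing the set of simple
reflections. -/
def coxeterAut : Subgroup (MulAut W) where
  carrier := {τ | τ '' Set.range cs.simple = Set.range cs.simple}
  one_mem' := by simp
  mul_mem' {a b} ha hb := by
    simp only [Set.mem_ofPred_eq] at *
    rw [MulAut.coe_mul, Set.image_comp, hb, ha]
  inv_mem' {a} ha := by
    simp only [Set.mem_ofPred_eq] at *
    nth_rewrite 1 [← ha]
    rw [← Set.image_comp, ← MulAut.coe_mul, inv_mul_cancel]
    simp

theorem coxeterAut_simple {τ : MulAut W} (hτ : τ ∈ coxeterAut cs) (i : B) :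
    ∃ j, τ (cs.simple i) = cs.simple j := by
  have h : τ (cs.simple i) ∈ τ '' Set.range cs.simple := ⟨_, ⟨i, rfl⟩, rfl⟩
  have h' : τ '' Set.range cs.simple = Set.range cs.simple := hτ
  rw [h'] at h
  obtain ⟨j, hj⟩ := h
  exact ⟨j, hj.symm⟩

theorem coxeterAut_length_le {τ : MulAut W} (hτ : τ ∈ coxeterAut cs) (w : W) :
    cs.length (τ w) ≤ cs.length w := by
  choose f hf using coxeterAut_simple cs hτ
  obtain ⟨ω, hω, rfl⟩ := cs.exists_isReduced w
  have : τ (cs.wordProd ω) = cs.wordProd (ω.map f) := by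
    unfold CoxeterSystem.wordProd
    rw [map_list_prod, List.map_map, List.map_map]
    congr 2
    funext i
    exact hf i
  rw [this, hω.eq]
  exact (cs.length_wordProd_le _).trans (by simp)

theorem coxeterAut_length {τ : MulAut W} (hτ : τ ∈ coxeterAut cs) (w : W) :
    cs.length (τ w) = cs.length w := by
  refine le_antisymm (coxeterAut_length_le cs hτ w) ?_
  have := coxeterAut_length_le cs ((coxeterAut cs).inv_mem hτ) (τ w)
  rwa [MulAut.inv_apply_self] at this

/-- The operator sending `a_t` to `a_{τ(t)}`. -/
noncomputable def permOp : MulAut W →* Module.End ℚ (InvMod W) where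
  toFun τ := Finsupp.lmapDomain ℚ ℚ (involPerm τ)
  map_one' := Finsupp.lhom_ext fun t a => by simp
  map_mul' a b := Finsupp.lhom_ext fun t a => by simp [Finsupp.lmapDomain_apply]

theorem permOp_single (τ : MulAut W) (t : Invol W) (a : ℚ) :
    permOp τ (Finsupp.single t a) = Finsupp.single (involPerm τ t) a := by
  simp [permOp, Finsupp.lmapDomain_apply]

theorem permOp_genOp {τ : MulAut W} (hτ : τ ∈ coxeterAut cs) {i j : B}
    (hij : τ (cs.simple i) = cs.simple j) : permOp τ * genOp cs i = genOp cs j * permOp τ := by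
  refine Finsupp.lhom_ext fun t a => ?_
  rw [Module.End.mul_apply, Module.End.mul_apply, permOp_single, genOp, genOp,
    Finsupp.linearCombination_single, Finsupp.linearCombination_single, map_smul]
  congr 1
  have e : (cs.simple j * (involPerm τ t).1 = (involPerm τ t).1 * cs.simple j ∧
      cs.length ((involPerm τ t).1 * cs.simple j) < cs.length (involPerm τ t).1) ↔
      (cs.simple i * t.1 = t.1 * cs.simple i ∧
        cs.length (t.1 * cs.simple i) < cs.length t.1) := by
    rw [involPerm_coe, ← hij, ← map_mul, ← map_mul, τ.injective.eq_iff,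
      coxeterAut_length cs hτ, coxeterAut_length cs hτ]
  by_cases h : cs.simple i * t.1 = t.1 * cs.simple i ∧
      cs.length (t.1 * cs.simple i) < cs.length t.1
  · rw [if_pos h, if_pos (e.2 h), map_neg, permOp_single]
  · rw [if_neg h, if_neg (mt e.1 h), permOp_single]
    congr 1
    apply Subtype.ext
    simp [hij]

theorem permOp_invRep {τ : MulAut W} (hτ : τ ∈ coxeterAut cs) (w : W) :
    permOp τ * invRep cs w = invRep cs (τ w) * permOp τ := by
  induction w using cs.simple_induction_left with
  | one => simp
  | mul_simple_left w i ih =>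
    obtain ⟨j, hj⟩ := coxeterAut_simple cs hτ i
    rw [map_mul, map_mul, map_mul, invRep_simple, hj, invRep_simple, ← mul_assoc,
      permOp_genOp cs hτ hj, mul_assoc, ih, mul_assoc]

/-- The semidirect product `W̃` of `W` with the cyclic group generated by an automorphism `σ`. -/
abbrev ExtGroup (σ : MulAut W) : Type _ :=
  W ⋊[(Subgroup.zpowers σ).subtype] (Subgroup.zpowers σ)

/-- The element `wσ` of the coset `W.σ` in `W̃`. -/
def cosetElt (σ : MulAut W) (w : W) : ExtGroup σ :=
  SemidirectProduct.inl w * SemidirectProduct.inr ⟨σ, Subgroup.mem_zpowers σ⟩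

/-- The extended involution module: the representation `R̃` of `W̃` extending `R`, in which `σ` sends
`a_t` to `a_{σ(t)}`. -/
noncomputable def extInvRep (σ : MulAut W) (hσ : σ ∈ coxeterAut cs) :
    Representation ℚ (ExtGroup σ) (InvMod W) where
  toFun g := invRep cs g.left * permOp (g.right : MulAut W)
  map_one' := by simp
  map_mul' g h := by
    have hg : (g.right : MulAut W) ∈ coxeterAut cs :=
      (Subgroup.zpowers_le.mpr hσ) g.right.2
    rw [SemidirectProduct.mul_left, SemidirectProduct.mul_right, Subgroup.coe_mul, map_mul,
      map_mul]
    have := permOp_invRep cs hg h.left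
    simp only [Subgroup.coe_subtype]
    calc _ = invRep cs g.left * (invRep cs ((g.right : MulAut W) h.left)
          * permOp (g.right : MulAut W)) * permOp (h.right : MulAut W) := by
            simp only [mul_assoc]
      _ = _ := by rw [← this]; simp only [mul_assoc]

theorem extInvRep_inl (σ : MulAut W) (hσ : σ ∈ coxeterAut cs) (w : W) :
    extInvRep cs σ hσ (SemidirectProduct.inl w) = invRep cs w := by
  simp [extInvRep]

theorem extInvRep_coset (σ : MulAut W) (hσ : σ ∈ coxeterAut cs) (t : Invol W) :
    extInvRep cs σ hσ (cosetElt σ 1) (Finsupp.single t 1) =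
      Finsupp.single (involPerm σ t) 1 := by
  simp [extInvRep, cosetElt, permOp_single]

/-- The character `ρ̃` of the extended involution module. -/
noncomputable def extInvChar (σ : MulAut W) (hσ : σ ∈ coxeterAut cs) : ExtGroup σ → ℚ :=
  (extInvRep cs σ hσ).character

end General

section F4

variable {W : Type*} [Group W] (cs : CoxeterSystem CoxeterMatrix.F₄ W)

/-- The matrix, in the basis of simple roots `α_j` of the root system of type `F₄`, of the simple
reflection `s_i : α_j ↦ α_j - c_{ij} α_i`, with `(c_{ij})` the Cartan matrix. -/
def f4Refl (i : Fin 4) : Matrix (Fin 4) (Fin 4) ℤ :=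
  Matrix.of fun k j => (if k = j then 1 else 0) - (if k = i then CartanMatrix.F₄ i j else 0)

theorem f4Refl_liftable : CoxeterMatrix.F₄.IsLiftable f4Refl := by
  unfold CoxeterMatrix.IsLiftable
  decide

/-- The matrices of the reflection representation of `W`. -/
noncomputable def f4Mat : W →* Matrix (Fin 4) (Fin 4) ℤ := cs.lift ⟨f4Refl, f4Refl_liftable⟩

theorem f4Mat_simple (i : Fin 4) : f4Mat cs (cs.simple i) = f4Refl i := by
  unfold f4Mat
  rw [cs.lift_apply_simple]

/-- The complex reflection representation of `W`. -/
noncomputable def reflectionRep : Representation ℂ W (Fin 4 → ℂ) where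
  toFun w := Matrix.toLin' ((f4Mat cs w).map (Int.cast : ℤ → ℂ))
  map_one' := by
    rw [map_one, Matrix.map_one _ Int.cast_zero Int.cast_one, Matrix.toLin'_one]
    rfl
  map_mul' u v := by
    have : ((f4Mat cs u * f4Mat cs v).map (Int.cast : ℤ → ℂ)) =
        (f4Mat cs u).map (Int.cast : ℤ → ℂ) * (f4Mat cs v).map (Int.cast : ℤ → ℂ) :=
      Matrix.map_mul (f := Int.castRingHom ℂ)
    rw [map_mul, this, Matrix.toLin'_mul]
    rfl

/-- The action of `w` by an algebra endomorphism of the symmetric algebra of the reflection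
representation, i.e. of the polynomial ring in the simple roots `α_j = X j`. -/
noncomputable def symAlg (w : W) : MvPolynomial (Fin 4) ℂ →ₐ[ℂ] MvPolynomial (Fin 4) ℂ :=
  MvPolynomial.aeval fun j => ∑ k, (f4Mat cs w k j : MvPolynomial (Fin 4) ℂ) * MvPolynomial.X k

/-- The representation of `W` on the symmetric algebra of the reflection representation. -/
noncomputable def symRep : Representation ℂ W (MvPolynomial (Fin 4) ℂ) where
  toFun w := (symAlg cs w).toLinearMap
  map_one' := by
    have : symAlg cs 1 = AlgHom.id ℂ _ := by
      ext j : 1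
      simp [symAlg, Matrix.one_apply]
    rw [this]
    rfl
  map_mul' u v := by
    have : symAlg cs (u * v) = (symAlg cs u).comp (symAlg cs v) := by
      ext j : 1
      simp only [symAlg, map_mul, Matrix.mul_apply, MvPolynomial.aeval_X, AlgHom.comp_apply,
        map_sum, Int.cast_sum, Int.cast_mul, map_intCast, Finset.sum_mul, Finset.mul_sum]
      rw [Finset.sum_comm]
      refine Finset.sum_congr rfl fun k _ => Finset.sum_congr rfl fun l _ => ?_
      ring
    rw [this]
    rfl

/-- The representation `r` occurs in the `i`-th symmetric power of the reflection representation
(meant for irreducible `r`): there is a nonzero equivariant map from `r` to the space of homogeneous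
polynomials of degree `i`. -/
def OccursInDegree {U : Type*} [AddCommGroup U] [Module ℂ U] (r : Representation ℂ W U) (i : ℕ) :
    Prop :=
  ∃ f : Representation.IntertwiningMap r (symRep cs), f ≠ 0 ∧
    ∀ u, f u ∈ MvPolynomial.homogeneousSubmodule (Fin 4) ℂ i

/-- The representation `r` (meant to be irreducible) occurs in the tensor square of the reflection
representation. -/
def OccursInTensorSquare {U : Type*} [AddCommGroup U] [Module ℂ U] (r : Representation ℂ W U) :
    Prop :=
  ∃ f : Representation.IntertwiningMap r ((reflectionRep cs).tprod (reflectionRep cs)), f ≠ 0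

/-- Labels of the irreducible characters of `W` that are needed; `phi_d_b` stands for `φ_{d,b}`,
with `phi_6_6'` and `phi_6_6''` for `φ'_{6,6}` and `φ''_{6,6}`. -/
inductive Label : Type
  | phi_1_0 | phi_9_2 | phi_9_10 | phi_1_24 | phi_12_4 | phi_6_6'' | phi_6_6'

/-- The degree of the character with a given label. -/
def Label.degree : Label → ℕ
  | .phi_1_0 => 1
  | .phi_9_2 => 9
  | .phi_9_10 => 9
  | .phi_1_24 => 1
  | .phi_12_4 => 12
  | .phi_6_6'' => 6
  | .phi_6_6' => 6

/-- The `b`-invariant of the character with a given label. -/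
def Label.b : Label → ℕ
  | .phi_1_0 => 0
  | .phi_9_2 => 2
  | .phi_9_10 => 10
  | .phi_1_24 => 24
  | .phi_12_4 => 4
  | .phi_6_6'' => 6
  | .phi_6_6' => 6

/-- The condition separating `φ''_{6,6}` (the exterior square of the reflection representation,
contained in its tensor square) from `φ'_{6,6}`. -/
def Label.Primes : Label → Prop → Prop
  | .phi_6_6'', p => p
  | .phi_6_6', p => ¬p
  | _, _ => True

/-- `r` is an irreducible representation of `W` affording the character with label `l`. -/
def HasLabel (l : Label) (r : Representation ℂ W (Fin l.degree → ℂ)) : Prop :=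
  r.IsIrreducible ∧ IsLeast {i | OccursInDegree cs r i} l.b ∧
    l.Primes (OccursInTensorSquare cs r)

/-- The normalization that picks one of the two extensions to `W̃`, which differ by a sign on
`W.σ`: the value at `σ` is negative for `φ''_{6,6}` and positive for the other characters, except
`φ'_{6,6}`, whose extension vanishes at `σ` and has a positive value at `s₁s₂σ`, where `s₁` is an
end node of the Coxeter diagram and `s₂` its neighbour. -/
def Label.Normalized (σ : MulAut W) : Label → (ExtGroup σ → ℂ) → Prop
  | .phi_6_6', ψ => 0 < (ψ (cosetElt σ (cs.simple 0 * cs.simple 1))).re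
  | .phi_6_6'', ψ => (ψ (cosetElt σ 1)).re < 0
  | _, ψ => 0 < (ψ (cosetElt σ 1)).re

/-- `ψ` is the character of `W̃` whose restriction to `W` is the irreducible character with label
`l`, normalized as above. -/
def IsExtension (σ : MulAut W) (l : Label) (ψ : ExtGroup σ → ℂ) : Prop :=
  ∃ r : Representation ℂ (ExtGroup σ) (Fin l.degree → ℂ),
    HasLabel cs l (r.comp SemidirectProduct.inl) ∧ l.Normalized cs σ ψ ∧ ψ = r.character

end F4

end InvolutionModule

/-! Let N be the largest normal 2-subgroup of W. It is extraspecial of order 32, its center is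
generated by the longest element (which acts as -1 on V), and W/N is S₃ × S₃ with σ exchanging the
two factors. This structure drives both halves of the argument.

The identity. Both sides are invariant under conjugation by W, which acts on W.σ by w ↦ g w σ(g)⁻¹.
In S₃ × S₃ this twisted conjugation has three classes, so W.σ is exhausted up to conjugacy by 3 · 32
= 96 elements (`exists_twisted_conj`). On these the trace on the 140 basis vectors a_t is compared
with the traces of explicit matrices (`involTrace_eq_extTrace`).

Identification of the characters. An irreducible representation that occurs in an even symmetric
power is trivial on the center of N, so it contains one of the 16 linear characters of N. These form
W-orbits of sizes 1, 9 and 6. By Clifford theory the representation either factors through S₃ × S₃,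
hence has degree at most 4, or is one of four representations of degree 9 or one of three of degrees
6, 6, 12, each induced from the stabilizer of a character of N
(`exists_intertwining_of_irreducible`). The induced representations are written as block monomial
integer matrices (`InducedDatum`). Linear characters are treated directly.

The b-invariants separate these candidates. Occurrence in a given degree is shown by a polynomial on
which the inducing subgroup acts as prescribed. A lower bound comes from a vector negated by k
reflections with different root lines: its image is a polynomial divisible by the k roots, so its
degree is at least k (`length_le_of_neg`). For Λ²V this gives only 4; degree 5 is excluded by parity
and degree 4 by a linear relation (`not_occursInDegree_four`). The two characters of degree 6 are
separated by their occurrence in V ⊗ V.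

Extensions. By Schur's lemma an extension to W̃ is unique up to a sign on W.σ
(`exists_sign_character`), and the normalization fixes that sign for an explicit matrix of σ.

All computations in W rest on the word problem: w is determined by the heights of the roots w⁻¹α_j,
and the sign of such a height detects a left descent (`height_injective`, `height_neg_iff`).
Equality of words thus becomes equality of quadruples of integers. -/

namespace InvolutionModule

/-! ### Roots, lengths and a solution of the word problem. -/

section Geometry

variable {W : Type*} [Group W] (cs : CoxeterSystem CoxeterMatrix.F₄ W)

theorem f4Mat_wordProd (l : List (Fin 4)) :
    f4Mat cs (cs.wordProd l) = (l.map f4Refl).prod := by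
  rw [CoxeterSystem.wordProd, map_list_prod, List.map_map]
  congr 2
  funext i
  exact f4Mat_simple cs i

/-- The rank two case: as long as an alternating word ending in t has fewer than m(s,t) letters, it
keeps α_s positive. -/
theorem dihedral_column : ∀ s t : Fin 4, s ≠ t → ∀ l ∈ [[t], [s, t], [t, s, t]],
    l.length < CoxeterMatrix.F₄ s t → ∃ a b : Fin 3, ∀ k,
      (l.map f4Refl).prod k s = (a : ℕ) * (1 : Matrix (Fin 4) (Fin 4) ℤ) k s
        + (b : ℕ) * (1 : Matrix (Fin 4) (Fin 4) ℤ) k t := by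
  decide +kernel

theorem f4_entry_cases : ∀ s t : Fin 4, s ≠ t →
    (2 : ℕ) ≤ CoxeterMatrix.F₄ s t ∧ (CoxeterMatrix.F₄ s t : ℕ) ≤ 4 := by
  intro s t h
  fin_cases s <;> fin_cases t <;> first | exact absurd rfl h | simp [CoxeterMatrix.F₄]

theorem column_nonneg_of_mul {v : W} {s t : Fin 4} (hst : s ≠ t) {l : List (Fin 4)}
    (hl : l ∈ [[t], [s, t], [t, s, t]]) (hlen : l.length < CoxeterMatrix.F₄ s t)
    (hs : ∀ k, 0 ≤ f4Mat cs v k s) (ht : ∀ k, 0 ≤ f4Mat cs v k t) (k : Fin 4) :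
    0 ≤ f4Mat cs (v * cs.wordProd l) k s := by
  obtain ⟨a, b, hab⟩ := dihedral_column s t hst l hl hlen
  have : f4Mat cs (v * cs.wordProd l) k s = (a : ℕ) * f4Mat cs v k s + (b : ℕ) * f4Mat cs v k t := by
    rw [map_mul, f4Mat_wordProd, Matrix.mul_apply]
    simp_rw [hab, Matrix.one_apply]
    simp only [mul_add, Finset.sum_add_distrib, mul_ite, mul_one, mul_zero,
      Finset.sum_ite_eq', Finset.mem_univ, if_true]
    ring
  rw [this]
  have := hs k
  have := ht k
  positivity

/-- `l(ws) > l(w)` implies that `w` sends the simple root of `s` to a nonnegative combination of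
simple roots. -/
theorem column_nonneg (w : W) (s : Fin 4) (h : cs.length w < cs.length (w * cs.simple s))
    (k : Fin 4) : 0 ≤ f4Mat cs w k s := by
  induction hn : cs.length w using Nat.strong_induction_on generalizing w s k with
  | _ n ih =>
  subst hn
  by_cases hw : w = 1
  · subst hw
    rw [map_one, Matrix.one_apply]
    split_ifs <;> norm_num
  obtain ⟨t, ht⟩ := cs.exists_rightDescent_of_ne_one hw
  have ht' : cs.length (w * cs.simple t) < cs.length w := ht
  have hst : s ≠ t := by
    rintro rfl
    omega
  have step : ∀ (v : W) (i : Fin 4), cs.length v < cs.length (v * cs.simple i) ∨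
      cs.length (v * cs.simple i) + 1 = cs.length v := by
    intro v i
    rcases cs.length_mul_simple v i with h | h <;> omega
  -- The goal follows once w = v·l with l in the dihedral group of s and t, and v a shorter element
  -- lengthened by both s and t: induction applies to both columns of v. Below, letters t, s, t are
  -- stripped from the right of w until such a v is reached.
  have fin : ∀ (v : W) (l : List (Fin 4)), l ∈ [[t], [s, t], [t, s, t]] →
      l.length < CoxeterMatrix.F₄ s t → w = v * cs.wordProd l → cs.length v < cs.length w →
      cs.length v < cs.length (v * cs.simple s) → cs.length v < cs.length (v * cs.simple t) →
      0 ≤ f4Mat cs w k s := by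
    intro v l hl hlen hv hvw hs ht
    rw [hv]
    exact column_nonneg_of_mul cs hst hl hlen (fun k => ih _ hvw v s hs k rfl)
      (fun k => ih _ hvw v t ht k rfl) k
  have ss : ∀ (v : W) (i : Fin 4), v * cs.simple i * cs.simple i = v := fun v i =>
    cs.simple_mul_simple_cancel_right i
  have le : ∀ (v : W) (i : Fin 4), cs.length (v * cs.simple i) ≤ cs.length v + 1 := by
    intro v i
    rcases cs.length_mul_simple v i with h | h <;> omega
  have rel : ∀ m, CoxeterMatrix.F₄ s t = m → (cs.simple s * cs.simple t) ^ m = 1 := by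
    rintro m rfl
    exact cs.simple_mul_simple_pow s t
  obtain ⟨hm2, hm4⟩ := f4_entry_cases s t hst
  rcases step (w * cs.simple t) s with h1 | h1
  · refine fin (w * cs.simple t) [t] (by simp)
      (by simp only [List.length_cons, List.length_nil]; omega) ?_ ht' h1 ?_
    · simp [mul_assoc]
    · rwa [ss]
  have l2 := le (w * cs.simple t * cs.simple s) t
  -- If m(s,t) letters have been stripped, the braid relation writes s as the alternating word of
  -- length 2m(s,t) - 1 that starts and ends with t. Its first m(s,t) letters shorten w and the
  -- other m(s,t) - 1 restore less than was lost, so l(ws) < l(w), a contradiction. The cases m = 3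
  -- and m = 4 below are excluded in the same way.
  by_cases m2 : CoxeterMatrix.F₄ s t = 2
  · exfalso
    have e : cs.simple t * (cs.simple s * cs.simple t) = cs.simple s := by
      refine (eq_inv_of_mul_eq_one_right ?_).trans (cs.inv_simple s)
      rw [← rel 2 m2, pow_two, ← mul_assoc]
    simp only [mul_assoc] at l2 h1
    rw [e] at l2
    omega
  rcases step (w * cs.simple t * cs.simple s) t with h2 | h2
  · refine fin (w * cs.simple t * cs.simple s) [s, t] (by simp)
      (by simp only [List.length_cons, List.length_nil]; omega) ?_ (by omega) ?_ h2
    · simp [CoxeterSystem.wordProd, mul_assoc]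
    · rw [ss]; omega
  have l3 := le (w * cs.simple t * cs.simple s * cs.simple t) s
  have l3' := le (w * cs.simple t * cs.simple s * cs.simple t * cs.simple s) t
  by_cases m3 : CoxeterMatrix.F₄ s t = 3
  · exfalso
    have e : cs.simple t * (cs.simple s * (cs.simple t * (cs.simple s * cs.simple t))) =
        cs.simple s := by
      refine (eq_inv_of_mul_eq_one_right ?_).trans (cs.inv_simple s)
      rw [← rel 3 m3]
      simp only [pow_succ, pow_zero, one_mul, mul_assoc]
    simp only [mul_assoc] at l3 l3' h1 h2
    rw [e] at l3'
    omega
  rcases step (w * cs.simple t * cs.simple s * cs.simple t) s with h3 | h3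
  · refine fin (w * cs.simple t * cs.simple s * cs.simple t) [t, s, t] (by simp)
      (by simp only [List.length_cons, List.length_nil]; omega) ?_ (by omega) h3 ?_
    · simp [CoxeterSystem.wordProd, mul_assoc]
    · rw [ss]; omega
  exfalso
  have l4 := le (w * cs.simple t * cs.simple s * cs.simple t * cs.simple s) t
  have l4' := le (w * cs.simple t * cs.simple s * cs.simple t * cs.simple s * cs.simple t) s
  have l4'' := le (w * cs.simple t * cs.simple s * cs.simple t * cs.simple s * cs.simple t *
    cs.simple s) t
  have e : cs.simple t * (cs.simple s * (cs.simple t * (cs.simple s * (cs.simple t *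
      (cs.simple s * cs.simple t))))) = cs.simple s := by
    refine (eq_inv_of_mul_eq_one_right ?_).trans (cs.inv_simple s)
    rw [← rel 4 (by omega)]
    simp only [pow_succ, pow_zero, one_mul, mul_assoc]
  simp only [mul_assoc] at l4 l4' l4'' h1 h2 h3
  rw [e] at l4''
  omega

theorem column_nonpos (w : W) (s : Fin 4) (h : cs.length (w * cs.simple s) < cs.length w)
    (k : Fin 4) : f4Mat cs w k s ≤ 0 := by
  have h1 := column_nonneg cs (w * cs.simple s) s
    (by rwa [cs.simple_mul_simple_cancel_right]) k
  have h2 : ∀ k s : Fin 4, f4Refl s k s = - (1 : Matrix (Fin 4) (Fin 4) ℤ) k s := by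
    decide +kernel
  rw [map_mul, f4Mat_simple, Matrix.mul_apply] at h1
  simp only [h2, Matrix.one_apply, mul_neg, mul_ite, mul_one, mul_zero, Finset.sum_neg_distrib,
    Finset.sum_ite_eq', Finset.mem_univ, if_true] at h1
  linarith

/-- The action of a simple reflection on the functionals on the root lattice, in terms of their
values at the simple roots. -/
def heightStep (i : Fin 4) (p : ℤ × ℤ × ℤ × ℤ) : ℤ × ℤ × ℤ × ℤ :=
  match i, p with
  | 0, (a, b, c, d) => (-a, b + a, c, d)
  | 1, (a, b, c, d) => (a + b, -b, c + 2 * b, d)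
  | 2, (a, b, c, d) => (a, b + c, -c, d + c)
  | 3, (a, b, c, d) => (a, b, c + d, -d)

/-- The heights of the images of the simple roots under the inverse of an element given by a
word. -/
def wordHeight (l : List (Fin 4)) : ℤ × ℤ × ℤ × ℤ := l.foldr heightStep (1, 1, 1, 1)

/-- The `i`-th component of a quadruple. -/
def coord (p : ℤ × ℤ × ℤ × ℤ) : Fin 4 → ℤ := ![p.1, p.2.1, p.2.2.1, p.2.2.2]

/-- The height of `w⁻¹ α_j`. -/
noncomputable def height (w : W) (j : Fin 4) : ℤ := ∑ k, f4Mat cs w⁻¹ k j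

theorem height_simple_mul (i : Fin 4) (w : W) (j : Fin 4) :
    height cs (cs.simple i * w) j = height cs w j - CartanMatrix.F₄ i j * height cs w i := by
  unfold height
  rw [mul_inv_rev, cs.inv_simple, map_mul, f4Mat_simple, Finset.mul_sum, ← Finset.sum_sub_distrib]
  refine Finset.sum_congr rfl fun k _ => ?_
  simp only [Matrix.mul_apply, f4Refl, Matrix.of_apply, mul_sub, mul_ite, mul_one, mul_zero,
    Finset.sum_sub_distrib, Finset.sum_ite_eq', Finset.mem_univ, if_true]
  ring

theorem height_one (j : Fin 4) : height cs (1 : W) j = 1 := by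
  simp [height, Matrix.one_apply]

theorem coord_heightStep (i : Fin 4) (p : ℤ × ℤ × ℤ × ℤ) (j : Fin 4) :
    coord (heightStep i p) j = coord p j - CartanMatrix.F₄ i j * coord p i := by
  obtain ⟨a, b, c, d⟩ := p
  fin_cases i <;> fin_cases j <;> simp [coord, heightStep, CartanMatrix.F₄] <;> ring

theorem height_wordProd (l : List (Fin 4)) :
    height cs (cs.wordProd l) = coord (wordHeight l) := by
  induction l with
  | nil =>
    funext j
    rw [cs.wordProd_nil, height_one]
    fin_cases j <;> rfl
  | cons i l ih =>
    funext j
    rw [cs.wordProd_cons, height_simple_mul, ih, ← coord_heightStep]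
    rfl

theorem coord_injective : Function.Injective coord := by
  rintro ⟨a, b, c, d⟩ ⟨a', b', c', d'⟩ h
  have h0 := congrFun h 0
  have h1 := congrFun h 1
  have h2 := congrFun h 2
  have h3 := congrFun h 3
  simp [coord] at h0 h1 h2 h3
  simp [h0, h1, h2, h3]

theorem height_nonneg {w : W} {s : Fin 4} (h : cs.length w < cs.length (cs.simple s * w)) :
    0 ≤ height cs w s := by
  refine Finset.sum_nonneg fun k _ => column_nonneg cs w⁻¹ s ?_ k
  rwa [cs.length_inv, ← cs.inv_simple, ← mul_inv_rev, cs.length_inv]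

/-- The coefficients of w⁻¹α_s are all nonpositive; strictness holds because this vector, a column
of an invertible matrix, is not zero. -/
theorem height_neg {w : W} {s : Fin 4} (h : cs.length (cs.simple s * w) < cs.length w) :
    height cs w s < 0 := by
  have hc : ∀ k, f4Mat cs w⁻¹ k s ≤ 0 := by
    refine column_nonpos cs w⁻¹ s ?_
    rwa [cs.length_inv, ← cs.inv_simple, ← mul_inv_rev, cs.length_inv]
  refine lt_of_le_of_ne (Finset.sum_nonpos fun k _ => hc k) fun h0 => ?_
  have hz := (Finset.sum_eq_zero_iff_of_nonpos fun k _ => hc k).1 h0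
  have : (f4Mat cs w * f4Mat cs w⁻¹) s s = 0 := by
    rw [Matrix.mul_apply]
    exact Finset.sum_eq_zero fun k hk => by rw [hz k hk, mul_zero]
  rw [← map_mul, mul_inv_cancel, map_one, Matrix.one_apply_eq] at this
  exact one_ne_zero this

theorem height_neg_iff (w : W) (s : Fin 4) :
    height cs w s < 0 ↔ cs.length (cs.simple s * w) < cs.length w := by
  refine ⟨fun h => ?_, height_neg cs⟩
  by_contra h'
  rcases cs.length_simple_mul w s with h1 | h1
  · exact absurd (height_nonneg cs (by omega)) (not_le.mpr h)
  · omega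

theorem height_mul_congr {u v : W} (h : height cs u = height cs v) (x : W) :
    height cs (x * u) = height cs (x * v) := by
  induction x using cs.simple_induction_left with
  | one => simpa using h
  | mul_simple_left x i ih =>
    funext j
    rw [mul_assoc, mul_assoc, height_simple_mul, height_simple_mul, ih]

/-- The height functional takes the value 1 on every simple root and so is regular: an element
fixing it has no left descent, hence is trivial. -/
theorem height_injective : Function.Injective (height cs) := by
  intro u v h
  have h1 : height cs (v⁻¹ * u) = height cs 1 := by
    rw [height_mul_congr cs h, inv_mul_cancel]
  have h2 : v⁻¹ * u = 1 := by
    by_contra hne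
    obtain ⟨s, hs⟩ := cs.exists_leftDescent_of_ne_one hne
    have := height_neg cs hs
    rw [h1, height_one] at this
    norm_num at this
  rwa [inv_mul_eq_one, eq_comm] at h2

/-- Words with the same heights represent the same element. -/
theorem wordProd_eq_iff (l l' : List (Fin 4)) :
    cs.wordProd l = cs.wordProd l' ↔ wordHeight l = wordHeight l' := by
  rw [← (height_injective cs).eq_iff, height_wordProd, height_wordProd, coord_injective.eq_iff]

theorem wordProd_congr {l l' : List (Fin 4)} (h : wordHeight l = wordHeight l') :
    cs.wordProd l = cs.wordProd l' := (wordProd_eq_iff cs l l').2 h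

end Geometry

/-! ### A list of words covering the whole group. -/

section Enumeration

variable {W : Type*} [Group W] (cs : CoxeterSystem CoxeterMatrix.F₄ W)

/-- Reading a word from right to left, each new letter s either moves the representative x to
another one or passes through it as sx = xt with t in J'. The hypothesis is a finite check on
heights. -/
theorem exists_coset_word {J J' : List (Fin 4)} {X : List (List (Fin 4))} (h1 : [] ∈ X)
    (hX : ∀ x ∈ X, ∀ s ∈ J, (∃ y ∈ X, wordHeight (s :: x) = wordHeight y) ∨
      ∃ t ∈ J', wordHeight (s :: x) = wordHeight (x ++ [t]))
    (l : List (Fin 4)) (hl : ∀ s ∈ l, s ∈ J) :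
    ∃ x ∈ X, ∃ m : List (Fin 4), (∀ s ∈ m, s ∈ J') ∧
      cs.wordProd l = cs.wordProd (x ++ m) := by
  induction l with
  | nil => exact ⟨[], h1, [], by simp, rfl⟩
  | cons s l ih =>
    obtain ⟨x, hx, m, hm, e⟩ := ih fun i hi => hl i (List.mem_cons_of_mem _ hi)
    rcases hX x hx s (hl s List.mem_cons_self) with ⟨y, hy, h⟩ | ⟨t, ht, h⟩
    · refine ⟨y, hy, m, hm, ?_⟩
      rw [cs.wordProd_cons, e, cs.wordProd_append, ← mul_assoc, ← cs.wordProd_cons,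
        wordProd_congr cs h, cs.wordProd_append]
    · refine ⟨x, hx, t :: m, ?_, ?_⟩
      · simpa [ht] using hm
      · rw [cs.wordProd_cons, e, cs.wordProd_append, ← mul_assoc, ← cs.wordProd_cons,
          wordProd_congr cs h, ← cs.wordProd_append, List.append_assoc, List.singleton_append]

/-- Minimal coset representatives in the chain of standard parabolic subgroups of types
`F₄`, `B₃`, `A₂`, `A₁`. -/
def cosetWords : Fin 4 → List (List (Fin 4))
  | 3 => [[], [3], [2, 3], [1, 2, 3], [0, 1, 2, 3], [2, 1, 2, 3], [0, 2, 1, 2, 3],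
      [3, 2, 1, 2, 3], [0, 3, 2, 1, 2, 3], [1, 0, 2, 1, 2, 3], [1, 0, 3, 2, 1, 2, 3],
      [2, 1, 0, 2, 1, 2, 3], [2, 1, 0, 3, 2, 1, 2, 3], [3, 2, 1, 0, 2, 1, 2, 3],
      [1, 2, 1, 0, 3, 2, 1, 2, 3], [2, 3, 2, 1, 0, 2, 1, 2, 3], [0, 1, 2, 1, 0, 3, 2, 1, 2, 3],
      [1, 2, 3, 2, 1, 0, 2, 1, 2, 3], [0, 1, 2, 3, 2, 1, 0, 2, 1, 2, 3],
      [2, 1, 2, 3, 2, 1, 0, 2, 1, 2, 3], [0, 2, 1, 2, 3, 2, 1, 0, 2, 1, 2, 3],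
      [1, 0, 2, 1, 2, 3, 2, 1, 0, 2, 1, 2, 3], [2, 1, 0, 2, 1, 2, 3, 2, 1, 0, 2, 1, 2, 3],
      [3, 2, 1, 0, 2, 1, 2, 3, 2, 1, 0, 2, 1, 2, 3]]
  | 2 => [[], [2], [1, 2], [0, 1, 2], [2, 1, 2], [0, 2, 1, 2], [1, 0, 2, 1, 2],
      [2, 1, 0, 2, 1, 2]]
  | 1 => [[], [1], [0, 1]]
  | 0 => [[], [0]]

/-- A list of words representing all elements of the group. -/
def allWords : List (List (Fin 4)) :=
  (cosetWords 3).flatMap fun x => (cosetWords 2).flatMap fun y =>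
    (cosetWords 1).flatMap fun z => (cosetWords 0).map fun t => x ++ (y ++ (z ++ t))

theorem exists_mem_allWords (w : W) : ∃ l ∈ allWords, cs.wordProd l = w := by
  obtain ⟨l, rfl⟩ := cs.wordProd_surjective w
  obtain ⟨x, hx, l, hl, e3⟩ := exists_coset_word cs (J := [0, 1, 2, 3]) (J' := [0, 1, 2])
    (X := cosetWords 3) (by decide) (by decide +kernel) l (fun s _ => by fin_cases s <;> decide)
  obtain ⟨y, hy, l, hl, e2⟩ := exists_coset_word cs (J := [0, 1, 2]) (J' := [0, 1])
    (X := cosetWords 2) (by decide) (by decide +kernel) l hl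
  obtain ⟨z, hz, l, hl, e1⟩ := exists_coset_word cs (J := [0, 1]) (J' := [0])
    (X := cosetWords 1) (by decide) (by decide +kernel) l hl
  obtain ⟨t, ht, l, hl, e0⟩ := exists_coset_word cs (J := [0]) (J' := [])
    (X := cosetWords 0) (by decide) (by decide +kernel) l hl
  obtain rfl : l = [] := List.eq_nil_iff_forall_not_mem.2 fun s hs => by simpa using hl s hs
  refine ⟨x ++ (y ++ (z ++ t)), ?_, ?_⟩
  · simp only [allWords, List.mem_flatMap, List.mem_map]
    exact ⟨x, hx, y, hy, z, hz, t, ht, rfl⟩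
  · simp only [e3, e2, e1, e0, List.append_nil, cs.wordProd_append]

end Enumeration

/-! ### The nontrivial diagram automorphism. -/

section DiagramAutomorphism

variable {W : Type*} [Group W] (cs : CoxeterSystem CoxeterMatrix.F₄ W)

theorem simple_injective : Function.Injective cs.simple := by
  intro i j h
  have : wordHeight [i] = wordHeight [j] := by
    rw [← wordProd_eq_iff cs]
    simpa using h
  clear h
  revert i j
  decide +kernel

/-- The relations of orders 2 and 3 already leave only the identity and the reversal; the double
bond need not be tested. -/
theorem diagram_symmetry : ∀ a b c d : Fin 4, [a, b, c, d].Nodup →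
    (∀ l ∈ [[a, b, a, b, a, b], [a, c, a, c], [a, d, a, d], [b, d, b, d], [c, d, c, d, c, d]],
      wordHeight l = (1, 1, 1, 1)) → (a, b, c, d) ∈ [(0, 1, 2, 3), (3, 2, 1, 0)] := by
  decide +kernel

/-- A nontrivial automorphism of the Coxeter group of type `F₄` reverses the diagram. -/
theorem aut_simple {σ : MulAut W} (hσ : σ ∈ coxeterAut cs) (hσ2 : orderOf σ = 2) (i : Fin 4) :
    σ (cs.simple i) = cs.simple i.rev := by
  choose f hf using coxeterAut_simple cs hσ
  have hinj : ∀ i j, i ≠ j → f i ≠ f j := fun i j h h' => h (simple_injective cs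
    (σ.injective (by rw [hf, hf, h'])))
  have rel : ∀ (i j : Fin 4) (m : ℕ), CoxeterMatrix.F₄ i j = m →
      (cs.simple (f i) * cs.simple (f j)) ^ m = 1 := by
    rintro i j m rfl
    rw [← hf, ← hf, ← map_mul, ← map_pow, cs.simple_mul_simple_pow, map_one]
  have rel2 : ∀ (i j : Fin 4), CoxeterMatrix.F₄ i j = 2 →
      wordHeight [f i, f j, f i, f j] = (1, 1, 1, 1) := by
    intro i j h
    refine (wordProd_eq_iff cs _ []).1 ?_
    simpa [CoxeterSystem.wordProd, pow_succ, mul_assoc] using rel i j 2 h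
  have rel3 : ∀ (i j : Fin 4), CoxeterMatrix.F₄ i j = 3 →
      wordHeight [f i, f j, f i, f j, f i, f j] = (1, 1, 1, 1) := by
    intro i j h
    refine (wordProd_eq_iff cs _ []).1 ?_
    simpa [CoxeterSystem.wordProd, pow_succ, mul_assoc] using rel i j 3 h
  have h4 := diagram_symmetry (f 0) (f 1) (f 2) (f 3)
    (by simp [hinj _ _ (show (0 : Fin 4) ≠ 1 by decide), hinj _ _ (show (0 : Fin 4) ≠ 2 by decide),
      hinj _ _ (show (0 : Fin 4) ≠ 3 by decide), hinj _ _ (show (1 : Fin 4) ≠ 2 by decide),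
      hinj _ _ (show (1 : Fin 4) ≠ 3 by decide), hinj _ _ (show (2 : Fin 4) ≠ 3 by decide)])
    (by simp [rel3 0 1 rfl, rel2 0 2 rfl, rel2 0 3 rfl, rel2 1 3 rfl, rel3 2 3 rfl])
  simp only [List.mem_cons, Prod.mk.injEq, List.not_mem_nil, or_false] at h4
  rcases h4 with ⟨h0, h1, h2, h3⟩ | ⟨h0, h1, h2, h3⟩
  · exfalso
    have : σ = 1 := by
      ext w
      induction w using cs.simple_induction_left with
      | one => simp
      | mul_simple_left w i ih =>
        rw [map_mul, ih, hf]
        fin_cases i <;> simp [h0, h1, h2, h3]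
    rw [this, orderOf_one] at hσ2
    norm_num at hσ2
  · rw [hf]
    fin_cases i <;> simp [h0, h1, h2, h3]

theorem aut_wordProd {σ : MulAut W} (hσ : ∀ i, σ (cs.simple i) = cs.simple i.rev)
    (l : List (Fin 4)) : σ (cs.wordProd l) = cs.wordProd (l.map Fin.rev) := by
  induction l with
  | nil => simp
  | cons i l ih => rw [cs.wordProd_cons, map_mul, ih, hσ, List.map_cons, cs.wordProd_cons]

end DiagramAutomorphism

/-! ### Tables for the elements with square 1, verified by computation. -/

section InvolutionTable

/-- The word whose letters are the digits to base `4` of a number with leading digit `1`. -/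
def decodeWord : ℕ → ℕ → List (Fin 4)
  | 0, _ => []
  | k + 1, n => if n < 4 then [] else Fin.ofNat 4 n :: decodeWord k (n / 4)

/-- Encoded reduced words for the `140` elements with `t ^ 2 = 1`. -/
def involCodes : List ℕ :=
  [72548, 1973092, 1601124, 7892580, 1188588644, 4757941348, 4754356324, 104931113060,
   4754354564, 19031765380, 297371364, 25614436, 400280, 1973144, 1159556, 76069705828, 18148,
   419724449892, 123316, 6558194584, 30961028, 76069691780, 304278823300, 72580, 2087817079908,
   1124, 8351268321380, 6244, 459388440, 1601048, 4757941636, 1519236080004, 8351268319620,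
   4484, 104931112472, 30828, 123320, 28935896, 370893188, 28067176880228, 133620293146724,
   104548, 1991092, 2087817080344, 1560, 6936, 23181700, 123844996, 6076944310660, 1935044,
   133620293132676, 90500, 6852338052, 112268707520900, 534481172586884, 418180, 130488567492,
   68, 452, 7964356, 428271128, 8155535468, 4, 28, 32622141880, 24, 1837557272, 440, 28711704,
   115743512, 5795425, 30961249, 1519236077665, 483761, 33405073283169, 22625, 28067176880225,
   133620293146721, 104545, 1991089, 107067782, 1754198555014, 8351268321670, 6534, 2038883867,
   1, 7, 124443, 8155535470, 6, 459389318, 110, 7177926, 28935878, 94952255073, 521954270049,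
   353, 428271129, 8155535469, 5, 29, 1808494, 23181409, 6132521057, 24530098273, 5857,
   130488567526, 102, 438, 105350, 384179041, 1935073, 130488567513, 89, 521954270105, 409,
   6905425286, 1947, 7790, 28711814, 93281, 6132524569, 1465, 27621701145, 7789, 431589094,
   383282273, 1536715873, 24011193, 1685017, 26342, 124646, 5849, 124633, 105369, 498585,
   95820569, 384178969, 383282713, 6905425433]

/-- A reduced word for the `i`-th element with `t ^ 2 = 1`. -/
def involWord (i : Fin 140) : List (Fin 4) := decodeWord 24 (involCodes.getD i 0)

/-- The operators `R(s)` in the basis of the `a_t`; the digit to base `512` at position `i` is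
`2 j + ε` if `a_t` for the `i`-th `t` is sent to `(-1) ^ ε` times the `j`-th basis vector. -/
def involTable : Fin 4 → ℕ
  | 0 =>
    543726177098191863891138438797450469937575442232718829913509495589169274643306094238170013423485616863852876822681990586402834392742936969199444602185453780300180610303257761773792590684837750185996831670246360540105061500637318180805860132859419392845020579981721505066198125905402850416102850725579520292991905362409287071691411228790509097524207181920745331867556927235036424
  | 1 =>
    9711192958001765328986842025561315506169195902864873412137288933613585100953870354513949371500605699774915781296149547971945680860874761242608331668316342600983192661831401884935196070323136375318688478728664327607641704953135111969255617066619660314737219919595046036622359923841091299981622910224893738317397901498120224292738309320628420829478780142583255277457803504956493852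
  | 2 =>
    10644701621969841112064937183117860978684960063598404360640609923631721590179826131425420612347239654191278048479087876848790026306233015172470102733958752412647263698520665709150266752988438023135548679214011804728153456483645721970439924221648284729596486986600536693843913801306665903052611283496471110497277316504794686493730031890000476899166256853486500022746386547802637316
  | 3 =>
    10722322043590173683800186244429520686358423666467955430953632510222831412925034320151553292445399536788873490551638003944544640160196543897041554524050571609996735414390342311088923410654170518803854772947061818545295021861909456748767096843109632739090791538790401665104002307333819458851478813415681712148647063053367663491701301356901471641400810672043416867023020874406035458

/-- The action of the diagram automorphism on the elements with `t ^ 2 = 1`, in the format of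
`involTable`. -/
def diagramTable : ℕ :=
  4047056122125753857413162407035328744693744205109435235442801207824468256621570129899242394652577774084089332065271222484141727300292117888131019266648345223850104339471492811884680980922369730020130037493037814702012748267738127287160231425880960651000690892123085432669074677848053756256992959202814412599741203793994771854362370532722990808097233157806721759475474547682617518

/-- The index part of the entry of a table. -/
def tableIndex (T : ℕ) (i : Fin 140) : Fin 140 := Fin.ofNat 140 (T / 512 ^ (i : ℕ) % 512 / 2)

/-- The sign part of the entry of a table. -/
def tableSign (T : ℕ) (i : Fin 140) : ℤ := if T / 512 ^ (i : ℕ) % 2 = 1 then -1 else 1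

/-- A strictly monotone code for heights in the relevant range. -/
def heightCode (p : ℤ × ℤ × ℤ × ℤ) : ℤ := ((p.1 * 64 + p.2.1) * 64 + p.2.2.1) * 64 + p.2.2.2

/-- The list is sorted by height code, so comparing neighbours suffices to see that the 140 elements
are distinct. -/
theorem involWord_strictMono : ∀ i : Fin 139,
    heightCode (wordHeight (involWord i.castSucc)) < heightCode (wordHeight (involWord i.succ)) := by
  decide +kernel

theorem involWord_sq : ∀ i : Fin 140, wordHeight (involWord i ++ involWord i) = (1, 1, 1, 1) := by
  decide +kernel

/-- If s and t commute, then l(ts) < l(t) means that s is a left descent of t, which is read off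
from the sign of a height. -/
theorem involTable_comm : ∀ (s : Fin 4) (i : Fin 140),
    wordHeight (s :: involWord i) = wordHeight (involWord i ++ [s]) →
    tableIndex (involTable s) i = i ∧ tableSign (involTable s) i =
      if coord (wordHeight (involWord i)) s < 0 then -1 else 1 := by
  decide +kernel

theorem involTable_noncomm : ∀ (s : Fin 4) (i : Fin 140),
    wordHeight (s :: involWord i) ≠ wordHeight (involWord i ++ [s]) →
    wordHeight (s :: involWord i ++ [s]) = wordHeight (involWord (tableIndex (involTable s) i)) ∧
      tableSign (involTable s) i = 1 := by
  decide +kernel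

theorem diagramTable_spec : ∀ i : Fin 140, wordHeight ((involWord i).map Fin.rev) =
    wordHeight (involWord (tableIndex diagramTable i)) := by
  decide +kernel

theorem exists_involWord : ∀ l ∈ allWords, wordHeight (l ++ l) = (1, 1, 1, 1) →
    ∃ i : Fin 140, wordHeight l = wordHeight (involWord i) := by
  decide +kernel

end InvolutionTable

/-! ### The character of the extended involution module on the nontrivial coset. -/

section InvolutionTrace

variable {W : Type*} [Group W] (cs : CoxeterSystem CoxeterMatrix.F₄ W)

/-- The `i`-th element with `t ^ 2 = 1`. -/
noncomputable def involElt (i : Fin 140) : Invol W :=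
  ⟨cs.wordProd (involWord i), by
    rw [pow_two, ← cs.wordProd_append, ← cs.wordProd_nil]
    exact wordProd_congr cs (involWord_sq i)⟩

/-- Surjectivity comes from testing all words of `allWords`, injectivity from the sorting. -/
theorem involElt_bijective : Function.Bijective (involElt cs) := by
  constructor
  · have hm : StrictMono fun i : Fin 140 => heightCode (wordHeight (involWord i)) :=
      Fin.strictMono_iff_lt_succ.2 involWord_strictMono
    intro i j h
    refine hm.injective (congrArg heightCode ?_)
    exact (wordProd_eq_iff cs _ _).1 (congrArg Subtype.val h)
  · rintro ⟨t, ht⟩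
    obtain ⟨l, hl, rfl⟩ := exists_mem_allWords cs t
    rw [pow_two, ← cs.wordProd_append, ← cs.wordProd_nil] at ht
    obtain ⟨i, hi⟩ := exists_involWord l hl ((wordProd_eq_iff cs _ _).1 ht)
    exact ⟨i, Subtype.ext (wordProd_congr cs hi.symm)⟩

theorem genOp_involElt (s : Fin 4) (i : Fin 140) (a : ℚ) :
    genOp cs s (Finsupp.single (involElt cs i) a) =
      Finsupp.single (involElt cs (tableIndex (involTable s) i))
        (a * tableSign (involTable s) i) := by
  rw [genOp, Finsupp.linearCombination_single]
  have hc : cs.simple s * (involElt cs i).1 = (involElt cs i).1 * cs.simple s ↔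
      wordHeight (s :: involWord i) = wordHeight (involWord i ++ [s]) := by
    rw [← wordProd_eq_iff cs, cs.wordProd_cons, cs.wordProd_append, cs.wordProd_singleton]
    rfl
  have hd : coord (wordHeight (involWord i)) s < 0 ↔
      cs.length (cs.simple s * (involElt cs i).1) < cs.length (involElt cs i).1 := by
    rw [← height_neg_iff, involElt, height_wordProd]
  by_cases h : cs.simple s * (involElt cs i).1 = (involElt cs i).1 * cs.simple s
  · obtain ⟨h1, h2⟩ := involTable_comm s i (hc.1 h)
    have hconj : involPerm (MulAut.conj (cs.simple s)) (involElt cs i) = involElt cs i := by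
      apply Subtype.ext
      simp [h]
    rw [h1, h2, hconj, ← h]
    simp only [true_and, ← hd]
    split_ifs <;> simp
  · obtain ⟨h1, h2⟩ := involTable_noncomm s i (mt hc.2 h)
    have hconj : involPerm (MulAut.conj (cs.simple s)) (involElt cs i) =
        involElt cs (tableIndex (involTable s) i) := by
      apply Subtype.ext
      rw [involPerm_coe, MulAut.conj_apply, cs.inv_simple]
      have := wordProd_congr cs h1
      rw [cs.wordProd_append, cs.wordProd_cons, cs.wordProd_singleton] at this
      exact this
    rw [if_neg (fun h' => h h'.1), hconj, h2]
    simp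

/-- The image of a signed basis vector under the operator of a word. -/
def involStep (l : List (Fin 4)) (p : Fin 140 × ℤ) : Fin 140 × ℤ :=
  l.foldr (fun s q => (tableIndex (involTable s) q.1, q.2 * tableSign (involTable s) q.1)) p

theorem invRep_involElt (l : List (Fin 4)) (p : Fin 140 × ℤ) :
    invRep cs (cs.wordProd l) (Finsupp.single (involElt cs p.1) (p.2 : ℚ)) =
      Finsupp.single (involElt cs (involStep l p).1) ((involStep l p).2 : ℚ) := by
  induction l with
  | nil => simp [involStep]
  | cons s l ih =>
    rw [cs.wordProd_cons, map_mul, Module.End.mul_apply, ih, invRep_simple, genOp_involElt]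
    simp [involStep]

/-- The trace of the operator of a word followed by the diagram automorphism. -/
def involTrace (l : List (Fin 4)) : ℤ :=
  ((List.finRange 140).map fun i =>
    let q := involStep l (tableIndex diagramTable i, 1)
    if q.1 = i then q.2 else 0).sum

theorem involPerm_involElt {σ : MulAut W} (hσ : ∀ i, σ (cs.simple i) = cs.simple i.rev)
    (i : Fin 140) : involPerm σ (involElt cs i) = involElt cs (tableIndex diagramTable i) := by
  apply Subtype.ext
  rw [involPerm_coe]
  exact (aut_wordProd cs hσ _).trans (wordProd_congr cs (diagramTable_spec i))

theorem extInvChar_coset {σ : MulAut W} (hσ : σ ∈ coxeterAut cs)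
    (hσ' : ∀ i, σ (cs.simple i) = cs.simple i.rev) (l : List (Fin 4)) :
    extInvChar cs σ hσ (cosetElt σ (cs.wordProd l)) = (involTrace l : ℤ) := by
  classical
  have e : ∀ i, extInvRep cs σ hσ (cosetElt σ (cs.wordProd l))
      (Finsupp.single (involElt cs i) 1) =
      Finsupp.single (involElt cs (involStep l (tableIndex diagramTable i, 1)).1)
        ((involStep l (tableIndex diagramTable i, 1)).2 : ℚ) := by
    intro i
    have : extInvRep cs σ hσ (cosetElt σ (cs.wordProd l)) =
        invRep cs (cs.wordProd l) * permOp σ := by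
      simp [extInvRep, cosetElt]
    rw [this, Module.End.mul_apply, permOp_single, involPerm_involElt cs hσ', ← invRep_involElt]
    simp
  let b : Module.Basis (Fin 140) ℚ (InvMod W) :=
    Finsupp.basisSingleOne.reindex (Equiv.ofBijective _ (involElt_bijective cs)).symm
  have hb : ∀ i, b i = Finsupp.single (involElt cs i) 1 := fun i => by
    simp [b]
  have hr : ∀ i (x : InvMod W), b.repr x i = x (involElt cs i) := fun i x => by
    simp [b]
  rw [extInvChar, Representation.character, LinearMap.trace_eq_matrix_trace ℚ b, Matrix.trace,
    involTrace, ← Fin.sum_univ_def, Int.cast_sum]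
  refine Finset.sum_congr rfl fun i _ => ?_
  rw [Matrix.diag_apply, LinearMap.toMatrix_apply, hr, hb, e, Finsupp.single_apply]
  simp only [(involElt_bijective cs).injective.eq_iff]
  split_ifs <;> simp

end InvolutionTrace

/-! ### Reduction of the coset W.σ to 96 elements. -/

section TwistedClasses

variable {W : Type*} [Group W] (cs : CoxeterSystem CoxeterMatrix.F₄ W)

/-- The images of the simple reflections in the product of two symmetric groups. -/
def symGen : Fin 4 → Equiv.Perm (Fin 3) × Equiv.Perm (Fin 3) :=
  ![(Equiv.swap 0 1, 1), (Equiv.swap 1 2, 1), (1, Equiv.swap 1 2), (1, Equiv.swap 0 1)]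

theorem symGen_liftable : CoxeterMatrix.F₄.IsLiftable symGen := by
  unfold CoxeterMatrix.IsLiftable
  decide +kernel

/-- The quotient of the group by its largest normal `2`-subgroup. -/
noncomputable def symQuot : W →* Equiv.Perm (Fin 3) × Equiv.Perm (Fin 3) :=
  cs.lift ⟨symGen, symGen_liftable⟩

/-- The image of a word in the product of two symmetric groups. -/
def wordQuot (l : List (Fin 4)) : Equiv.Perm (Fin 3) × Equiv.Perm (Fin 3) :=
  (l.map symGen).prod

theorem symQuot_wordProd (l : List (Fin 4)) : symQuot cs (cs.wordProd l) = wordQuot l := by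
  rw [CoxeterSystem.wordProd, map_list_prod, List.map_map, wordQuot]
  congr 2
  funext i
  exact cs.lift_apply_simple symGen_liftable i

theorem wordQuot_rev (l : List (Fin 4)) : wordQuot (l.map Fin.rev) = (wordQuot l).swap := by
  induction l with
  | nil => rfl
  | cons i l ih =>
    have h : symGen i.rev = (symGen i).swap := by
      revert i
      decide +kernel
    simp only [wordQuot, List.map_cons, List.prod_cons] at ih ⊢
    rw [ih, h]
    rfl

/-- Words for the elements of the largest normal `2`-subgroup. -/
def kernelWords : List (List (Fin 4)) := allWords.filter fun l => wordQuot l = 1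

/-- Twisted conjugation by (a, b) sends (x, y) to (a x b⁻¹, b y a⁻¹), so the class is determined by
the conjugacy class of xy in S₃. The three words give the identity, a transposition and a 3-cycle in
the first factor. -/
theorem exists_quot_conj : ∀ x : Equiv.Perm (Fin 3) × Equiv.Perm (Fin 3),
    ∃ a ∈ ([[], [0], [1], [0, 1], [1, 0], [0, 1, 0]] : List (List (Fin 4))),
    ∃ b ∈ ([[], [2], [3], [2, 3], [3, 2], [2, 3, 2]] : List (List (Fin 4))),
    ∃ c ∈ ([[], [0], [0, 1]] : List (List (Fin 4))),
      wordQuot (a ++ b) * x = wordQuot c * (wordQuot (a ++ b)).swap := by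
  decide +kernel

theorem exists_twisted_conj {σ : MulAut W} (hσ : ∀ i, σ (cs.simple i) = cs.simple i.rev)
    (w : W) : ∃ g : W, ∃ l ∈ kernelWords, ∃ c ∈ ([[], [0], [0, 1]] : List (List (Fin 4))),
      g * w * (σ g)⁻¹ = cs.wordProd (l ++ c) := by
  obtain ⟨a, -, b, -, c, hc, h⟩ := exists_quot_conj (symQuot cs w)
  obtain ⟨l, hl, e⟩ := exists_mem_allWords cs
    (cs.wordProd (a ++ b) * w * (σ (cs.wordProd (a ++ b)))⁻¹ * (cs.wordProd c)⁻¹)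
  refine ⟨cs.wordProd (a ++ b), l, ?_, c, hc, ?_⟩
  · rw [kernelWords, List.mem_filter, decide_eq_true_eq, ← symQuot_wordProd cs, e]
    refine ⟨hl, ?_⟩
    simp only [map_mul, map_inv, symQuot_wordProd, aut_wordProd cs hσ, wordQuot_rev]
    rw [h]
    simp
  · rw [cs.wordProd_append l c, e, inv_mul_cancel_right]

end TwistedClasses

/-! ### Induced representations as block monomial matrices, and the data for degrees 1, 6, 9, 12. -/

section BlockMonomial

/-- A block monomial integer matrix with `m` block columns and blocks of size `q`: the block in
column `j` is `blk j`, in row `idx j`. -/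
@[ext] structure BlockMon (m q : ℕ) where
  idx : Fin m → Fin m
  blk : Fin m → Matrix (Fin q) (Fin q) ℤ

namespace BlockMon

variable {m q : ℕ}

instance : Mul (BlockMon m q) :=
  ⟨fun A B => ⟨fun j => A.idx (B.idx j), fun j => A.blk (B.idx j) * B.blk j⟩⟩

instance : One (BlockMon m q) := ⟨⟨id, fun _ => 1⟩⟩

instance : DecidableEq (BlockMon m q) := fun A B =>
  decidable_of_iff (A.idx = B.idx ∧ A.blk = B.blk)
    ⟨fun h => BlockMon.ext h.1 h.2, fun h => by rw [h]; exact ⟨rfl, rfl⟩⟩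

instance : Monoid (BlockMon m q) where
  mul_assoc A B C := BlockMon.ext rfl (funext fun _ => Matrix.mul_assoc _ _ _)
  one_mul A := BlockMon.ext rfl (funext fun _ => Matrix.one_mul _)
  mul_one A := BlockMon.ext rfl (funext fun _ => Matrix.mul_one _)

theorem mul_idx (A B : BlockMon m q) (j : Fin m) : (A * B).idx j = A.idx (B.idx j) := rfl

theorem mul_blk (A B : BlockMon m q) (j : Fin m) :
    (A * B).blk j = A.blk (B.idx j) * B.blk j := rfl

/-- The operator of a block monomial matrix on vectors. -/
noncomputable def toEnd : BlockMon m q →* Module.End ℂ (Fin m × Fin q → ℂ) where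
  toFun A := (Pi.basisFun ℂ (Fin m × Fin q)).constr ℂ fun p =>
    ∑ a, (A.blk p.1 a p.2 : ℂ) • Pi.single (A.idx p.1, a) 1
  map_one' := by
    refine (Pi.basisFun ℂ _).ext fun p => ?_
    rw [Module.Basis.constr_basis]
    simp [show (1 : BlockMon m q) = ⟨id, fun _ => 1⟩ from rfl, Matrix.one_apply]
  map_mul' A B := by
    refine (Pi.basisFun ℂ _).ext fun p => ?_
    rw [Module.Basis.constr_basis, Module.End.mul_apply, Module.Basis.constr_basis, map_sum]
    simp only [map_smul, ← Pi.basisFun_apply, Module.Basis.constr_basis, mul_idx, mul_blk,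
      Matrix.mul_apply, Int.cast_sum, Int.cast_mul, Finset.sum_smul, Finset.smul_sum, smul_smul]
    rw [Finset.sum_comm]
    simp only [mul_comm]

theorem toEnd_single (A : BlockMon m q) (j : Fin m) (b : Fin q) :
    toEnd A (Pi.single (j, b) 1) = ∑ a, (A.blk j a b : ℂ) • Pi.single (A.idx j, a) 1 := by
  rw [← Pi.basisFun_apply]
  exact Module.Basis.constr_basis _ _ _ _

/-- The trace of a block monomial matrix. -/
def trace (A : BlockMon m q) : ℤ :=
  ((List.finRange m).map fun j => if A.idx j = j then Matrix.trace (A.blk j) else 0).sum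

theorem trace_toEnd (A : BlockMon m q) : LinearMap.trace ℂ _ (toEnd A) = (A.trace : ℂ) := by
  rw [LinearMap.trace_eq_matrix_trace ℂ (Pi.basisFun ℂ _), Matrix.trace, trace,
    ← Fin.sum_univ_def, Fintype.sum_prod_type, Int.cast_sum]
  refine Finset.sum_congr rfl fun j _ => ?_
  simp only [Matrix.diag_apply, LinearMap.toMatrix_apply, Pi.basisFun_apply, toEnd_single,
    Pi.basisFun_repr, Finset.sum_apply, Pi.smul_apply, Pi.single_apply, Prod.mk.injEq]
  by_cases h : A.idx j = j
  · simp [h, Matrix.trace]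
  · simp [h, Ne.symm h]

end BlockMon

/-- Data of a block monomial representation of the Coxeter group of type `F₄`: coset representatives
of a subgroup, generators of the subgroup with integer matrices, and the cosets and subgroup
elements arising from the products of simple reflections and representatives. -/
structure InducedDatum (m q g : ℕ) where
  coset : Fin m → List (Fin 4)
  gen : Fin g → List (Fin 4)
  act : Fin g → Matrix (Fin q) (Fin q) ℤ
  idx : Fin 4 → Fin m → Fin m
  stab : Fin 4 → Fin m → List (Fin g)

namespace InducedDatum

variable {m q g : ℕ} (D : InducedDatum m q g)

/-- The block monomial matrix of a simple reflection. -/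
def simpleMon (s : Fin 4) : BlockMon m q :=
  ⟨D.idx s, fun j => ((D.stab s j).map D.act).prod⟩

/-- The block monomial matrix of a word. -/
def wordMon (l : List (Fin 4)) : BlockMon m q := (l.map D.simpleMon).prod

/-- The compatibilities that make the data define an induced representation. -/
structure IsValid [NeZero m] : Prop where
  liftable : CoxeterMatrix.F₄.IsLiftable D.simpleMon
  mul_coset : ∀ s j, wordHeight (s :: D.coset j) =
    wordHeight (D.coset (D.idx s j) ++ (D.stab s j).flatMap D.gen)
  coset_zero : D.coset 0 = []
  wordMon_coset : ∀ j, (D.wordMon (D.coset j)).idx 0 = j ∧ (D.wordMon (D.coset j)).blk 0 = 1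
  wordMon_reverse : ∀ j, (D.wordMon (D.coset j).reverse).idx j = 0 ∧
    (D.wordMon (D.coset j).reverse).blk j = 1

variable [NeZero m] {D} (hD : D.IsValid)
variable {W : Type*} [Group W] (cs : CoxeterSystem CoxeterMatrix.F₄ W)

/-- The homomorphism to block monomial matrices. -/
noncomputable def monHom (hD : D.IsValid) : W →* BlockMon m q := cs.lift ⟨_, hD.liftable⟩

theorem monHom_wordProd (l : List (Fin 4)) : monHom cs hD (cs.wordProd l) = D.wordMon l := by
  rw [CoxeterSystem.wordProd, map_list_prod, List.map_map, wordMon]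
  congr 2
  funext i
  exact cs.lift_apply_simple hD.liftable i

/-- The block monomial representation. -/
noncomputable def rep (hD : D.IsValid) : Representation ℂ W (Fin m × Fin q → ℂ) :=
  BlockMon.toEnd.comp (monHom cs hD)

theorem rep_wordProd_single (l : List (Fin 4)) (j : Fin m) (b : Fin q) :
    rep cs hD (cs.wordProd l) (Pi.single (j, b) 1) =
      ∑ a, ((D.wordMon l).blk j a b : ℂ) • Pi.single ((D.wordMon l).idx j, a) 1 := by
  rw [← monHom_wordProd hD cs]
  exact BlockMon.toEnd_single _ _ _

theorem rep_coset (j : Fin m) (b : Fin q) :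
    rep cs hD (cs.wordProd (D.coset j)) (Pi.single (0, b) 1) = Pi.single (j, b) 1 := by
  rw [rep_wordProd_single, (hD.wordMon_coset j).1, (hD.wordMon_coset j).2]
  simp [Matrix.one_apply]

theorem rep_reverse (j : Fin m) (b : Fin q) :
    rep cs hD (cs.wordProd (D.coset j).reverse) (Pi.single (j, b) 1) = Pi.single (0, b) 1 := by
  rw [rep_wordProd_single, (hD.wordMon_reverse j).1, (hD.wordMon_reverse j).2]
  simp [Matrix.one_apply]

/-- The prescribed action of the generators of the inducing subgroup propagates to products of
generators. This is what makes the map in Frobenius reciprocity commute with simple reflections. -/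
theorem apply_flatMap_gen {U : Type*} [AddCommGroup U] [Module ℂ U] (R : Representation ℂ W U)
    (v : Fin q → U)
    (hv : ∀ i b, R (cs.wordProd (D.gen i)) (v b) = ∑ a, (D.act i a b : ℂ) • v a)
    (h : List (Fin g)) (b : Fin q) :
    R (cs.wordProd (h.flatMap D.gen)) (v b) = ∑ a, ((h.map D.act).prod a b : ℂ) • v a := by
  induction h generalizing b with
  | nil => simp [Matrix.one_apply]
  | cons i h ih =>
    rw [List.flatMap_cons, cs.wordProd_append, map_mul, Module.End.mul_apply, ih, map_sum]
    simp only [map_smul, hv, List.map_cons, List.prod_cons, Matrix.mul_apply, Int.cast_sum,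
      Int.cast_mul, Finset.sum_smul, Finset.smul_sum, smul_smul]
    rw [Finset.sum_comm]
    simp only [mul_comm]

/-- The universal property of the induced representation. -/
theorem exists_intertwining {U : Type*} [AddCommGroup U] [Module ℂ U] (R : Representation ℂ W U)
    (v : Fin q → U)
    (hv : ∀ i b, R (cs.wordProd (D.gen i)) (v b) = ∑ a, (D.act i a b : ℂ) • v a) :
    ∃ f : Representation.IntertwiningMap (rep cs hD) R,
      ∀ j b, f (Pi.single (j, b) 1) = R (cs.wordProd (D.coset j)) (v b) := by
  let F : (Fin m × Fin q → ℂ) →ₗ[ℂ] U := (Pi.basisFun ℂ (Fin m × Fin q)).constr ℂ fun p =>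
    R (cs.wordProd (D.coset p.1)) (v p.2)
  have hF : ∀ j b, F (Pi.single (j, b) 1) = R (cs.wordProd (D.coset j)) (v b) := fun j b => by
    rw [← Pi.basisFun_apply]
    exact Module.Basis.constr_basis _ _ _ _
  have hs : ∀ s, F ∘ₗ rep cs hD (cs.simple s) = R (cs.simple s) ∘ₗ F := by
    intro s
    refine (Pi.basisFun ℂ _).ext fun p => ?_
    obtain ⟨j, b⟩ := p
    have e := rep_wordProd_single hD cs [s] j b
    have e1 : D.wordMon [s] = D.simpleMon s := by simp [wordMon]
    rw [cs.wordProd_singleton, e1] at e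
    rw [Pi.basisFun_apply, LinearMap.comp_apply, LinearMap.comp_apply, e, hF, map_sum]
    simp only [map_smul, hF]
    rw [← Module.End.mul_apply, ← map_mul, ← cs.wordProd_cons,
      wordProd_congr cs (hD.mul_coset s j), cs.wordProd_append, map_mul, Module.End.mul_apply,
      apply_flatMap_gen cs R v hv, map_sum]
    simp only [map_smul]
    rfl
  refine ⟨⟨F, fun w => ?_⟩, hF⟩
  induction w using cs.simple_induction_left with
  | one => simp [Module.End.one_eq_id]
  | mul_simple_left w i ih =>
    rw [map_mul, map_mul, Module.End.mul_eq_comp, Module.End.mul_eq_comp, ← LinearMap.comp_assoc,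
      hs, LinearMap.comp_assoc, ih, LinearMap.comp_assoc]

theorem exists_intertwining_ne_zero {U : Type*} [AddCommGroup U] [Module ℂ U]
    (R : Representation ℂ W U) (v : Fin q → U)
    (hv : ∀ i b, R (cs.wordProd (D.gen i)) (v b) = ∑ a, (D.act i a b : ℂ) • v a)
    {b : Fin q} (hb : v b ≠ 0) :
    ∃ f : Representation.IntertwiningMap (rep cs hD) R, f ≠ 0 := by
  obtain ⟨f, hf⟩ := exists_intertwining hD cs R v hv
  refine ⟨f, fun h0 => hb ?_⟩
  have := hf 0 b
  rw [hD.coset_zero, cs.wordProd_nil, map_one, Module.End.one_apply, h0] at this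
  exact this.symm

end InducedDatum

/-- Words for four involutions that generate the largest normal `2`-subgroup modulo its center. -/
def normalWord : Fin 4 → List (Fin 4) :=
  ![[1, 2, 1, 2], [0, 1, 2, 1, 2, 0], [3, 1, 2, 1, 2, 3], [0, 3, 1, 2, 1, 2, 3, 0]]

/-- The linear characters. -/
def datumOne (d e : ℤ) : InducedDatum 1 1 4 where
  coset := ![[]]
  gen := ![[0], [1], [2], [3]]
  act := ![!![d], !![d], !![e], !![e]]
  idx := fun _ => id
  stab := ![![[0]], ![[1]], ![[2]], ![[3]]]

/-- The characters of degree `9`, induced from linear characters of a Sylow `2`-subgroup. -/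
def datumNine (d e : ℤ) : InducedDatum 9 1 6 where
  coset := ![[], [3], [2, 3], [0], [0, 3], [0, 2, 3], [1, 0], [1, 0, 3], [1, 0, 2, 3]]
  gen := ![[1], [2], normalWord 0, normalWord 1, normalWord 2, normalWord 3]
  act := ![!![d], !![e], 1, 1, 1, -1]
  idx := ![![3, 4, 5, 0, 1, 2, 6, 7, 8], ![0, 1, 2, 6, 7, 8, 3, 4, 5],
    ![0, 2, 1, 3, 5, 4, 6, 8, 7], ![1, 0, 2, 4, 3, 5, 7, 6, 8]]
  stab := ![![[], [], [], [], [], [], [0], [0], [0, 4]],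
    ![[0], [0], [0, 4], [], [], [], [], [], []], ![[1], [], [], [1], [], [], [1, 3], [5], [5]],
    ![[], [], [1], [], [], [1], [], [], [1]]]

/-- The characters of degrees `6` and `12`, induced from a subgroup of index `6`. -/
def datumSix {q : ℕ} (u v : Matrix (Fin q) (Fin q) ℤ) : InducedDatum 6 q 6 where
  coset := ![[], [0], [1], [0, 1], [1, 0], [0, 1, 0]]
  gen := ![[0, 3], [1, 2], normalWord 0, normalWord 1, normalWord 2, normalWord 3]
  act := ![u, v, 1, -1, -1, 1]
  idx := ![![1, 0, 3, 2, 5, 4], ![2, 4, 0, 5, 1, 3], ![2, 3, 0, 1, 5, 4], ![1, 0, 4, 5, 2, 3]]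
  stab := ![![[], [], [], [], [], []], ![[], [], [], [], [], []],
    ![[1], [1], [1, 2], [1, 2], [1, 3], [1, 3]], ![[0], [0], [0], [0], [0], [0]]]

/-- The action of the first generator of the symmetric group of degree `3` on its representation of
degree `2`. -/
def twoDimU : Matrix (Fin 2) (Fin 2) ℤ := !![0, 1; 1, 0]

/-- Minus the action of the second generator of the symmetric group of degree `3` on its
representation of degree `2`. -/
def twoDimV : Matrix (Fin 2) (Fin 2) ℤ := !![-1, 1; 0, 1]

theorem datumOne_isValid (d e : ℤˣ) : (datumOne d e).IsValid where
  liftable := by unfold CoxeterMatrix.IsLiftable; revert d e; decide +kernel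
  mul_coset := by revert d e; decide +kernel
  coset_zero := rfl
  wordMon_coset := by revert d e; decide +kernel
  wordMon_reverse := by revert d e; decide +kernel

theorem datumNine_isValid (d e : ℤˣ) : (datumNine d e).IsValid where
  liftable := by unfold CoxeterMatrix.IsLiftable; revert d e; decide +kernel
  mul_coset := by revert d e; decide +kernel
  coset_zero := rfl
  wordMon_coset := by revert d e; decide +kernel
  wordMon_reverse := by revert d e; decide +kernel

theorem datumSix_isValid (d : ℤˣ) : (datumSix !![(d : ℤ)] !![-(d : ℤ)]).IsValid where
  liftable := by unfold CoxeterMatrix.IsLiftable; revert d; decide +kernel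
  mul_coset := by revert d; decide +kernel
  coset_zero := rfl
  wordMon_coset := by revert d; decide +kernel
  wordMon_reverse := by revert d; decide +kernel

theorem datumTwelve_isValid : (datumSix twoDimU twoDimV).IsValid where
  liftable := by unfold CoxeterMatrix.IsLiftable; decide +kernel
  mul_coset := by decide +kernel
  coset_zero := rfl
  wordMon_coset := by decide +kernel
  wordMon_reverse := by decide +kernel

end BlockMonomial

/-! ### Irreducibility of the induced representations. -/

section Irreducibility

namespace InducedDatum

variable {m q g : ℕ} [NeZero m] [NeZero q] {D : InducedDatum m q g}

/-- The eigenvalue of a generator of the normal `2`-subgroup on a block. -/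
def normalSign (D : InducedDatum m q g) (k : Fin 4) (j : Fin m) : ℤ :=
  (D.wordMon (normalWord k)).blk j 0 0

/-- The normal `2`-subgroup acts on the blocks by distinct characters. -/
structure IsSeparated (D : InducedDatum m q g) : Prop where
  diag : ∀ k j, (D.wordMon (normalWord k)).idx j = j ∧
    (D.wordMon (normalWord k)).blk j = Matrix.diagonal fun _ => D.normalSign k j
  sign : ∀ k j, D.normalSign k j ∈ [1, -1]
  sep : ∀ i j, i ≠ j → ∃ k, D.normalSign k i ≠ D.normalSign k j

variable (hD : D.IsValid) (hS : D.IsSeparated)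
variable {W : Type*} [Group W] (cs : CoxeterSystem CoxeterMatrix.F₄ W)

theorem rep_normalWord (hS : D.IsSeparated) (k : Fin 4) (v : Fin m × Fin q → ℂ) :
    rep cs hD (cs.wordProd (normalWord k)) v = fun p => (D.normalSign k p.1 : ℂ) * v p := by
  let F : (Fin m × Fin q → ℂ) →ₗ[ℂ] (Fin m × Fin q → ℂ) :=
    { toFun := fun v p => (D.normalSign k p.1 : ℂ) * v p
      map_add' := fun x y => by ext p; simp [mul_add]
      map_smul' := fun c x => by ext p; simp [mul_left_comm] }
  suffices h : rep cs hD (cs.wordProd (normalWord k)) = F from congrArg (fun f => f v) h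
  refine (Pi.basisFun ℂ _).ext fun p => ?_
  obtain ⟨j, b⟩ := p
  rw [Pi.basisFun_apply, rep_wordProd_single, (hS.diag k j).1, (hS.diag k j).2]
  ext r
  simp only [Matrix.diagonal_apply, Finset.sum_apply, Pi.smul_apply, Pi.single_apply, F,
    LinearMap.coe_mk, AddHom.coe_mk, smul_eq_mul]
  by_cases hr : r = (j, b)
  · subst hr
    simp
  · rw [if_neg hr, mul_zero]
    refine Finset.sum_eq_zero fun a _ => ?_
    by_cases hab : a = b
    · subst hab
      simp [hr]
    · simp [hab]

/-- The normal subgroup acts on the blocks by distinct characters, so the projection to block j is a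
polynomial in its elements and preserves subrepresentations. The inverse of the j-th coset
representative then moves block j to block 0. -/
theorem block_mem (hS : D.IsSeparated) (S : Subrepresentation (rep cs hD))
    {v : Fin m × Fin q → ℂ} (hv : v ∈ S.toSubmodule) (j : Fin m) :
    ∑ a, v (j, a) • Pi.single (0, a) 1 ∈ S.toSubmodule := by
  -- Adding the eigenvalue on block j to the k-th generator gives an operator that is nonzero on
  -- block j and kills each block whose k-th sign differs.
  have step : ∀ (k : Fin 4) (x : Fin m × Fin q → ℂ), x ∈ S.toSubmodule →
      (fun p => ((D.normalSign k p.1 : ℂ) + D.normalSign k j) * x p) ∈ S.toSubmodule := by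
    intro k x hx
    have := S.toSubmodule.add_mem (S.apply_mem_toSubmodule (cs.wordProd (normalWord k)) hx)
      (S.toSubmodule.smul_mem (D.normalSign k j : ℂ) hx)
    rw [rep_normalWord hD cs hS] at this
    convert this using 1
    ext p
    simp [add_mul]
  have h4 := step 0 _ (step 1 _ (step 2 _ (step 3 _ hv)))
  have key : ∑ a, v (j, a) • Pi.single (j, a) (1 : ℂ) ∈ S.toSubmodule := by
    have hsq : ∀ k, (D.normalSign k j : ℂ) * D.normalSign k j = 1 := by
      intro k
      have := hS.sign k j
      simp only [List.mem_cons, List.not_mem_nil, or_false] at this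
      rcases this with h | h <;> simp [h]
    -- On block j each of the four factors is twice a sign; this scalar inverts their product.
    have := S.toSubmodule.smul_mem ((16 : ℂ)⁻¹ * D.normalSign 0 j * D.normalSign 1 j *
      D.normalSign 2 j * D.normalSign 3 j) h4
    convert this using 1
    ext p
    obtain ⟨i, b⟩ := p
    simp only [Finset.sum_apply, Pi.smul_apply, Pi.single_apply, smul_eq_mul, Prod.mk.injEq]
    by_cases hij : i = j
    · subst hij
      simp only [true_and, mul_ite, mul_one, mul_zero, Finset.sum_ite_eq, Finset.mem_univ, if_true]
      have h0 := hsq 0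
      have h1 := hsq 1
      have h2 := hsq 2
      have h3 := hsq 3
      generalize (D.normalSign 0 i : ℂ) = x0 at *
      generalize (D.normalSign 1 i : ℂ) = x1 at *
      generalize (D.normalSign 2 i : ℂ) = x2 at *
      generalize (D.normalSign 3 i : ℂ) = x3 at *
      have : (16 : ℂ)⁻¹ * x0 * x1 * x2 * x3 * ((x0 + x0) * ((x1 + x1) * ((x2 + x2) *
          ((x3 + x3) * v (i, b))))) = (x0 * x0) * (x1 * x1) * (x2 * x2) * (x3 * x3) * v (i, b) := by
        ring
      rw [this, h0, h1, h2, h3]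
      ring
    · obtain ⟨k, hk⟩ := hS.sep i j hij
      have hz : (D.normalSign k i : ℂ) + D.normalSign k j = 0 := by
        have h1 := hS.sign k i
        have h2 := hS.sign k j
        simp only [List.mem_cons, List.not_mem_nil, or_false] at h1 h2
        rcases h1 with h1 | h1 <;> rcases h2 with h2 | h2 <;> simp_all
      simp only [hij, false_and, if_false, mul_zero, Finset.sum_const_zero]
      fin_cases k <;> simp at hz <;> simp [hz]
  have := S.apply_mem_toSubmodule (cs.wordProd (D.coset j).reverse) key
  rw [map_sum] at this
  simpa only [map_smul, rep_reverse] using this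

/-- A criterion for irreducibility of a block monomial representation. -/
theorem isIrreducible (hS : D.IsSeparated)
    (hq : ∀ S : Subrepresentation (rep cs hD), ∀ a : Fin q → ℂ, a ≠ 0 →
      ∑ b, a b • Pi.single (0, b) 1 ∈ S.toSubmodule →
      ∀ b, Pi.single (0, b) 1 ∈ S.toSubmodule) : (rep cs hD).IsIrreducible := by
  have : Nontrivial (Subrepresentation (rep cs hD)) := by
    refine ⟨⊥, ⊤, fun h => ?_⟩
    have h1 : (Pi.single (0, 0) 1 : Fin m × Fin q → ℂ) ∈
        (⊤ : Subrepresentation (rep cs hD)).toSubmodule := Submodule.mem_top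
    rw [← h] at h1
    have h2 : (Pi.single (0, 0) 1 : Fin m × Fin q → ℂ) = 0 := h1
    simpa using congrFun h2 (0, 0)
  refine { eq_bot_or_eq_top := fun S => ?_ }
  by_cases hbot : S.toSubmodule = ⊥
  · exact Or.inl (Subrepresentation.toSubmodule_injective hbot)
  right
  apply Subrepresentation.toSubmodule_injective
  obtain ⟨v, hv, hv0⟩ := Submodule.exists_mem_ne_zero_of_ne_bot hbot
  obtain ⟨⟨j, b⟩, hjb⟩ := Function.ne_iff.1 hv0
  have h0 := hq S (fun a => v (j, a)) (fun h => hjb (congrFun h b)) (block_mem hD cs hS S hv j)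
  refine eq_top_iff.2 fun x _ => ?_
  rw [pi_eq_sum_univ' x]
  refine S.toSubmodule.sum_mem fun p _ => S.toSubmodule.smul_mem _ ?_
  have := S.apply_mem_toSubmodule (cs.wordProd (D.coset p.1)) (h0 p.2)
  rwa [rep_coset] at this

end InducedDatum

theorem isIrreducible_of_isSeparated {m g : ℕ} [NeZero m] {D : InducedDatum m 1 g}
    (hD : D.IsValid) (hS : D.IsSeparated) {W : Type*} [Group W]
    (cs : CoxeterSystem CoxeterMatrix.F₄ W) : (D.rep cs hD).IsIrreducible := by
  refine InducedDatum.isIrreducible hD cs hS fun S a ha h b => ?_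
  have h0 : a 0 ≠ 0 := fun h0 => ha (funext fun i => by rw [Subsingleton.elim i 0, h0]; rfl)
  have := S.toSubmodule.smul_mem (a 0)⁻¹ h
  rw [Subsingleton.elim b 0]
  simpa [h0] using this

theorem datumOne_isSeparated (d e : ℤˣ) : (datumOne d e).IsSeparated where
  diag := by revert d e; decide +kernel
  sign := by revert d e; decide +kernel
  sep := by revert d e; decide +kernel

theorem datumNine_isSeparated (d e : ℤˣ) : (datumNine d e).IsSeparated where
  diag := by revert d e; decide +kernel
  sign := by revert d e; decide +kernel
  sep := by revert d e; decide +kernel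

theorem datumSix_isSeparated (d : ℤˣ) : (datumSix !![(d : ℤ)] !![-(d : ℤ)]).IsSeparated where
  diag := by revert d; decide +kernel
  sign := by revert d; decide +kernel
  sep := by revert d; decide +kernel

theorem datumTwelve_isSeparated : (datumSix twoDimU twoDimV).IsSeparated where
  diag := by decide +kernel
  sign := by decide +kernel
  sep := by decide +kernel

variable {W : Type*} [Group W] (cs : CoxeterSystem CoxeterMatrix.F₄ W)

/-- Block 0 carries the two-dimensional representation of S₃, up to the sign of the second
generator; its irreducibility is checked on coordinates. -/
theorem datumTwelve_isIrreducible :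
    ((datumSix twoDimU twoDimV).rep cs datumTwelve_isValid).IsIrreducible := by
  refine InducedDatum.isIrreducible _ cs datumTwelve_isSeparated fun S a ha h => ?_
  have hu := fun b => (datumSix twoDimU twoDimV).rep_wordProd_single datumTwelve_isValid cs [0, 3] 0 b
  have hv := fun b => (datumSix twoDimU twoDimV).rep_wordProd_single datumTwelve_isValid cs [1, 2] 0 b
  have iu : ((datumSix twoDimU twoDimV).wordMon [0, 3]).idx 0 = 0 ∧
      ((datumSix twoDimU twoDimV).wordMon [0, 3]).blk 0 = !![0, 1; 1, 0] := by decide +kernel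
  have iv : ((datumSix twoDimU twoDimV).wordMon [1, 2]).idx 0 = 0 ∧
      ((datumSix twoDimU twoDimV).wordMon [1, 2]).blk 0 = !![-1, 1; 0, 1] := by decide +kernel
  simp only [iu.1, iu.2, iv.1, iv.2, Fin.sum_univ_two] at hu hv
  have hu0 := hu 0
  have hu1 := hu 1
  have hv0 := hv 0
  have hv1 := hv 1
  simp at hu0 hu1 hv0 hv1
  set e0 : Fin 6 × Fin 2 → ℂ := Pi.single (0, 0) 1
  set e1 : Fin 6 × Fin 2 → ℂ := Pi.single (0, 1) 1
  rw [Fin.sum_univ_two] at h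
  have mU : ∀ x y : ℂ, x • e0 + y • e1 ∈ S.toSubmodule → y • e0 + x • e1 ∈ S.toSubmodule := by
    intro x y hxy
    have := S.apply_mem_toSubmodule (cs.wordProd [0, 3]) hxy
    rw [map_add, map_smul, map_smul, hu0, hu1] at this
    rwa [add_comm]
  have mV : ∀ x y : ℂ, x • e0 + y • e1 ∈ S.toSubmodule →
      (y - x) • e0 + y • e1 ∈ S.toSubmodule := by
    intro x y hxy
    have := S.apply_mem_toSubmodule (cs.wordProd [1, 2]) hxy
    rw [map_add, map_smul, map_smul, hv0, hv1] at this
    convert this using 1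
    module
  have fin : ∀ y : ℂ, y ≠ 0 → y • e0 ∈ S.toSubmodule →
      ∀ b, (Pi.single (0, b) 1 : Fin 6 × Fin 2 → ℂ) ∈ S.toSubmodule := by
    intro y hy h0
    have h1 := S.toSubmodule.smul_mem y⁻¹ h0
    rw [smul_smul, inv_mul_cancel₀ hy, one_smul] at h1
    have h2 := mU 1 0 (by simpa using h1)
    intro b
    fin_cases b
    · exact h1
    · simpa using h2
  have key : ∀ x y : ℂ, x • e0 + y • e1 ∈ S.toSubmodule → 2 * x - y ≠ 0 →
      ∀ b, (Pi.single (0, b) 1 : Fin 6 × Fin 2 → ℂ) ∈ S.toSubmodule := by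
    intro x y hxy hne
    refine fin _ hne ?_
    have := S.toSubmodule.sub_mem hxy (mV x y hxy)
    convert this using 1
    module
  -- The difference of a vector (x, y) and its image under s_1s_2 is (2x - y)e0. If 2x - y vanishes
  -- both for (x, y) and for the swapped vector (y, x), then x = y = 0.
  by_cases hne : 2 * a 0 - a 1 = 0
  · refine key _ _ (mU _ _ h) fun h' => ha ?_
    have h1 : a 0 = 0 := by linear_combination (2 * hne + h') / 3
    have h2 : a 1 = 0 := by linear_combination (hne + 2 * h') / 3
    ext i
    fin_cases i <;> simp [h1, h2]
  · exact key _ _ h hne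

end Irreducibility

/-! ### Eigenvectors of involutions, of operators of order 3, and of S₃. -/

section Eigenvectors

variable {U : Type*} [AddCommGroup U] [Module ℂ U]

/-- A sign as a complex number. -/
def signC (e : ℤˣ) : ℂ := ((e : ℤ) : ℂ)

theorem signC_mul_self (e : ℤˣ) : signC e * signC e = 1 := by
  rcases Int.units_eq_one_or e with rfl | rfl <;> simp [signC]

theorem signC_mul (d e : ℤˣ) : signC (d * e) = signC d * signC e := by
  simp [signC]

@[simp] theorem signC_one : signC 1 = 1 := by simp [signC]

@[simp] theorem signC_neg_one : signC (-1) = -1 := by simp [signC]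

/-- The vectors v + Tv and v - Tv add up to 2v, so one of them is nonzero. -/
theorem exists_sign_eigenvector (T : Module.End ℂ U) {v : U} (hT : T (T v) = v) (hv : v ≠ 0) :
    ∃ e : ℤˣ, v + signC e • T v ≠ 0 ∧ T (v + signC e • T v) = signC e • (v + signC e • T v) := by
  have hT' : ∀ e, T (v + signC e • T v) = signC e • (v + signC e • T v) := by
    intro e
    rw [map_add, map_smul, hT, smul_add, smul_smul, signC_mul_self, one_smul, add_comm]
  by_cases h : v + T v = 0
  · refine ⟨-1, ?_, hT' _⟩
    have : T v = -v := (neg_eq_of_add_eq_zero_right h).symm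
    rw [this]
    have : v + signC (-1) • -v = (2 : ℂ) • v := by
      rw [signC_neg_one]
      module
    rw [this]
    exact smul_ne_zero two_ne_zero hv
  · exact ⟨1, by simpa using h, hT' _⟩

/-- The three candidates, for the cube roots of unity c, add up to 3v and so cannot all vanish. -/
theorem exists_cube_eigenvector (T : Module.End ℂ U) {v : U} (hT : T (T (T v)) = v)
    (hv : v ≠ 0) : ∃ c : ℂ, c ≠ 0 ∧ v + c ^ 2 • T v + c • T (T v) ≠ 0 ∧
      T (v + c ^ 2 • T v + c • T (T v)) = c • (v + c ^ 2 • T v + c • T (T v)) := by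
  have hroot := Complex.isPrimitiveRoot_exp 3 (by norm_num)
  set z := Complex.exp (2 * Real.pi * Complex.I / (3 : ℕ)) with hzdef
  clear_value z
  have h3 : z ^ 3 = 1 := hroot.pow_eq_one
  have h1 : z ≠ 1 := hroot.ne_one (by norm_num)
  have hs : 1 + z + z ^ 2 = 0 := by
    have : (z - 1) * (1 + z + z ^ 2) = 0 := by linear_combination h3
    exact (mul_eq_zero.1 this).resolve_left (sub_ne_zero.2 h1)
  have hT' : ∀ c : ℂ, c ^ 3 = 1 →
      T (v + c ^ 2 • T v + c • T (T v)) = c • (v + c ^ 2 • T v + c • T (T v)) := by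
    intro c hc
    rw [map_add, map_add, map_smul, map_smul, hT, smul_add, smul_add, smul_smul, smul_smul,
      show c * c ^ 2 = 1 by linear_combination hc, show c * c = c ^ 2 by ring, one_smul]
    abel
  have hz0 : z ≠ 0 := fun h => by simp [h] at h3
  by_contra hcon
  push Not at hcon
  have e0 := not_imp_not.2 (hcon 1 one_ne_zero) (fun h => h (hT' 1 (by norm_num)))
  have e1 := not_imp_not.2 (hcon z hz0) (fun h => h (hT' z h3))
  have e2 := not_imp_not.2 (hcon (z ^ 2) (pow_ne_zero 2 hz0))
    (fun h => h (hT' (z ^ 2) (by linear_combination (z ^ 3 + 1) * h3)))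
  rw [not_not] at e0 e1 e2
  apply smul_ne_zero (three_ne_zero' ℂ) hv
  have hz4 : (z ^ 2) ^ 2 = z := by linear_combination z * h3
  rw [hz4] at e2
  have key : (3 : ℂ) • v + (1 + z + z ^ 2) • T v + (1 + z + z ^ 2) • T (T v) = 0 := by
    have := congrArg₂ (· + ·) e0 (congrArg₂ (· + ·) e1 e2)
    simp only [add_zero] at this
    rw [← this]
    module
  simpa [hs] using key

/-- Representations of the symmetric group of degree `3` contain an invariant line or the
two-dimensional representation. -/
theorem exists_symmetric_vectors (u v : Module.End ℂ U) (E : Submodule ℂ U)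
    (huE : ∀ x ∈ E, u x ∈ E) (hvE : ∀ x ∈ E, v x ∈ E) (huu : ∀ x ∈ E, u (u x) = x)
    (hvv : ∀ x ∈ E, v (v x) = x) (huv : ∀ x ∈ E, u (v (u (v (u (v x))))) = x) {x : U}
    (hx : x ∈ E) (hx0 : x ≠ 0) :
    (∃ d : ℤˣ, ∃ y ∈ E, y ≠ 0 ∧ u y = signC d • y ∧ v y = signC d • y) ∨
      ∃ y ∈ E, y ≠ 0 ∧ v y = y ∧ v (u y) = -y - u y := by
  -- The operator summing the powers of the rotation uv decides the case. A nonzero value is fixed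
  -- by the rotation, so u and v agree on it and an eigenvector of u is an eigenvector of both.
  by_cases h : ∃ y ∈ E, y + u (v y) + u (v (u (v y))) ≠ 0
  · left
    obtain ⟨y, hy, hy0⟩ := h
    set w := y + u (v y) + u (v (u (v y))) with hw
    have hwE : w ∈ E := E.add_mem (E.add_mem hy (huE _ (hvE _ hy)))
      (huE _ (hvE _ (huE _ (hvE _ hy))))
    have huvw : u (v w) = w := by
      rw [hw]
      simp only [map_add, huv y hy]
      abel
    have hvw : v w = u w := by
      rw [← huu (v w) (hvE _ hwE), huvw]
    clear_value w
    obtain ⟨d, hd0, hd⟩ := exists_sign_eigenvector u (huu w hwE) hy0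
    refine ⟨d, _, E.add_mem hwE (E.smul_mem _ (huE _ hwE)), hd0, hd, ?_⟩
    have : v (u w) = w := by rw [← hvw, hvv w hwE]
    rw [map_add, map_smul, hvw, this, smul_add, smul_smul, signC_mul_self, one_smul, add_comm]
  · right
    push Not at h
    obtain ⟨y, hyE, hy0, hy⟩ : ∃ y ∈ E, y ≠ 0 ∧ v y = y := by
      -- A vector fixed by v is wanted. If v negates x, then ux + v(ux) serves: were it zero, the
      -- relation of order 3 and the vanishing of the rotation sum would give 3x = 0.
      by_cases h1 : x + v x = 0
      · have hvx : v x = -x := (neg_eq_of_add_eq_zero_right h1).symm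
        refine ⟨u x + v (u x), E.add_mem (huE _ hx) (hvE _ (huE _ hx)), fun h2 => hx0 ?_, ?_⟩
        · have h3 : v (u x) = -u x := (neg_eq_of_add_eq_zero_right h2).symm
          have h4 := huv x hx
          have h5 := h x hx
          simp only [hvx, map_neg, h3, huu x hx, neg_neg] at h4 h5
          have h6 : (3 : ℂ) • x = 0 := by
            rw [h4] at h5
            rw [← h5]
            module
          exact (smul_eq_zero.1 h6).resolve_left three_ne_zero
        · rw [map_add, hvv _ (huE _ hx), add_comm]
      · exact ⟨x + v x, E.add_mem hx (hvE _ hx), h1, by rw [map_add, hvv x hx, add_comm]⟩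
    refine ⟨y, hyE, hy0, hy, ?_⟩
    have h1 := h y hyE
    rw [hy] at h1
    have h2 : u (v (u y)) = -(y + u y) := (neg_eq_of_add_eq_zero_right h1).symm
    rw [← huu (v (u y)) (hvE _ (huE _ hyE)), h2, map_neg, map_add, huu y hyE]
    abel

end Eigenvectors

/-! ### Clifford theory for the normal 2-subgroup: the nontrivial characters. -/

section Clifford

variable {U : Type*} [AddCommGroup U] [Module ℂ U]
variable {W : Type*} [Group W] (cs : CoxeterSystem CoxeterMatrix.F₄ W) (R : Representation ℂ W U)

/-- The longest element, which acts by `-1` on the reflection representation. -/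
def centralWord : List (Fin 4) :=
  [0, 1, 0, 2, 1, 0, 2, 1, 2, 3, 2, 1, 0, 2, 1, 2, 3, 2, 1, 0, 2, 1, 2, 3]

theorem apply_append (l l' : List (Fin 4)) (v : U) :
    R (cs.wordProd (l ++ l')) v = R (cs.wordProd l) (R (cs.wordProd l') v) := by
  rw [cs.wordProd_append, map_mul, Module.End.mul_apply]

theorem apply_cons (i : Fin 4) (l : List (Fin 4)) (v : U) :
    R (cs.wordProd (i :: l)) v = R (cs.simple i) (R (cs.wordProd l) v) := by
  rw [cs.wordProd_cons, map_mul, Module.End.mul_apply]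

theorem apply_congr {l l' : List (Fin 4)} (h : wordHeight l = wordHeight l') (v : U) :
    R (cs.wordProd l) v = R (cs.wordProd l') v := by
  rw [wordProd_congr cs h]

theorem simple_apply_simple_apply (i : Fin 4) (v : U) :
    R (cs.simple i) (R (cs.simple i) v) = v := by
  rw [← Module.End.mul_apply, ← map_mul, cs.simple_mul_simple_self, map_one, Module.End.one_apply]

/-- The eigenspace of a character of the normal `2`-subgroup. -/
def normalEigenspace (ε : Fin 4 → ℤˣ) : Submodule ℂ U where
  carrier := {v | ∀ k, R (cs.wordProd (normalWord k)) v = signC (ε k) • v}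
  zero_mem' k := by simp
  add_mem' hx hy k := by rw [map_add, hx, hy, smul_add]
  smul_mem' c x hx k := by rw [map_smul, hx, smul_comm]

/-- The indices of the generators of the normal `2`-subgroup whose product is the conjugate of
the `k`-th generator by the `i`-th simple reflection. -/
def normalConj : Fin 4 → Fin 4 → List (Fin 4) :=
  ![![[1], [0], [3], [2]], ![[0], [0, 1], [2], [2, 3]], ![[0], [1], [0, 2], [1, 3]],
    ![[2], [3], [0], [1]]]

theorem normalWord_append_simple : ∀ k i, wordHeight (normalWord k ++ [i]) =
    wordHeight (i :: (normalConj i k).flatMap normalWord) := by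
  decide +kernel

/-- The action of a simple reflection on characters of the normal `2`-subgroup. -/
def charStep (i : Fin 4) (ε : Fin 4 → ℤˣ) : Fin 4 → ℤˣ := fun k => ((normalConj i k).map ε).prod

theorem apply_flatMap_normalWord {ε : Fin 4 → ℤˣ} {v : U} (hv : v ∈ normalEigenspace cs R ε)
    (l : List (Fin 4)) :
    R (cs.wordProd (l.flatMap normalWord)) v = signC ((l.map ε).prod) • v := by
  induction l with
  | nil => simp
  | cons k l ih =>
    rw [List.flatMap_cons, apply_append, ih, map_smul, hv k, smul_smul, List.map_cons,
      List.prod_cons, signC_mul, mul_comm]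

theorem simple_mem_normalEigenspace {ε : Fin 4 → ℤˣ} {v : U} (hv : v ∈ normalEigenspace cs R ε)
    (i : Fin 4) : R (cs.simple i) v ∈ normalEigenspace cs R (charStep i ε) := by
  intro k
  have := apply_congr cs R (normalWord_append_simple k i) v
  rw [apply_append, cs.wordProd_singleton, apply_cons, apply_flatMap_normalWord cs R hv,
    map_smul] at this
  exact this

theorem word_mem_normalEigenspace {ε : Fin 4 → ℤˣ} {v : U} (hv : v ∈ normalEigenspace cs R ε)
    (l : List (Fin 4)) :
    R (cs.wordProd l) v ∈ normalEigenspace cs R (l.foldr charStep ε) := by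
  induction l with
  | nil => simpa using hv
  | cons i l ih =>
    rw [apply_cons]
    exact simple_mem_normalEigenspace cs R ih i

theorem apply_injective (w : W) : Function.Injective (R w) := by
  intro x y h
  have := congrArg (R w⁻¹) h
  rwa [← Module.End.mul_apply, ← Module.End.mul_apply, ← map_mul, inv_mul_cancel, map_one,
    Module.End.one_apply, Module.End.one_apply] at this

/-- Commutators in the normal subgroup lie in its center. -/
theorem normalWord_comm : ∀ k l : Fin 4,
    wordHeight (normalWord k ++ normalWord l) = wordHeight (normalWord l ++ normalWord k) ∨
    wordHeight (normalWord k ++ normalWord l) =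
      wordHeight (centralWord ++ (normalWord l ++ normalWord k)) := by
  decide +kernel

theorem normalWord_sq : ∀ k : Fin 4, wordHeight (normalWord k ++ normalWord k) = (1, 1, 1, 1) := by
  decide +kernel

theorem normalWord_apply_apply (k : Fin 4) (v : U) :
    R (cs.wordProd (normalWord k)) (R (cs.wordProd (normalWord k)) v) = v := by
  rw [← apply_append, apply_congr cs R (l' := []) (normalWord_sq k)]
  simp

/-- When the center acts trivially the four generators act by commuting involutions, and these can
be diagonalized one after another without losing earlier eigenvalues. -/
theorem exists_normal_eigenvector (hz : R (cs.wordProd centralWord) = 1) {v : U} (hv : v ≠ 0) :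
    ∃ ε, ∃ x ∈ normalEigenspace cs R ε, x ≠ 0 := by
  have hcomm : ∀ k l (x : U), R (cs.wordProd (normalWord k)) (R (cs.wordProd (normalWord l)) x) =
      R (cs.wordProd (normalWord l)) (R (cs.wordProd (normalWord k)) x) := by
    intro k l x
    rw [← apply_append, ← apply_append]
    rcases normalWord_comm k l with h | h
    · exact apply_congr cs R h x
    · rw [apply_congr cs R h x, apply_append, hz, Module.End.one_apply]
  have step : ∀ (k : Fin 4) (x : U), x ≠ 0 → ∃ e : ℤˣ, ∃ y : U, y ≠ 0 ∧
      R (cs.wordProd (normalWord k)) y = signC e • y ∧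
      ∀ (l : Fin 4) (d : ℤˣ), R (cs.wordProd (normalWord l)) x = signC d • x →
        R (cs.wordProd (normalWord l)) y = signC d • y := by
    intro k x hx
    obtain ⟨e, h0, h1⟩ := exists_sign_eigenvector _ (normalWord_apply_apply cs R k x) hx
    refine ⟨e, _, h0, h1, fun l d hl => ?_⟩
    rw [map_add, map_smul, hcomm l k, hl, map_smul, smul_add, smul_comm]
  obtain ⟨e0, v0, h0, k0, -⟩ := step 0 v hv
  obtain ⟨e1, v1, h1, k1, t1⟩ := step 1 v0 h0
  obtain ⟨e2, v2, h2, k2, t2⟩ := step 2 v1 h1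
  obtain ⟨e3, v3, h3, k3, t3⟩ := step 3 v2 h2
  refine ⟨![e0, e1, e2, e3], v3, fun k => ?_, h3⟩
  fin_cases k
  · exact t3 _ _ (t2 _ _ (t1 _ _ k0))
  · exact t3 _ _ (t2 _ _ k1)
  · exact t3 _ _ k2
  · exact k3

/-- The 16 sign vectors form three orbits under the simple reflections, of sizes 1, 9 and 6, with
the displayed representatives. -/
theorem exists_char_conj : ∀ a b c d : ℤˣ,
    ∃ l ∈ ([[], [0], [1], [0, 1], [1, 0], [0, 1, 0]] : List (List (Fin 4))),
    ∃ l' ∈ ([[], [2], [3], [2, 3], [3, 2], [2, 3, 2]] : List (List (Fin 4))),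
      (l ++ l').foldr charStep ![a, b, c, d] ∈
        [![1, 1, 1, 1], ![1, 1, 1, -1], ![1, -1, -1, 1]] := by
  decide +kernel

/-- Up to conjugacy, there are three characters of the normal `2`-subgroup that are trivial on its
center. -/
theorem exists_standard_eigenvector (hz : R (cs.wordProd centralWord) = 1) {v : U} (hv : v ≠ 0) :
    ∃ ε ∈ [![1, 1, 1, 1], ![1, 1, 1, -1], ![1, -1, -1, 1]],
      ∃ x ∈ normalEigenspace cs R ε, x ≠ 0 := by
  obtain ⟨ε, x, hx, hx0⟩ := exists_normal_eigenvector cs R hz hv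
  obtain ⟨l, -, l', -, h⟩ := exists_char_conj (ε 0) (ε 1) (ε 2) (ε 3)
  have e : ![ε 0, ε 1, ε 2, ε 3] = ε := by
    ext k
    fin_cases k <;> rfl
  rw [e] at h
  refine ⟨_, h, _, word_mem_normalEigenspace cs R hx (l ++ l'), fun h0 => hx0 ?_⟩
  exact apply_injective R (cs.wordProd (l ++ l')) (by rw [h0, map_zero])

/-- Recognition of vectors on which a Sylow `2`-subgroup acts as prescribed. -/
theorem datumNine_act (d e : ℤˣ) {y : U} (hy1 : R (cs.simple 1) y = signC d • y)
    (hy2 : R (cs.simple 2) y = signC e • y) (hy : y ∈ normalEigenspace cs R ![1, 1, 1, -1])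
    (i : Fin 6) (b : Fin 1) : R (cs.wordProd ((datumNine d e).gen i)) y =
      ∑ a, ((datumNine d e).act i a b : ℂ) • y := by
  obtain rfl : b = 0 := Subsingleton.elim _ _
  rw [Fin.sum_univ_one]
  have key : ∀ k, R (cs.wordProd (normalWord k)) y =
      signC ((![1, 1, 1, -1] : Fin 4 → ℤˣ) k) • y := hy
  have k0 := key 0
  have k1 := key 1
  have k2 := key 2
  have k3 := key 3
  simp only [Matrix.cons_val, signC_one, one_smul, signC_neg_one] at k0 k1 k2 k3
  match i with
  | 0 =>
    change R (cs.wordProd [1]) y = signC d • y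
    rwa [cs.wordProd_singleton]
  | 1 =>
    change R (cs.wordProd [2]) y = signC e • y
    rwa [cs.wordProd_singleton]
  | 2 =>
    change R (cs.wordProd (normalWord 0)) y = (((1 : Matrix (Fin 1) (Fin 1) ℤ) 0 0 : ℤ) : ℂ) • y
    rw [k0, Matrix.one_apply_eq, Int.cast_one, one_smul]
  | 3 =>
    change R (cs.wordProd (normalWord 1)) y = (((1 : Matrix (Fin 1) (Fin 1) ℤ) 0 0 : ℤ) : ℂ) • y
    rw [k1, Matrix.one_apply_eq, Int.cast_one, one_smul]
  | 4 =>
    change R (cs.wordProd (normalWord 2)) y = (((1 : Matrix (Fin 1) (Fin 1) ℤ) 0 0 : ℤ) : ℂ) • y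
    rw [k2, Matrix.one_apply_eq, Int.cast_one, one_smul]
  | 5 =>
    change R (cs.wordProd (normalWord 3)) y =
      (((-1 : Matrix (Fin 1) (Fin 1) ℤ) 0 0 : ℤ) : ℂ) • y
    rw [k3, Matrix.neg_apply, Matrix.one_apply_eq, Int.cast_neg, Int.cast_one]

/-- The stabilizer of this character is a Sylow 2-subgroup, generated by the normal subgroup and by
s_1, s_2. A common eigenvector of s_1 and s_2 in the eigenspace gives a map from an induced
representation. -/
theorem exists_nine_intertwining {v : U} (hv : v ∈ normalEigenspace cs R ![1, 1, 1, -1])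
    (hv0 : v ≠ 0) : ∃ d e : ℤˣ, ∃ f : Representation.IntertwiningMap
      ((datumNine d e).rep cs (datumNine_isValid d e)) R, f ≠ 0 := by
  have h1 : charStep 1 ![1, 1, 1, -1] = ![1, 1, 1, -1] := by decide
  have h2 : charStep 2 ![1, 1, 1, -1] = ![1, 1, 1, -1] := by decide
  have m1 : ∀ x ∈ normalEigenspace cs R ![1, 1, 1, -1],
      R (cs.simple 1) x ∈ normalEigenspace cs R ![1, 1, 1, -1] := by
    intro x hx
    have := simple_mem_normalEigenspace cs R hx 1
    rwa [h1] at this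
  have m2 : ∀ x ∈ normalEigenspace cs R ![1, 1, 1, -1],
      R (cs.simple 2) x ∈ normalEigenspace cs R ![1, 1, 1, -1] := by
    intro x hx
    have := simple_mem_normalEigenspace cs R hx 2
    rwa [h2] at this
  obtain ⟨d, hx0, hx1⟩ := exists_sign_eigenvector _ (simple_apply_simple_apply cs R 1 v) hv0
  set x := v + signC d • R (cs.simple 1) v
  have hx : x ∈ normalEigenspace cs R ![1, 1, 1, -1] :=
    Submodule.add_mem _ hv (Submodule.smul_mem _ _ (m1 v hv))
  clear_value x
  obtain ⟨e, hy0, hy2⟩ := exists_sign_eigenvector _ (simple_apply_simple_apply cs R 2 x) hx0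
  -- The commutator of s_1 and s_2 is the normal generator with index 0, which acts by 1 on this
  -- eigenspace, so s_1 and s_2 commute there.
  have hcomm : R (cs.simple 1) (R (cs.simple 2) x) = signC d • R (cs.simple 2) x := by
    have h := apply_congr cs R
      (show wordHeight [1, 2] = wordHeight (normalWord 0 ++ [2, 1]) by decide +kernel) x
    rw [apply_append, apply_cons, cs.wordProd_singleton, apply_cons, cs.wordProd_singleton, hx1,
      map_smul, map_smul, m2 x hx 0] at h
    simpa using h
  have hy1 : R (cs.simple 1) (x + signC e • R (cs.simple 2) x) =
      signC d • (x + signC e • R (cs.simple 2) x) := by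
    rw [map_add, map_smul, hx1, hcomm, smul_add, smul_comm]
  have hy : x + signC e • R (cs.simple 2) x ∈ normalEigenspace cs R ![1, 1, 1, -1] :=
    Submodule.add_mem _ hx (Submodule.smul_mem _ _ (m2 x hx))
  generalize x + signC e • R (cs.simple 2) x = y at *
  exact ⟨d, e, InducedDatum.exists_intertwining_ne_zero (datumNine_isValid d e) cs R
    (fun _ => y) (datumNine_act cs R d e hy1 hy2 hy) (b := 0) hy0⟩

/-- Recognition of vectors on which the subgroup of index `6` acts as prescribed. -/
theorem datumSix_act {q : ℕ} (u w : Matrix (Fin q) (Fin q) ℤ) (y : Fin q → U)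
    (hu : ∀ b, R (cs.wordProd [0, 3]) (y b) = ∑ a, (u a b : ℂ) • y a)
    (hw : ∀ b, R (cs.wordProd [1, 2]) (y b) = ∑ a, (w a b : ℂ) • y a)
    (hy : ∀ b, y b ∈ normalEigenspace cs R ![1, -1, -1, 1]) (i : Fin 6) (b : Fin q) :
    R (cs.wordProd ((datumSix u w).gen i)) (y b) =
      ∑ a, ((datumSix u w).act i a b : ℂ) • y a := by
  have key : ∀ k, R (cs.wordProd (normalWord k)) (y b) =
    signC ((![1, -1, -1, 1] : Fin 4 → ℤˣ) k) • y b := hy b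
  have k0 := key 0
  have k1 := key 1
  have k2 := key 2
  have k3 := key 3
  simp only [Matrix.cons_val, signC_one, one_smul, signC_neg_one] at k0 k1 k2 k3
  have pos : ∑ a, (((1 : Matrix (Fin q) (Fin q) ℤ) a b : ℤ) : ℂ) • y a = y b := by
    simp [Matrix.one_apply]
  have neg : ∑ a, (((-1 : Matrix (Fin q) (Fin q) ℤ) a b : ℤ) : ℂ) • y a = (-1 : ℂ) • y b := by
    simp [Matrix.one_apply]
  match i with
  | 0 => exact hu b
  | 1 => exact hw b
  | 2 => exact k0.trans pos.symm
  | 3 => exact k1.trans neg.symm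
  | 4 => exact k2.trans neg.symm
  | 5 => exact k3.trans pos.symm

/-- The stabilizer has quotient S₃, generated by the images of s_0s_3 and s_1s_2. On the eigenspace
the operators of s_0s_3 and of minus s_1s_2 satisfy the relations of S₃. Its trivial, sign and
two-dimensional representations give the degrees 6, 6 and 12. -/
theorem exists_six_intertwining {v : U} (hv : v ∈ normalEigenspace cs R ![1, -1, -1, 1])
    (hv0 : v ≠ 0) :
    (∃ d : ℤˣ, ∃ f : Representation.IntertwiningMap
      ((datumSix !![(d : ℤ)] !![-(d : ℤ)]).rep cs (datumSix_isValid d)) R, f ≠ 0) ∨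
    ∃ f : Representation.IntertwiningMap
      ((datumSix twoDimU twoDimV).rep cs datumTwelve_isValid) R, f ≠ 0 := by
  set E := normalEigenspace cs R ![1, -1, -1, 1] with hE
  have hu : [0, 3].foldr charStep ![1, -1, -1, 1] = ![1, -1, -1, 1] := by decide
  have hw : [1, 2].foldr charStep ![1, -1, -1, 1] = ![1, -1, -1, 1] := by decide
  have mu : ∀ x ∈ E, R (cs.wordProd [0, 3]) x ∈ E := by
    intro x hx
    have := word_mem_normalEigenspace cs R hx [0, 3]
    rwa [hu] at this
  have mw : ∀ x ∈ E, R (cs.wordProd [1, 2]) x ∈ E := by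
    intro x hx
    have := word_mem_normalEigenspace cs R hx [1, 2]
    rwa [hw] at this
  have uu : ∀ x ∈ E, R (cs.wordProd [0, 3]) (R (cs.wordProd [0, 3]) x) = x := by
    intro x _
    rw [← apply_append, apply_congr cs R (l' := []) (by decide +kernel)]
    simp
  have ww : ∀ x ∈ E, R (cs.wordProd [1, 2]) (R (cs.wordProd [1, 2]) x) = x := by
    intro x hx
    rw [← apply_append, apply_congr cs R (l' := normalWord 0) (by decide +kernel), hx 0]
    simp
  have uw : ∀ x ∈ E, R (cs.wordProd [0, 3]) (R (cs.wordProd [1, 2]) (R (cs.wordProd [0, 3])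
      (R (cs.wordProd [1, 2]) (R (cs.wordProd [0, 3]) (R (cs.wordProd [1, 2]) x))))) = -x := by
    intro x hx
    simp only [← apply_append]
    -- The cube of s_0s_3s_1s_2 is the product of the normal generators with indices 2, 3, 0, whose
    -- eigenvalue is (-1)·1·1. This is why s_1s_2 is replaced by its negative below.
    rw [apply_congr cs R (l' := [2, 3, 0].flatMap normalWord) (by decide +kernel),
      apply_flatMap_normalWord cs R hx]
    simp
  rcases exists_symmetric_vectors (R (cs.wordProd [0, 3])) (-R (cs.wordProd [1, 2])) E mu
    (fun x hx => E.neg_mem (mw x hx)) uu (fun x hx => by simp [ww x hx])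
    (fun x hx => by simp [uw x hx]) hv hv0 with ⟨d, y, hy, hy0, h1, h2⟩ | ⟨y, hy, hy0, h1, h2⟩
  · left
    rw [LinearMap.neg_apply, neg_eq_iff_eq_neg] at h2
    refine ⟨d, InducedDatum.exists_intertwining_ne_zero (datumSix_isValid d) cs R
      (fun _ => y) (datumSix_act cs R _ _ _ (fun b => ?_) (fun b => ?_) fun _ => hy)
      (b := 0) hy0⟩
    · obtain rfl : b = 0 := Subsingleton.elim _ _
      rw [Fin.sum_univ_one]
      exact h1
    · obtain rfl : b = 0 := Subsingleton.elim _ _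
      rw [Fin.sum_univ_one, h2, ← neg_smul]
      congr 1
      exact (Int.cast_neg _).symm
  · right
    rw [LinearMap.neg_apply] at h1 h2
    have h1' : R (cs.wordProd [1, 2]) y = -y := by rw [← h1, neg_neg, h1]
    have h2' : R (cs.wordProd [1, 2]) (R (cs.wordProd [0, 3]) y) =
        y + R (cs.wordProd [0, 3]) y := by
      rw [← neg_inj, h2]
      abel
    refine InducedDatum.exists_intertwining_ne_zero datumTwelve_isValid cs R
      ![y, R (cs.wordProd [0, 3]) y] (datumSix_act cs R _ _ _ ?_ ?_ ?_) (b := 0) hy0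
    · rw [Fin.forall_fin_two, Fin.sum_univ_two, Fin.sum_univ_two]
      simp [twoDimU, uu y hy]
    · rw [Fin.forall_fin_two, Fin.sum_univ_two, Fin.sum_univ_two]
      simp [twoDimV, h1', h2']
    · rw [Fin.forall_fin_two]
      exact ⟨hy, mu y hy⟩

end Clifford

/-! ### Clifford theory: the trivial character and representations of degree 1. -/

section CliffordTrivial

variable {U : Type*} [AddCommGroup U] [Module ℂ U]
variable {W : Type*} [Group W] (cs : CoxeterSystem CoxeterMatrix.F₄ W) (R : Representation ℂ W U)

/-- A subspace stable under the simple reflections is everything, for irreducible `R`. -/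
theorem eq_top_of_simple_mem (hR : R.IsIrreducible) (E : Submodule ℂ U)
    (hE : ∀ i, ∀ x ∈ E, R (cs.simple i) x ∈ E) {v : U} (hv : v ∈ E) (hv0 : v ≠ 0) : E = ⊤ := by
  have hE' : ∀ w : W, ∀ x ∈ E, R w x ∈ E := by
    intro w
    induction w using cs.simple_induction_left with
    | one => simp
    | mul_simple_left w i ih =>
      intro x hx
      rw [map_mul]
      exact hE i _ (ih x hx)
  let S : Subrepresentation R := ⟨E, fun w x hx => hE' w x hx⟩
  rcases hR.eq_bot_or_eq_top S with h | h
  · have : v ∈ S.toSubmodule := hv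
    rw [h] at this
    exact absurd this hv0
  · have : S.toSubmodule = ⊤ := by rw [h]; rfl
    exact this

/-- The eigenspace of the trivial character is stable under W, so it is everything and R factors
through S₃ × S₃. If y is a common eigenvector of the rotations s_0s_1 and s_3s_2, then y, s_0y, s_3y
and s_0s_3y span a stable subspace. -/
theorem finrank_le_four (hR : R.IsIrreducible) {v : U}
    (hv : v ∈ normalEigenspace cs R ![1, 1, 1, 1]) (hv0 : v ≠ 0) : Module.finrank ℂ U ≤ 4 := by
  have htop : normalEigenspace cs R ![1, 1, 1, 1] = ⊤ := by
    refine eq_top_of_simple_mem cs R hR _ (fun i x hx => ?_) hv hv0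
    have := simple_mem_normalEigenspace cs R hx i
    rwa [(by decide : ∀ i, charStep i ![1, 1, 1, 1] = ![1, 1, 1, 1]) i] at this
  have htriv : ∀ x : U, R (cs.wordProd (normalWord 0)) x = x := by
    intro x
    have : x ∈ normalEigenspace cs R ![1, 1, 1, 1] := htop ▸ Submodule.mem_top
    simpa using this 0
  have comm : ∀ i j : Fin 4, wordHeight [i, j] = wordHeight [j, i] → ∀ x : U,
      R (cs.simple i) (R (cs.simple j) x) = R (cs.simple j) (R (cs.simple i) x) := by
    intro i j h x
    simpa [apply_cons] using apply_congr cs R h x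
  have h02 := comm 0 2 (by decide +kernel)
  have h03 := comm 0 3 (by decide +kernel)
  have h13 := comm 1 3 (by decide +kernel)
  -- The only noncommuting pair across the double bond commutes modulo the normal subgroup.
  have h12 : ∀ x : U, R (cs.simple 1) (R (cs.simple 2) x) = R (cs.simple 2) (R (cs.simple 1) x) := by
    intro x
    have := apply_congr cs R
      (show wordHeight [1, 2] = wordHeight ([2, 1] ++ normalWord 0) by decide +kernel) x
    rw [apply_append, htriv] at this
    simpa [apply_cons] using this
  have cube : ∀ i j : Fin 4, wordHeight [i, j, i, j, i, j] = wordHeight [] → ∀ x : U,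
      R (cs.wordProd [i, j]) (R (cs.wordProd [i, j]) (R (cs.wordProd [i, j]) x)) = x := by
    intro i j h x
    simpa [apply_cons] using apply_congr cs R h x
  have sq := fun i (x : U) => simple_apply_simple_apply cs R i x
  obtain ⟨c, hc, hx0, hx⟩ := exists_cube_eigenvector (R (cs.wordProd [0, 1]))
    (cube 0 1 (by decide +kernel) v) hv0
  generalize v + c ^ 2 • R (cs.wordProd [0, 1]) v + c • R (cs.wordProd [0, 1])
    (R (cs.wordProd [0, 1]) v) = x at *
  obtain ⟨d, hd, hy0, hy⟩ := exists_cube_eigenvector (R (cs.wordProd [3, 2]))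
    (cube 3 2 (by decide +kernel) x) hx0
  have hcomm : ∀ z : U, R (cs.wordProd [0, 1]) (R (cs.wordProd [3, 2]) z) =
      R (cs.wordProd [3, 2]) (R (cs.wordProd [0, 1]) z) := by
    intro z
    simp only [apply_cons, cs.wordProd_nil, map_one, Module.End.one_apply]
    rw [h13, h12, h03, h02]
  have hy' : R (cs.wordProd [0, 1]) (x + d ^ 2 • R (cs.wordProd [3, 2]) x +
      d • R (cs.wordProd [3, 2]) (R (cs.wordProd [3, 2]) x)) = c • (x + d ^ 2 •
      R (cs.wordProd [3, 2]) x + d • R (cs.wordProd [3, 2]) (R (cs.wordProd [3, 2]) x)) := by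
    simp only [map_add, map_smul, hcomm, hx, smul_add, smul_comm c]
  generalize x + d ^ 2 • R (cs.wordProd [3, 2]) x + d • R (cs.wordProd [3, 2])
    (R (cs.wordProd [3, 2]) x) = y at *
  simp only [apply_cons, cs.wordProd_nil, map_one, Module.End.one_apply] at hy hy'
  have y1 : R (cs.simple 1) y = c • R (cs.simple 0) y := by
    rw [← map_smul, ← hy', sq]
  have y10 : R (cs.simple 1) (R (cs.simple 0) y) = c⁻¹ • y := by
    rw [eq_inv_smul_iff₀ hc, ← map_smul, ← y1, sq]
  have y2 : R (cs.simple 2) y = d • R (cs.simple 3) y := by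
    rw [← map_smul, ← hy, sq]
  have y23 : R (cs.simple 2) (R (cs.simple 3) y) = d⁻¹ • y := by
    rw [eq_inv_smul_iff₀ hd, ← map_smul, ← y2, sq]
  let b : Fin 4 → U := ![y, R (cs.simple 0) y, R (cs.simple 3) y, R (cs.simple 0) (R (cs.simple 3) y)]
  have hb : ∀ k, b k ∈ Submodule.span ℂ (Set.range b) :=
    fun k => Submodule.subset_span ⟨k, rfl⟩
  have hspan : Submodule.span ℂ (Set.range b) = ⊤ := by
    refine eq_top_of_simple_mem cs R hR _ (fun i x hx => ?_) (hb 0) hy0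
    induction hx using Submodule.span_induction with
    | mem x h =>
      have m0 : y ∈ _ := hb 0
      have m1 : R (cs.simple 0) y ∈ _ := hb 1
      have m2 : R (cs.simple 3) y ∈ _ := hb 2
      have m3 : R (cs.simple 0) (R (cs.simple 3) y) ∈ _ := hb 3
      generalize Submodule.span ℂ (Set.range b) = E at *
      obtain ⟨k, rfl⟩ := h
      have s0 : ∀ k, R (cs.simple 0) (b k) ∈ E := by
        simpa [Fin.forall_fin_succ, b, sq] using ⟨m1, m0, m3, m2⟩
      have s1 : ∀ k, R (cs.simple 1) (b k) ∈ E := by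
        have e3 : R (cs.simple 1) (R (cs.simple 0) (R (cs.simple 3) y)) =
            c⁻¹ • R (cs.simple 3) y := by
          rw [h03, h13, y10, map_smul]
        have e2 : R (cs.simple 1) (R (cs.simple 3) y) =
            c • R (cs.simple 0) (R (cs.simple 3) y) := by
          rw [h13, y1, map_smul, h03]
        simpa [Fin.forall_fin_succ, b, y1, y10, e2, e3] using ⟨E.smul_mem c m1,
          E.smul_mem c⁻¹ m0, E.smul_mem c m3, E.smul_mem c⁻¹ m2⟩
      have s2 : ∀ k, R (cs.simple 2) (b k) ∈ E := by
        have e3 : R (cs.simple 2) (R (cs.simple 0) (R (cs.simple 3) y)) =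
            d⁻¹ • R (cs.simple 0) y := by
          rw [← h02, y23, map_smul]
        have e1 : R (cs.simple 2) (R (cs.simple 0) y) =
            d • R (cs.simple 0) (R (cs.simple 3) y) := by
          rw [← h02, y2, map_smul]
        simpa [Fin.forall_fin_succ, b, y2, y23, e1, e3] using ⟨E.smul_mem d m2,
          E.smul_mem d m3, E.smul_mem d⁻¹ m0, E.smul_mem d⁻¹ m1⟩
      have s3 : ∀ k, R (cs.simple 3) (b k) ∈ E := by
        simpa [Fin.forall_fin_succ, b, sq, ← h03] using ⟨m2, m3, m0, m1⟩
      match i with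
      | 0 => exact s0 k
      | 1 => exact s1 k
      | 2 => exact s2 k
      | 3 => exact s3 k
    | zero => simp
    | add x z _ _ h1 h2 => rw [map_add]; exact Submodule.add_mem _ h1 h2
    | smul t x _ h1 => rw [map_smul]; exact Submodule.smul_mem _ _ h1
  calc Module.finrank ℂ U = (Set.range b).finrank ℂ := by
        rw [Set.finrank, hspan, finrank_top]
    _ ≤ Fintype.card (Fin 4) := finrank_range_le_card b
    _ = 4 := by simp

/-- Irreducible representations of dimension greater than `4` on which the central involution
acts trivially. -/
theorem exists_intertwining_of_irreducible (hR : R.IsIrreducible)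
    (hz : R (cs.wordProd centralWord) = 1) (hdim : 4 < Module.finrank ℂ U) :
    (∃ d e : ℤˣ, ∃ f : Representation.IntertwiningMap
      ((datumNine d e).rep cs (datumNine_isValid d e)) R, f ≠ 0) ∨
    (∃ d : ℤˣ, ∃ f : Representation.IntertwiningMap
      ((datumSix !![(d : ℤ)] !![-(d : ℤ)]).rep cs (datumSix_isValid d)) R, f ≠ 0) ∨
    ∃ f : Representation.IntertwiningMap
      ((datumSix twoDimU twoDimV).rep cs datumTwelve_isValid) R, f ≠ 0 := by
  have : Nontrivial U := Module.nontrivial_of_finrank_pos (R := ℂ) (by omega)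
  obtain ⟨v, hv⟩ := exists_ne (0 : U)
  obtain ⟨ε, hε, x, hx, hx0⟩ := exists_standard_eigenvector cs R hz hv
  simp only [List.mem_cons, List.not_mem_nil, or_false] at hε
  rcases hε with rfl | rfl | rfl
  · exact absurd (finrank_le_four cs R hR hx hx0) (by omega)
  · exact Or.inl (exists_nine_intertwining cs R hx hx0)
  · exact Or.inr (exists_six_intertwining cs R hx hx0)

/-- Recognition of vectors spanning a one-dimensional representation. -/
theorem datumOne_act (d e : ℤˣ) {y : U}
    (hy : ∀ i, R (cs.simple i) y = signC ((![d, d, e, e] : Fin 4 → ℤˣ) i) • y)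
    (i : Fin 4) (b : Fin 1) : R (cs.wordProd ((datumOne d e).gen i)) y =
      ∑ a, ((datumOne d e).act i a b : ℂ) • y := by
  obtain rfl : b = 0 := Subsingleton.elim _ _
  have h := hy i
  rw [← cs.wordProd_singleton] at h
  rw [Fin.sum_univ_one]
  match i with
  | 0 => exact h
  | 1 => exact h
  | 2 => exact h
  | 3 => exact h

/-- Braid relations of length 3 force equal signs on s_0, s_1 and on s_2, s_3. -/
theorem exists_intertwining_of_finrank_eq_one (hdim : Module.finrank ℂ U = 1) :
    ∃ d e : ℤˣ, ∃ f : Representation.IntertwiningMap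
      ((datumOne d e).rep cs (datumOne_isValid d e)) R, f ≠ 0 := by
  obtain ⟨v, hv, hspan⟩ := finrank_eq_one_iff'.1 hdim
  have hsign : ∀ i, ∃ e : ℤˣ, R (cs.simple i) v = signC e • v := by
    intro i
    obtain ⟨e, h0, h1⟩ := exists_sign_eigenvector _ (simple_apply_simple_apply cs R i v) hv
    refine ⟨e, ?_⟩
    obtain ⟨c, hc⟩ := hspan (v + signC e • R (cs.simple i) v)
    rw [← hc, map_smul, smul_comm] at h1
    have hc0 : c ≠ 0 := by
      rintro rfl
      rw [zero_smul] at hc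
      exact h0 hc.symm
    exact smul_right_injective _ hc0 h1
  choose e he using hsign
  have hinj : ∀ i j : Fin 4, wordHeight [i, j, i] = wordHeight [j, i, j] → e i = e j := by
    intro i j h
    have := apply_congr cs R h v
    simp only [apply_cons, cs.wordProd_nil, map_one, Module.End.one_apply, he, map_smul,
      smul_smul, ← signC_mul] at this
    have h2 := smul_left_injective ℂ hv this
    have h3 : e i * e j * e i = e j * e i * e j := Units.ext (Int.cast_injective (α := ℂ) h2)
    rcases Int.units_eq_one_or (e i) with h | h <;> rcases Int.units_eq_one_or (e j) with h' | h' <;>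
      simp [h, h'] at h3 ⊢
  have h10 := hinj 1 0 (by decide +kernel)
  have h32 := hinj 3 2 (by decide +kernel)
  refine ⟨e 0, e 2, InducedDatum.exists_intertwining_ne_zero (datumOne_isValid _ _) cs R
    (fun _ => v) (datumOne_act cs R _ _ fun i => ?_) (b := 0) hv⟩
  rw [he]
  match i with
  | 0 => rfl
  | 1 => rw [h10]; rfl
  | 2 => rfl
  | 3 => rw [h32]; rfl

end CliffordTrivial

/-! ### Linear forms and divisibility of polynomials by roots. -/

section LinearForms

open MvPolynomial

/-- The action of a simple reflection on the coordinates of a vector in the basis of simple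
roots. -/
def rootStep (i : Fin 4) (p : ℤ × ℤ × ℤ × ℤ) : ℤ × ℤ × ℤ × ℤ :=
  match i with
  | 0 => (p.2.1 - p.1, p.2.1, p.2.2.1, p.2.2.2)
  | 1 => (p.1, p.1 - p.2.1 + 2 * p.2.2.1, p.2.2.1, p.2.2.2)
  | 2 => (p.1, p.2.1, p.2.1 - p.2.2.1 + p.2.2.2, p.2.2.2)
  | 3 => (p.1, p.2.1, p.2.2.1, p.2.2.1 - p.2.2.2)

/-- The action of a word on coordinates of vectors. -/
def rootWord (l : List (Fin 4)) (p : ℤ × ℤ × ℤ × ℤ) : ℤ × ℤ × ℤ × ℤ := l.foldr rootStep p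

/-- The coordinates of the simple roots. -/
def simpleRoot : Fin 4 → ℤ × ℤ × ℤ × ℤ :=
  ![(1, 0, 0, 0), (0, 1, 0, 0), (0, 0, 1, 0), (0, 0, 0, 1)]

/-- The linear form with given coefficients. -/
noncomputable def lin (p : ℤ × ℤ × ℤ × ℤ) : MvPolynomial (Fin 4) ℂ :=
  (p.1 : MvPolynomial (Fin 4) ℂ) * X 0 + (p.2.1 : MvPolynomial (Fin 4) ℂ) * X 1 +
    (p.2.2.1 : MvPolynomial (Fin 4) ℂ) * X 2 + (p.2.2.2 : MvPolynomial (Fin 4) ℂ) * X 3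

/-- The pairing of a linear form with a point. -/
def dot (p x : ℤ × ℤ × ℤ × ℤ) : ℤ :=
  p.1 * x.1 + p.2.1 * x.2.1 + p.2.2.1 * x.2.2.1 + p.2.2.2 * x.2.2.2

/-- The point with given integer coordinates. -/
noncomputable def point (x : ℤ × ℤ × ℤ × ℤ) : Fin 4 → ℂ := fun k => (coord x k : ℂ)

theorem eval_lin (p x : ℤ × ℤ × ℤ × ℤ) : eval (point x) (lin p) = (dot p x : ℂ) := by
  simp [lin, dot, point, coord]

theorem lin_simpleRoot (i : Fin 4) : lin (simpleRoot i) = X i := by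
  fin_cases i <;> simp [lin, simpleRoot]

theorem lin_isHomogeneous (p : ℤ × ℤ × ℤ × ℤ) : (lin p).IsHomogeneous 1 := by
  have h : ∀ (a : ℤ) (i : Fin 4), ((a : MvPolynomial (Fin 4) ℂ) * X i).IsHomogeneous 1 := by
    intro a i
    have : (a : MvPolynomial (Fin 4) ℂ) = C (a : ℂ) := by simp
    rw [this]
    exact isHomogeneous_C_mul_X _ _
  exact (((h _ _).add (h _ _)).add (h _ _)).add (h _ _)

variable {W : Type*} [Group W] (cs : CoxeterSystem CoxeterMatrix.F₄ W)

theorem symRep_eq (w : W) (f : MvPolynomial (Fin 4) ℂ) : symRep cs w f = symAlg cs w f := rfl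

theorem symAlg_simple_X (i j : Fin 4) :
    symAlg cs (cs.simple i) (X j) = lin (rootStep i (simpleRoot j)) := by
  rw [symAlg, aeval_X, f4Mat_simple]
  fin_cases i <;> fin_cases j <;>
    simp [Fin.sum_univ_four, f4Refl, CartanMatrix.F₄, lin, rootStep, simpleRoot] <;> ring

theorem symRep_simple_lin (i : Fin 4) (p : ℤ × ℤ × ℤ × ℤ) :
    symRep cs (cs.simple i) (lin p) = lin (rootStep i p) := by
  rw [symRep_eq, lin]
  simp only [map_add, map_mul, map_intCast, symAlg_simple_X]
  fin_cases i <;> simp [lin, rootStep, simpleRoot] <;> ring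

theorem symRep_lin (l : List (Fin 4)) (p : ℤ × ℤ × ℤ × ℤ) :
    symRep cs (cs.wordProd l) (lin p) = lin (rootWord l p) := by
  induction l with
  | nil => simp [rootWord]
  | cons i l ih => rw [apply_cons, ih, symRep_simple_lin]; rfl

theorem symRep_list_prod (w : W) (L : List (MvPolynomial (Fin 4) ℂ)) :
    symRep cs w L.prod = (L.map fun f => symRep cs w f).prod := by
  simp only [symRep_eq]
  exact map_list_prod (symAlg cs w) L

theorem symRep_prod_lin (l : List (Fin 4)) (L : List (ℤ × ℤ × ℤ × ℤ)) :
    symRep cs (cs.wordProd l) (L.map lin).prod = ((L.map (rootWord l)).map lin).prod := by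
  rw [symRep_list_prod, List.map_map, List.map_map]
  congr 2
  funext p
  exact symRep_lin cs l p

theorem symRep_isHomogeneous {f : MvPolynomial (Fin 4) ℂ} {n : ℕ} (hf : f.IsHomogeneous n) (w : W) :
    (symRep cs w f).IsHomogeneous n := by
  have h : ∀ (a : ℤ) (i : Fin 4), ((a : MvPolynomial (Fin 4) ℂ) * X i).IsHomogeneous 1 := by
    intro a i
    have : (a : MvPolynomial (Fin 4) ℂ) = C (a : ℂ) := by simp
    rw [this]
    exact isHomogeneous_C_mul_X _ _
  have := hf.aeval (fun j => ∑ k, (f4Mat cs w k j : MvPolynomial (Fin 4) ℂ) * X k)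
    (fun j => IsHomogeneous.sum _ _ _ fun k _ => h _ _)
  rwa [one_mul] at this

theorem prod_lin_isHomogeneous (L : List (ℤ × ℤ × ℤ × ℤ)) :
    (L.map lin).prod.IsHomogeneous L.length := by
  induction L with
  | nil => exact isHomogeneous_one _ _
  | cons p L ih =>
    rw [List.map_cons, List.prod_cons, List.length_cons, add_comm]
    exact (lin_isHomogeneous p).mul ih

theorem eval_prod_lin (L : List (ℤ × ℤ × ℤ × ℤ)) (x : ℤ × ℤ × ℤ × ℤ) :
    eval (point x) (L.map lin).prod = ((L.map fun p => dot p x).prod : ℤ) := by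
  rw [map_list_prod, List.map_map, Int.cast_list_prod, List.map_map]
  congr 2
  funext p
  exact eval_lin p x

/-- A polynomial negated by a simple reflection is divisible by the simple root. -/
theorem X_dvd_of_simple_neg {f : MvPolynomial (Fin 4) ℂ} {i : Fin 4}
    (h : symRep cs (cs.simple i) f = -f) : X i ∣ f := by
  -- A simple reflection changes each variable by a multiple of its root, so it acts trivially
  -- modulo X i. Hence f ≡ -f and X i divides 2f.
  have h1 : (Ideal.Quotient.mkₐ ℂ (Ideal.span {(X i : MvPolynomial (Fin 4) ℂ)})).comp
      (symAlg cs (cs.simple i)) = Ideal.Quotient.mkₐ ℂ (Ideal.span {X i}) := by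
    ext j : 1
    rw [AlgHom.comp_apply, symAlg, aeval_X, f4Mat_simple]
    rw [Ideal.Quotient.mkₐ_eq_mk, Ideal.Quotient.eq, Ideal.mem_span_singleton]
    refine ⟨-(CartanMatrix.F₄ i j : MvPolynomial (Fin 4) ℂ), ?_⟩
    have : ∀ k, (f4Refl i k j : MvPolynomial (Fin 4) ℂ) * X k = (if k = j then X k else 0) -
        (if k = i then (CartanMatrix.F₄ i j : MvPolynomial (Fin 4) ℂ) * X k else 0) := by
      intro k
      simp only [f4Refl, Matrix.of_apply]
      split_ifs <;> simp [sub_mul]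
    simp only [this, Finset.sum_sub_distrib, Finset.sum_ite_eq', Finset.mem_univ, if_true]
    ring
  have h2 := DFunLike.congr_fun h1 f
  rw [AlgHom.comp_apply, ← symRep_eq, h, Ideal.Quotient.mkₐ_eq_mk, Ideal.Quotient.eq,
    Ideal.mem_span_singleton] at h2
  have h3 : X i ∣ C (-2⁻¹ : ℂ) * (-f - f) := h2.mul_left _
  have h4 : C (-2⁻¹ : ℂ) * (-f - f) = f := by
    have : -f - f = C (-2 : ℂ) * f := by
      rw [show (-2 : ℂ) = -1 + -1 by norm_num, C_add, C_neg, C_1]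
      ring
    rw [this, ← mul_assoc, ← C_mul]
    norm_num
  rwa [h4] at h3

/-- The vector negated by a conjugate of a simple reflection. -/
def wordRoot (a : List (Fin 4) × Fin 4) : ℤ × ℤ × ℤ × ℤ := rootWord a.1 (simpleRoot a.2)

/-- A word for a conjugate of a simple reflection. -/
def reflWord (a : List (Fin 4) × Fin 4) : List (Fin 4) := a.1 ++ a.2 :: a.1.reverse

/-- The action of the group on polynomials by algebra automorphisms. -/
noncomputable def symEquiv (w : W) : MvPolynomial (Fin 4) ℂ ≃* MvPolynomial (Fin 4) ℂ :=
  { symAlg cs w with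
    invFun := symAlg cs w⁻¹
    left_inv := fun f => by
      change (symRep cs w⁻¹) (symRep cs w f) = f
      rw [← Module.End.mul_apply, ← map_mul, inv_mul_cancel, map_one, Module.End.one_apply]
    right_inv := fun f => by
      change (symRep cs w) (symRep cs w⁻¹ f) = f
      rw [← Module.End.mul_apply, ← map_mul, mul_inv_cancel, map_one, Module.End.one_apply] }

theorem symEquiv_apply (w : W) (f : MvPolynomial (Fin 4) ℂ) :
    symEquiv cs w f = symRep cs w f := rfl

theorem lin_wordRoot (a : List (Fin 4) × Fin 4) :
    lin (wordRoot a) = symEquiv cs (cs.wordProd a.1) (X a.2) := by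
  rw [symEquiv_apply, ← lin_simpleRoot, symRep_lin]
  rfl

/-- A root is the image of a variable under a ring automorphism. -/
theorem prime_lin_wordRoot {W : Type*} [Group W] (cs : CoxeterSystem CoxeterMatrix.F₄ W)
    (a : List (Fin 4) × Fin 4) : Prime (lin (wordRoot a)) := by
  rw [lin_wordRoot cs, MulEquiv.prime_iff]
  exact X_prime

theorem lin_dvd_of_neg {f : MvPolynomial (Fin 4) ℂ} (a : List (Fin 4) × Fin 4)
    (h : symRep cs (cs.wordProd (reflWord a)) f = -f) : lin (wordRoot a) ∣ f := by
  obtain ⟨x, s⟩ := a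
  have h1 : X s ∣ symRep cs (cs.wordProd x)⁻¹ f := by
    apply X_dvd_of_simple_neg cs
    rw [reflWord, apply_append, apply_cons, cs.wordProd_reverse] at h
    apply apply_injective (symRep cs) (cs.wordProd x)
    rw [h, map_neg, ← Module.End.mul_apply, ← map_mul, mul_inv_cancel, map_one,
      Module.End.one_apply]
  rw [lin_wordRoot cs]
  have h2 := map_dvd (symEquiv cs (cs.wordProd x)) h1
  rwa [symEquiv_apply _ _ (symRep cs _ f), ← Module.End.mul_apply, ← map_mul, mul_inv_cancel,
    map_one, Module.End.one_apply] at h2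

/-- Generators of the relations satisfied by the coordinates of `q`. -/
def relations (q : ℤ × ℤ × ℤ × ℤ) : List (ℤ × ℤ × ℤ × ℤ) :=
  [(q.2.1, -q.1, 0, 0), (q.2.2.1, 0, -q.1, 0), (q.2.2.2, 0, 0, -q.1), (0, q.2.2.1, -q.2.1, 0),
    (0, q.2.2.2, 0, -q.2.1), (0, 0, q.2.2.2, -q.2.2.1)]

/-- The vectors `p` and `q` are linearly independent. -/
def Independent (p q : ℤ × ℤ × ℤ × ℤ) : Prop := ∃ x ∈ relations q, dot p x ≠ 0

instance (p q : ℤ × ℤ × ℤ × ℤ) : Decidable (Independent p q) :=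
  inferInstanceAs (Decidable (∃ x ∈ relations q, dot p x ≠ 0))

/-- Every point of `relations q` is a zero of the form q, while independence provides one at which p
does not vanish. -/
theorem not_lin_dvd_lin {p q : ℤ × ℤ × ℤ × ℤ} (h : Independent p q) : ¬ lin q ∣ lin p := by
  rintro ⟨c, hc⟩
  obtain ⟨x, hx, hne⟩ := h
  have hq : dot q x = 0 := by
    simp only [relations, List.mem_cons, List.not_mem_nil, or_false] at hx
    rcases hx with rfl | rfl | rfl | rfl | rfl | rfl <;> simp only [dot] <;> ring
  have := congrArg (eval (point x)) hc
  rw [map_mul, eval_lin, eval_lin, hq, Int.cast_zero, zero_mul] at this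
  exact hne (by exact_mod_cast this)

theorem prod_lin_dvd {f : MvPolynomial (Fin 4) ℂ} (L : List (ℤ × ℤ × ℤ × ℤ))
    (hp : ∀ p ∈ L, Prime (lin p)) (hd : ∀ p ∈ L, lin p ∣ f) (hL : L.Pairwise Independent) :
    (L.map lin).prod ∣ f := by
  induction L generalizing f with
  | nil => simp
  | cons p L ih =>
    obtain ⟨h, rfl⟩ := hd p List.mem_cons_self
    rw [List.pairwise_cons] at hL
    rw [List.map_cons, List.prod_cons]
    refine mul_dvd_mul_left _ (ih (fun q hq => hp q (List.mem_cons_of_mem _ hq)) (fun q hq => ?_)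
      hL.2)
    exact ((hp q (List.mem_cons_of_mem _ hq)).dvd_or_dvd
      (hd q (List.mem_cons_of_mem _ hq))).resolve_left (not_lin_dvd_lin (hL.1 q hq))

theorem prod_wordRoot_dvd {f : MvPolynomial (Fin 4) ℂ} (A : List (List (Fin 4) × Fin 4))
    (hA : (A.map wordRoot).Pairwise Independent)
    (h : ∀ a ∈ A, symRep cs (cs.wordProd (reflWord a)) f = -f) :
    ((A.map wordRoot).map lin).prod ∣ f := by
  refine prod_lin_dvd _ (fun _ hp => ?_) (fun _ hp => ?_) hA
  · obtain ⟨a, ha, rfl⟩ := List.mem_map.1 hp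
    exact prime_lin_wordRoot cs a
  · obtain ⟨a, ha, rfl⟩ := List.mem_map.1 hp
    exact lin_dvd_of_neg cs a (h a ha)

/-- A polynomial negated by `n` reflections has degree at least `n`; in case of equality it is a
multiple of the product of the roots. -/
theorem length_le_of_neg {f : MvPolynomial (Fin 4) ℂ} {n : ℕ} (hf : f.IsHomogeneous n)
    (hf0 : f ≠ 0) (A : List (List (Fin 4) × Fin 4)) (hA : (A.map wordRoot).Pairwise Independent)
    (h : ∀ a ∈ A, symRep cs (cs.wordProd (reflWord a)) f = -f) :
    A.length ≤ n ∧ (A.length = n → ∃ c : ℂ, c ≠ 0 ∧ f = C c * ((A.map wordRoot).map lin).prod) := by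
  obtain ⟨k, hk⟩ := prod_wordRoot_dvd cs A hA h
  have hk0 : k ≠ 0 := by
    rintro rfl
    exact hf0 (by rw [hk, mul_zero])
  have hP0 : ((A.map wordRoot).map lin).prod ≠ 0 := by
    intro h0
    exact hf0 (by rw [hk, h0, zero_mul])
  have hdeg := hf.totalDegree hf0
  rw [hk, totalDegree_mul_of_isDomain hP0 hk0,
    (prod_lin_isHomogeneous _).totalDegree hP0, List.length_map] at hdeg
  refine ⟨by omega, fun hn => ?_⟩
  have hk1 : k.totalDegree = 0 := by omega
  rw [totalDegree_eq_zero_iff_eq_C] at hk1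
  refine ⟨coeff 0 k, fun h0 => hk0 (by rw [hk1, h0, C_0]), ?_⟩
  rw [hk, mul_comm, ← hk1]

/-- The central involution acts by a sign on each symmetric power. -/
theorem symRep_central {f : MvPolynomial (Fin 4) ℂ} {n : ℕ} (hf : f.IsHomogeneous n) :
    symRep cs (cs.wordProd centralWord) f = (-1 : ℂ) ^ n • f := by
  have hX : ∀ j, symAlg cs (cs.wordProd centralWord) (X j) = -X j := by
    intro j
    rw [← symRep_eq, ← lin_simpleRoot, symRep_lin]
    have : ∀ j, rootWord centralWord (simpleRoot j) = -simpleRoot j := by decide +kernel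
    rw [this]
    simp only [lin, Prod.fst_neg, Prod.snd_neg, Int.cast_neg]
    ring
  have h1 : symAlg cs (cs.wordProd centralWord) = aeval fun j => (-1 : ℂ) • X j := by
    ext j : 1
    rw [hX, aeval_X, neg_one_smul]
  rw [symRep_eq, h1]
  conv_lhs => rw [f.as_sum]
  conv_rhs => rw [f.as_sum]
  rw [map_sum, Finset.smul_sum]
  refine Finset.sum_congr rfl fun d hd => ?_
  rw [aeval_monomial, monomial_eq, Finsupp.prod, Finsupp.prod]
  simp only [smul_pow]
  rw [Finset.prod_smul, Finset.prod_pow_eq_pow_sum, mul_smul_comm]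
  congr 2
  exact (hf.degree_eq_sum_deg_support hd).symm

end LinearForms

/-! ### Lower bounds for the degrees of occurrence. -/

section LowerBounds

open MvPolynomial

namespace BlockMon

variable {m q : ℕ}

/-- The action of a block monomial matrix on integer vectors. -/
def mulVec (A : BlockMon m q) (c : Fin m → Fin q → ℤ) : Fin m → Fin q → ℤ :=
  fun i a => ∑ j, if A.idx j = i then ∑ b, A.blk j a b * c j b else 0

/-- The complex vector with given integer coordinates. -/
noncomputable def intVec (c : Fin m → Fin q → ℤ) : Fin m × Fin q → ℂ := fun p => c p.1 p.2

theorem toEnd_intVec (A : BlockMon m q) (c : Fin m → Fin q → ℤ) :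
    toEnd A (intVec c) = intVec (A.mulVec c) := by
  rw [pi_eq_sum_univ' (intVec c), map_sum]
  simp only [map_smul]
  ext ⟨i, a⟩
  rw [Fintype.sum_prod_type, Finset.sum_apply, intVec, mulVec, Int.cast_sum]
  refine Finset.sum_congr rfl fun j _ => ?_
  simp only [toEnd_single, Finset.sum_apply, Pi.smul_apply, Pi.single_apply, smul_eq_mul, intVec,
    Prod.mk.injEq]
  by_cases h : A.idx j = i
  · subst h
    simp [mul_comm]
  · simp [h, Ne.symm h]

theorem intVec_neg (c : Fin m → Fin q → ℤ) : intVec (-c) = -intVec c := by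
  ext p
  simp [intVec]

theorem intVec_ne_zero {c : Fin m → Fin q → ℤ} (h : c ≠ 0) : intVec c ≠ 0 := by
  intro h0
  apply h
  ext i a
  simpa [intVec] using congrFun h0 (i, a)

end BlockMon

open BlockMon

namespace InducedDatum

variable {m q g : ℕ} [NeZero m] {D : InducedDatum m q g} (hD : D.IsValid)
variable {W : Type*} [Group W] (cs : CoxeterSystem CoxeterMatrix.F₄ W)

theorem rep_intVec (l : List (Fin 4)) (c : Fin m → Fin q → ℤ) :
    D.rep cs hD (cs.wordProd l) (intVec c) = intVec ((D.wordMon l).mulVec c) := by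
  rw [← toEnd_intVec, ← monHom_wordProd hD cs]
  rfl

/-- The vector `c` is negated by the reflections in `A`, whose roots are pairwise independent. -/
structure IsNegated (D : InducedDatum m q g) (A : List (List (Fin 4) × Fin 4))
    (c : Fin m → Fin q → ℤ) : Prop where
  ne_zero : c ≠ 0
  independent : (A.map wordRoot).Pairwise Independent
  neg : ∀ a ∈ A, (D.wordMon (reflWord a)).mulVec c = -c

variable {hD cs}

/-- The lower bound on the degrees of symmetric powers given by a vector negated by several
reflections. -/
theorem length_le_of_isNegated (irr : (D.rep cs hD).IsIrreducible)
    {A : List (List (Fin 4) × Fin 4)} {c : Fin m → Fin q → ℤ} (hA : D.IsNegated A c)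
    {f : Representation.IntertwiningMap (D.rep cs hD) (symRep cs)} (hf : f ≠ 0) {n : ℕ}
    (hn : ∀ u, f u ∈ homogeneousSubmodule (Fin 4) ℂ n) :
    A.length ≤ n ∧ (A.length = n →
      ∃ k : ℂ, k ≠ 0 ∧ f (intVec c) = C k * ((A.map wordRoot).map lin).prod) := by
  have hinj := (Representation.IsIrreducible.injective_or_eq_zero f).resolve_right hf
  have h0 : f (intVec c) ≠ 0 := by
    intro h
    exact intVec_ne_zero hA.ne_zero (hinj (h.trans (map_zero f).symm))
  refine length_le_of_neg cs (hn _) h0 A hA.independent fun a ha => ?_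
  rw [← f.isIntertwining, rep_intVec, hA.neg a ha, intVec_neg, map_neg]

theorem length_le_of_occursInDegree (irr : (D.rep cs hD).IsIrreducible)
    {A : List (List (Fin 4) × Fin 4)} {c : Fin m → Fin q → ℤ} (hA : D.IsNegated A c)
    {n : ℕ} (h : OccursInDegree cs (D.rep cs hD) n) : A.length ≤ n := by
  obtain ⟨f, hf, hn⟩ := h
  exact (length_le_of_isNegated irr hA hf hn).1

end InducedDatum

/-- The longest element acts by (-1)^n on polynomials of degree n. -/
theorem even_of_occursInDegree {U : Type*} [AddCommGroup U] [Module ℂ U]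
    {W : Type*} [Group W] {cs : CoxeterSystem CoxeterMatrix.F₄ W} {R : Representation ℂ W U} {n : ℕ}
    (h : OccursInDegree cs R n) (hz : R (cs.wordProd centralWord) = 1) : Even n := by
  obtain ⟨f, hf, hn⟩ := h
  by_contra hodd
  rw [Nat.not_even_iff_odd] at hodd
  refine hf (DFunLike.ext _ _ fun u => ?_)
  have h1 := f.isIntertwining _ _ (cs.wordProd centralWord) u
  rw [hz, symRep_central cs (hn u), Module.End.one_apply, hodd.neg_one_pow, neg_one_smul,
    eq_neg_iff_add_eq_zero, ← two_smul ℂ] at h1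
  exact (smul_eq_zero.1 h1).resolve_left two_ne_zero

/-- Irreducible representations occurring in even degree have trivial action of the central
involution. -/
theorem central_eq_one_of_even {U : Type*} [AddCommGroup U] [Module ℂ U]
    {W : Type*} [Group W] {cs : CoxeterSystem CoxeterMatrix.F₄ W} {R : Representation ℂ W U} {n : ℕ}
    (hR : R.IsIrreducible) (h : OccursInDegree cs R n) (he : Even n) :
    R (cs.wordProd centralWord) = 1 := by
  obtain ⟨f, hf, hn⟩ := h
  have hinj := (Representation.IsIrreducible.injective_or_eq_zero f).resolve_right hf
  ext u
  apply hinj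
  rw [f.isIntertwining, symRep_central cs (hn u), he.neg_one_pow, one_smul, Module.End.one_apply]

/-- The number of reflections is the lower bound obtained, and here it equals the b-invariant 2. -/
theorem datumNine_isNegated_one_one : (datumNine 1 1).IsNegated [([], 0), ([], 2)]
    ![![0], ![1], ![-1], ![0], ![-1], ![1], ![0], ![0], ![0]] where
  ne_zero := by decide +kernel
  independent := by decide +kernel
  neg := by decide +kernel

/-- Three reflections exclude degree 2, which distinguishes this representation from the one with
b-invariant 2; likewise for the other mixed pair of signs. -/
theorem datumNine_isNegated_one_neg : (datumNine 1 (-1)).IsNegated [([], 2), ([], 3), ([2], 3)]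
    ![![1], ![-1], ![1], ![0], ![0], ![0], ![0], ![0], ![0]] where
  ne_zero := by decide +kernel
  independent := by decide +kernel
  neg := by decide +kernel

theorem datumNine_isNegated_neg_one : (datumNine (-1) 1).IsNegated [([], 0), ([], 1), ([0], 1)]
    ![![1], ![0], ![0], ![-1], ![0], ![0], ![1], ![0], ![0]] where
  ne_zero := by decide +kernel
  independent := by decide +kernel
  neg := by decide +kernel

theorem datumNine_isNegated_neg_neg : (datumNine (-1) (-1)).IsNegated
    [([], 0), ([], 1), ([], 2), ([1], 0), ([2], 1), ([1], 2), ([2, 1], 0), ([0, 1], 2),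
      ([1, 2, 1], 0), ([3, 2, 1, 2, 3, 0, 1], 2)]
    ![![1], ![0], ![0], ![-1], ![0], ![0], ![1], ![0], ![0]] where
  ne_zero := by decide +kernel
  independent := by decide +kernel
  neg := by decide +kernel

theorem datumSix_isNegated_one : (datumSix !![1] !![-1]).IsNegated
    [([], 0), ([], 1), ([0], 1), ([], 3), ([2, 1, 2, 3, 0, 1], 2), ([3, 2, 1, 2, 3, 0, 1], 2)]
    ![![-1], ![1], ![1], ![-1], ![-1], ![1]] where
  ne_zero := by decide +kernel
  independent := by decide +kernel
  neg := by decide +kernel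

/-- Only four reflections, although the b-invariant is 6; degrees 4 and 5 need separate arguments.
-/
theorem datumSix_isNegated_neg : (datumSix !![-1] !![1]).IsNegated
    [([], 0), ([1], 2), ([1, 2, 1], 0), ([0, 1], 2)]
    ![![0], ![0], ![0], ![0], ![-1], ![1]] where
  ne_zero := by decide +kernel
  independent := by decide +kernel
  neg := by decide +kernel

theorem datumTwelve_isNegated : (datumSix twoDimU twoDimV).IsNegated
    [([], 0), ([1], 2), ([1, 2, 1], 0), ([0, 1], 2)]
    ![![0, 0], ![0, 0], ![0, 0], ![0, 0], ![-1, -2], ![1, 2]] where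
  ne_zero := by decide +kernel
  independent := by decide +kernel
  neg := by decide +kernel

/-- Representatives of the conjugates of the simple short roots. -/
def shortRefls : List (List (Fin 4) × Fin 4) :=
  [([], 0), ([], 1), ([1], 0), ([2], 1), ([2, 1], 0), ([3, 2], 1), ([1, 2, 1], 0), ([3, 2, 1], 0),
    ([3, 1, 2, 1], 0), ([2, 3, 1, 2, 1], 0), ([1, 2, 3, 1, 2, 1], 0), ([0, 1, 2, 3, 1, 2, 1], 0)]

/-- Representatives of the conjugates of the simple long roots. -/
def longRefls : List (List (Fin 4) × Fin 4) :=
  [([], 2), ([], 3), ([1], 2), ([3], 2), ([0, 1], 2), ([3, 1], 2), ([3, 0, 1], 2), ([2, 3, 1], 2),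
    ([2, 3, 0, 1], 2), ([1, 2, 3, 0, 1], 2), ([2, 1, 2, 3, 0, 1], 2), ([3, 2, 1, 2, 3, 0, 1], 2)]

theorem datumOne_isNegated_neg_neg :
    (datumOne (-1) (-1)).IsNegated (shortRefls ++ longRefls) ![![1]] where
  ne_zero := by decide +kernel
  independent := by decide +kernel
  neg := by decide +kernel

/-- A nontrivial linear character is -1 on some simple reflection, so it cannot occur in degree 0.
-/
theorem datumOne_isNegated (d e : ℤˣ) (h : ¬(d = 1 ∧ e = 1)) :
    (datumOne d e).IsNegated [([], if d = 1 then 2 else 0)] ![![1]] where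
  ne_zero := by decide +kernel
  independent := by simp
  neg := by revert d e; decide +kernel

variable {W : Type*} [Group W] (cs : CoxeterSystem CoxeterMatrix.F₄ W)

/-- The exterior square of the reflection representation does not occur in degree `4`. -/
theorem not_occursInDegree_four (hD : (datumSix !![-1] !![1]).IsValid)
    (irr : ((datumSix !![-1] !![1]).rep cs hD).IsIrreducible) :
    ¬OccursInDegree cs ((datumSix !![-1] !![1]).rep cs hD) 4 := by
  rintro ⟨f, hf, hn⟩
  obtain ⟨k, hk, hfk⟩ := (InducedDatum.length_le_of_isNegated irr datumSix_isNegated_neg hf hn).2 rfl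
  set c : Fin 6 → Fin 1 → ℤ := ![![0], ![0], ![0], ![0], ![-1], ![1]] with hc
  -- In degree 4 the image of c would be a nonzero multiple of the product of its four roots. This
  -- relation between translates of c would then hold between the corresponding translates of that
  -- product.
  have hrel : ((datumSix !![-1] !![1]).wordMon [1]).mulVec c +
      ((datumSix !![-1] !![1]).wordMon [3, 0, 1]).mulVec c =
      c + ((datumSix !![-1] !![1]).wordMon [0, 1, 2, 3]).mulVec c := by
    rw [hc]
    decide +kernel
  have hadd : ∀ x y : Fin 6 → Fin 1 → ℤ, intVec (x + y) = intVec x + intVec y := by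
    intro x y
    ext p
    simp [intVec]
  have h1 := congrArg (fun x => f (intVec x)) hrel
  simp only [hadd, map_add] at h1
  rw [← InducedDatum.rep_intVec hD cs, ← InducedDatum.rep_intVec hD cs,
    ← InducedDatum.rep_intVec hD cs, f.isIntertwining, f.isIntertwining, f.isIntertwining, hfk,
    ← smul_eq_C_mul, map_smul, map_smul, map_smul, symRep_prod_lin, symRep_prod_lin,
    symRep_prod_lin, ← smul_add, ← smul_add] at h1
  -- At this point the two sides of the relation between products of roots have different values.
  have h2 := congrArg (eval (point (1, 2, 0, 1))) (smul_right_injective _ hk h1)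
  simp only [map_add, eval_prod_lin] at h2
  revert h2
  norm_cast

end LowerBounds

/-! ### Polynomials realizing the representations of degree 9. -/

section Occurrences

open MvPolynomial

variable {W : Type*} [Group W] (cs : CoxeterSystem CoxeterMatrix.F₄ W)

namespace InducedDatum

variable {m q g : ℕ} [NeZero m] {D : InducedDatum m q g} (hD : D.IsValid)

/-- Homogeneous polynomials transforming as prescribed under the inducing subgroup give an
occurrence of the induced representation. -/
theorem occursInDegree {n : ℕ} (v : Fin q → MvPolynomial (Fin 4) ℂ)
    (hv : ∀ i b, symRep cs (cs.wordProd (D.gen i)) (v b) = ∑ a, (D.act i a b : ℂ) • v a)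
    (hn : ∀ b, (v b).IsHomogeneous n) {b : Fin q} (hb : v b ≠ 0) :
    OccursInDegree cs (D.rep cs hD) n := by
  obtain ⟨f, hf⟩ := D.exists_intertwining hD cs (symRep cs) v hv
  refine ⟨f, fun h0 => hb ?_, fun u => ?_⟩
  · have := hf 0 b
    rw [hD.coset_zero, cs.wordProd_nil, map_one, Module.End.one_apply, h0] at this
    exact this.symm
  · rw [pi_eq_sum_univ' u, map_sum]
    refine Submodule.sum_mem _ fun p _ => ?_
    rw [map_smul]
    refine Submodule.smul_mem _ _ ?_
    obtain ⟨j, a⟩ := p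
    rw [hf]
    exact symRep_isHomogeneous cs (hn a) _

end InducedDatum

/-- The coordinates of an orthogonal basis. -/
def orthoVec : Fin 4 → ℤ × ℤ × ℤ × ℤ := ![(2, 3, 2, 1), (0, 1, 1, 1), (0, 1, 1, 0), (0, 1, 0, 0)]

/-- The linear forms of an orthogonal basis. -/
noncomputable def ortho (i : Fin 4) : MvPolynomial (Fin 4) ℂ := lin (orthoVec i)

theorem lin_neg (p : ℤ × ℤ × ℤ × ℤ) : lin (-p) = -lin p := by
  simp only [lin, Prod.fst_neg, Prod.snd_neg, Int.cast_neg]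
  ring

theorem symAlg_ortho {l : List (Fin 4)} {i : Fin 4} {p : ℤ × ℤ × ℤ × ℤ}
    (h : rootWord l (orthoVec i) = p) : symAlg cs (cs.wordProd l) (ortho i) = lin p := by
  rw [← h, ← symRep_lin cs]
  rfl

theorem symAlg_ortho_pos {l : List (Fin 4)} {i j : Fin 4}
    (h : rootWord l (orthoVec i) = orthoVec j) :
    symAlg cs (cs.wordProd l) (ortho i) = ortho j := symAlg_ortho cs h

theorem symAlg_ortho_neg {l : List (Fin 4)} {i j : Fin 4}
    (h : rootWord l (orthoVec i) = -orthoVec j) :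
    symAlg cs (cs.wordProd l) (ortho i) = -ortho j := by
  rw [symAlg_ortho cs h, lin_neg]
  rfl

/-- In the orthogonal coordinates the normal subgroup acts by double sign changes and double
transpositions, s_1 by a sign change and s_2 by a transposition. Eigenvector conditions become
visible symmetries of polynomials. -/
theorem symAlg_normalWord_zero :
    symAlg cs (cs.wordProd (normalWord 0)) (ortho 0) = ortho 0 ∧
    symAlg cs (cs.wordProd (normalWord 0)) (ortho 1) = ortho 1 ∧
    symAlg cs (cs.wordProd (normalWord 0)) (ortho 2) = -ortho 2 ∧
    symAlg cs (cs.wordProd (normalWord 0)) (ortho 3) = -ortho 3 :=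
  ⟨symAlg_ortho_pos cs (by decide +kernel), symAlg_ortho_pos cs (by decide +kernel),
    symAlg_ortho_neg cs (by decide +kernel), symAlg_ortho_neg cs (by decide +kernel)⟩

theorem symAlg_normalWord_one :
    symAlg cs (cs.wordProd (normalWord 1)) (ortho 0) = ortho 1 ∧
    symAlg cs (cs.wordProd (normalWord 1)) (ortho 1) = ortho 0 ∧
    symAlg cs (cs.wordProd (normalWord 1)) (ortho 2) = ortho 3 ∧
    symAlg cs (cs.wordProd (normalWord 1)) (ortho 3) = ortho 2 :=
  ⟨symAlg_ortho_pos cs (by decide +kernel), symAlg_ortho_pos cs (by decide +kernel),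
    symAlg_ortho_pos cs (by decide +kernel), symAlg_ortho_pos cs (by decide +kernel)⟩

theorem symAlg_normalWord_two :
    symAlg cs (cs.wordProd (normalWord 2)) (ortho 0) = ortho 0 ∧
    symAlg cs (cs.wordProd (normalWord 2)) (ortho 1) = -ortho 1 ∧
    symAlg cs (cs.wordProd (normalWord 2)) (ortho 2) = ortho 2 ∧
    symAlg cs (cs.wordProd (normalWord 2)) (ortho 3) = -ortho 3 :=
  ⟨symAlg_ortho_pos cs (by decide +kernel), symAlg_ortho_neg cs (by decide +kernel),
    symAlg_ortho_pos cs (by decide +kernel), symAlg_ortho_neg cs (by decide +kernel)⟩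

theorem symAlg_normalWord_three :
    symAlg cs (cs.wordProd (normalWord 3)) (ortho 0) = ortho 2 ∧
    symAlg cs (cs.wordProd (normalWord 3)) (ortho 1) = ortho 3 ∧
    symAlg cs (cs.wordProd (normalWord 3)) (ortho 2) = ortho 0 ∧
    symAlg cs (cs.wordProd (normalWord 3)) (ortho 3) = ortho 1 :=
  ⟨symAlg_ortho_pos cs (by decide +kernel), symAlg_ortho_pos cs (by decide +kernel),
    symAlg_ortho_pos cs (by decide +kernel), symAlg_ortho_pos cs (by decide +kernel)⟩

theorem symAlg_simple_one :
    symAlg cs (cs.wordProd [1]) (ortho 0) = ortho 0 ∧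
    symAlg cs (cs.wordProd [1]) (ortho 1) = ortho 1 ∧
    symAlg cs (cs.wordProd [1]) (ortho 2) = ortho 2 ∧
    symAlg cs (cs.wordProd [1]) (ortho 3) = -ortho 3 :=
  ⟨symAlg_ortho_pos cs (by decide +kernel), symAlg_ortho_pos cs (by decide +kernel),
    symAlg_ortho_pos cs (by decide +kernel), symAlg_ortho_neg cs (by decide +kernel)⟩

theorem symAlg_simple_two :
    symAlg cs (cs.wordProd [2]) (ortho 0) = ortho 0 ∧
    symAlg cs (cs.wordProd [2]) (ortho 1) = ortho 1 ∧
    symAlg cs (cs.wordProd [2]) (ortho 2) = ortho 3 ∧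
    symAlg cs (cs.wordProd [2]) (ortho 3) = ortho 2 :=
  ⟨symAlg_ortho_pos cs (by decide +kernel), symAlg_ortho_pos cs (by decide +kernel),
    symAlg_ortho_pos cs (by decide +kernel), symAlg_ortho_pos cs (by decide +kernel)⟩

theorem mem_normalEigenspace_of_ortho {f : MvPolynomial (Fin 4) ℂ} {ε : Fin 4 → ℤˣ}
    (h0 : symAlg cs (cs.wordProd (normalWord 0)) f = signC (ε 0) • f)
    (h1 : symAlg cs (cs.wordProd (normalWord 1)) f = signC (ε 1) • f)
    (h2 : symAlg cs (cs.wordProd (normalWord 2)) f = signC (ε 2) • f)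
    (h3 : symAlg cs (cs.wordProd (normalWord 3)) f = signC (ε 3) • f) :
    f ∈ normalEigenspace cs (symRep cs) ε := fun k =>
  match k with
  | 0 => h0
  | 1 => h1
  | 2 => h2
  | 3 => h3

/-- The polynomial generating a representation of degree `9`. -/
noncomputable def nineForm (d e : ℤˣ) : MvPolynomial (Fin 4) ℂ :=
  (ortho 2 ^ 2 + ortho 3 ^ 2 - ortho 0 ^ 2 - ortho 1 ^ 2) *
    ((if d = 1 then 1 else ortho 0 * ortho 1 * ortho 2 * ortho 3) *
      (if e = 1 then 1 else (ortho 0 ^ 2 - ortho 1 ^ 2) * (ortho 2 ^ 2 - ortho 3 ^ 2)))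

theorem nineForm_simple_one (d e : ℤˣ) :
    symRep cs (cs.simple 1) (nineForm d e) = signC d • nineForm d e := by
  obtain ⟨h0, h1, h2, h3⟩ := symAlg_simple_one cs
  rw [cs.wordProd_singleton] at h0 h1 h2 h3
  rw [symRep_eq]
  rcases Int.units_eq_one_or d with rfl | rfl <;> rcases Int.units_eq_one_or e with rfl | rfl <;>
    simp [nineForm, h0, h1, h2, h3]

theorem nineForm_simple_two (d e : ℤˣ) :
    symRep cs (cs.simple 2) (nineForm d e) = signC e • nineForm d e := by
  obtain ⟨h0, h1, h2, h3⟩ := symAlg_simple_two cs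
  rw [cs.wordProd_singleton] at h0 h1 h2 h3
  rw [symRep_eq]
  rcases Int.units_eq_one_or d with rfl | rfl <;> rcases Int.units_eq_one_or e with rfl | rfl <;>
    simp [nineForm, h0, h1, h2, h3] <;> ring

/-- Among the four generators only the last changes the sign of the quadratic factor. The optional
factors are invariant under the normal subgroup and carry the signs of s_1 and s_2. -/
theorem nineForm_mem (d e : ℤˣ) :
    nineForm d e ∈ normalEigenspace cs (symRep cs) ![1, 1, 1, -1] := by
  obtain ⟨a0, a1, a2, a3⟩ := symAlg_normalWord_zero cs
  obtain ⟨b0, b1, b2, b3⟩ := symAlg_normalWord_one cs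
  obtain ⟨c0, c1, c2, c3⟩ := symAlg_normalWord_two cs
  obtain ⟨d0, d1, d2, d3⟩ := symAlg_normalWord_three cs
  apply mem_normalEigenspace_of_ortho <;>
    rcases Int.units_eq_one_or d with rfl | rfl <;>
    rcases Int.units_eq_one_or e with rfl | rfl <;>
    simp [nineForm, a0, a1, a2, a3, b0, b1, b2, b3, c0, c1, c2, c3, d0, d1, d2, d3] <;> ring

theorem ortho_isHomogeneous (i : Fin 4) : (ortho i).IsHomogeneous 1 := lin_isHomogeneous _

theorem ne_zero_of_eval {f : MvPolynomial (Fin 4) ℂ} {x : ℤ × ℤ × ℤ × ℤ} {n : ℤ}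
    (h : eval (point x) f = (n : ℂ)) (hn : n ≠ 0) : f ≠ 0 := by
  rintro rfl
  rw [map_zero] at h
  exact hn (by exact_mod_cast h.symm)

theorem eval_ortho_one : eval (point (1, 1, 1, 1)) (ortho 0) = 8 ∧
    eval (point (1, 1, 1, 1)) (ortho 1) = 3 ∧ eval (point (1, 1, 1, 1)) (ortho 2) = 2 ∧
    eval (point (1, 1, 1, 1)) (ortho 3) = 1 := by
  refine ⟨?_, ?_, ?_, ?_⟩ <;> simp [ortho, orthoVec, eval_lin, dot]

theorem nineForm_ne_zero (d e : ℤˣ) : nineForm d e ≠ 0 := by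
  obtain ⟨h0, h1, h2, h3⟩ := eval_ortho_one
  intro h
  have := congrArg (eval (point (1, 1, 1, 1))) h
  rcases Int.units_eq_one_or d with rfl | rfl <;> rcases Int.units_eq_one_or e with rfl | rfl <;>
    simp [nineForm, h0, h1, h2, h3] at this <;> norm_num at this

theorem nineForm_isHomogeneous (d e : ℤˣ) : (nineForm d e).IsHomogeneous
    (2 + ((if d = 1 then 0 else 4) + (if e = 1 then 0 else 4))) := by
  have h := ortho_isHomogeneous
  have h2 : ∀ i, (ortho i ^ 2).IsHomogeneous 2 := fun i => (h i).pow 2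
  refine ((((h2 2).add (h2 3)).sub (h2 0)).sub (h2 1)).mul (IsHomogeneous.mul ?_ ?_)
  · split_ifs
    · exact isHomogeneous_one _ _
    · exact (((h 0).mul (h 1)).mul (h 2)).mul (h 3)
  · split_ifs
    · exact isHomogeneous_one _ _
    · exact ((h2 0).sub (h2 1)).mul ((h2 2).sub (h2 3))

theorem datumNine_occursInDegree (d e : ℤˣ) :
    OccursInDegree cs ((datumNine d e).rep cs (datumNine_isValid d e))
      (2 + ((if d = 1 then 0 else 4) + (if e = 1 then 0 else 4))) :=
  InducedDatum.occursInDegree cs _ (fun _ => nineForm d e)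
    (datumNine_act cs (symRep cs) d e (nineForm_simple_one cs d e) (nineForm_simple_two cs d e)
      (nineForm_mem cs d e)) (fun _ => nineForm_isHomogeneous d e) (b := 0) (nineForm_ne_zero d e)

end Occurrences

/-! ### Polynomials realizing the representations of degrees 6, 12 and 1. -/

section MoreOccurrences

open MvPolynomial

variable {W : Type*} [Group W] (cs : CoxeterSystem CoxeterMatrix.F₄ W)

theorem symAlg_word_one_two :
    symAlg cs (cs.wordProd [1, 2]) (ortho 0) = ortho 0 ∧
    symAlg cs (cs.wordProd [1, 2]) (ortho 1) = ortho 1 ∧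
    symAlg cs (cs.wordProd [1, 2]) (ortho 2) = -ortho 3 ∧
    symAlg cs (cs.wordProd [1, 2]) (ortho 3) = ortho 2 :=
  ⟨symAlg_ortho_pos cs (by decide +kernel), symAlg_ortho_pos cs (by decide +kernel),
    symAlg_ortho_neg cs (by decide +kernel), symAlg_ortho_pos cs (by decide +kernel)⟩

theorem ortho_eq : ortho 0 = 2 * X 0 + 3 * X 1 + 2 * X 2 + X 3 ∧ ortho 1 = X 1 + X 2 + X 3 ∧
    ortho 2 = X 1 + X 2 ∧ ortho 3 = X 1 := by
  simp [ortho, orthoVec, lin]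

/-- This element does not permute the orthogonal coordinates up to sign, so identities involving it
are verified after expansion in the simple roots. -/
theorem symAlg_word_zero_three :
    symAlg cs (cs.wordProd [0, 3]) (ortho 0) = X 0 + 3 * X 1 + 2 * X 2 + X 3 ∧
    symAlg cs (cs.wordProd [0, 3]) (ortho 1) = X 0 + X 1 + X 2 ∧
    symAlg cs (cs.wordProd [0, 3]) (ortho 2) = X 0 + X 1 + X 2 + X 3 ∧
    symAlg cs (cs.wordProd [0, 3]) (ortho 3) = X 0 + X 1 := by
  refine ⟨?_, ?_, ?_, ?_⟩
  · rw [symAlg_ortho cs (p := (1, 3, 2, 1)) (by decide +kernel)]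
    simp [lin]
  · rw [symAlg_ortho cs (p := (1, 1, 1, 0)) (by decide +kernel)]
    simp [lin]
  · rw [symAlg_ortho cs (p := (1, 1, 1, 1)) (by decide +kernel)]
    simp [lin]
  · rw [symAlg_ortho cs (p := (1, 1, 0, 0)) (by decide +kernel)]
    simp [lin]

/-- The polynomial generating a representation of degree `6`. -/
noncomputable def sixForm (d : ℤˣ) : MvPolynomial (Fin 4) ℂ :=
  if d = 1 then
    (ortho 0 ^ 2 - ortho 1 ^ 2) * (ortho 2 * ortho 3) *
        (ortho 0 ^ 2 + ortho 1 ^ 2 - ortho 2 ^ 2 - ortho 3 ^ 2) +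
      ortho 0 * ortho 1 * (ortho 2 ^ 2 - ortho 3 ^ 2) *
        (ortho 2 ^ 2 + ortho 3 ^ 2 - ortho 0 ^ 2 - ortho 1 ^ 2)
  else
    ortho 0 * ortho 1 * (ortho 0 ^ 2 - ortho 1 ^ 2) *
        (ortho 0 ^ 2 + ortho 1 ^ 2 - 5 * (ortho 2 ^ 2 + ortho 3 ^ 2)) +
      ortho 2 * ortho 3 * (ortho 2 ^ 2 - ortho 3 ^ 2) *
        (ortho 2 ^ 2 + ortho 3 ^ 2 - 5 * (ortho 0 ^ 2 + ortho 1 ^ 2))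

theorem C_five : (C 5 : MvPolynomial (Fin 4) ℂ) = 5 := map_ofNat C 5

theorem sixForm_word_zero_three (d : ℤˣ) :
    symRep cs (cs.wordProd [0, 3]) (sixForm d) = signC d • sixForm d := by
  obtain ⟨h0, h1, h2, h3⟩ := symAlg_word_zero_three cs
  obtain ⟨o0, o1, o2, o3⟩ := ortho_eq
  rw [symRep_eq]
  rcases Int.units_eq_one_or d with rfl | rfl
  · simp only [sixForm, if_true, map_add, map_sub, map_mul, map_pow, h0, h1, h2, h3, signC_one,
      one_smul]
    simp only [o0, o1, o2, o3]
    ring1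
  · simp only [sixForm, (by decide : ¬(-1 : ℤˣ) = 1), if_false, map_add, map_sub, map_mul,
      map_pow, h0, h1, h2, h3, signC_neg_one, neg_one_smul, map_ofNat]
    simp only [o0, o1, o2, o3]
    ring1

theorem sixForm_word_one_two (d : ℤˣ) :
    symRep cs (cs.wordProd [1, 2]) (sixForm d) = -signC d • sixForm d := by
  obtain ⟨h0, h1, h2, h3⟩ := symAlg_word_one_two cs
  rw [symRep_eq]
  rcases Int.units_eq_one_or d with rfl | rfl
  · simp only [sixForm, if_true, map_add, map_sub, map_mul, map_pow, h0, h1, h2, h3, signC_one,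
      neg_one_smul]
    ring
  · simp only [sixForm, (by decide : ¬(-1 : ℤˣ) = 1), if_false, map_add, map_sub, map_mul,
      map_pow, h0, h1, h2, h3, signC_neg_one, neg_neg, one_smul, map_ofNat]
    ring

theorem sixForm_mem (d : ℤˣ) :
    sixForm d ∈ normalEigenspace cs (symRep cs) ![1, -1, -1, 1] := by
  obtain ⟨a0, a1, a2, a3⟩ := symAlg_normalWord_zero cs
  obtain ⟨b0, b1, b2, b3⟩ := symAlg_normalWord_one cs
  obtain ⟨c0, c1, c2, c3⟩ := symAlg_normalWord_two cs
  obtain ⟨d0, d1, d2, d3⟩ := symAlg_normalWord_three cs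
  apply mem_normalEigenspace_of_ortho <;>
    rcases Int.units_eq_one_or d with rfl | rfl <;>
    simp [sixForm, map_ofNat, a0, a1, a2, a3, b0, b1, b2, b3, c0, c1, c2, c3, d0, d1, d2, d3] <;> ring

theorem sixForm_isHomogeneous (d : ℤˣ) : (sixForm d).IsHomogeneous 6 := by
  have h := ortho_isHomogeneous
  have h2 : ∀ i, (ortho i ^ 2).IsHomogeneous 2 := fun i => (h i).pow 2
  have h11 : ∀ i j, (ortho i * ortho j).IsHomogeneous 2 := fun i j => (h i).mul (h j)
  unfold sixForm
  split_ifs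
  · exact ((((h2 0).sub (h2 1)).mul (h11 2 3)).mul ((((h2 0).add (h2 1)).sub (h2 2)).sub
      (h2 3))).add (((h11 0 1).mul ((h2 2).sub (h2 3))).mul ((((h2 2).add (h2 3)).sub (h2 0)).sub
      (h2 1)))
  · rw [← C_five]
    exact (((h11 0 1).mul ((h2 0).sub (h2 1))).mul (((h2 0).add (h2 1)).sub
      (((h2 2).add (h2 3)).C_mul 5))).add (((h11 2 3).mul ((h2 2).sub (h2 3))).mul
      (((h2 2).add (h2 3)).sub (((h2 0).add (h2 1)).C_mul 5)))

theorem sixForm_ne_zero (d : ℤˣ) : sixForm d ≠ 0 := by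
  obtain ⟨h0, h1, h2, h3⟩ := eval_ortho_one
  intro h
  have := congrArg (eval (point (1, 1, 1, 1))) h
  rcases Int.units_eq_one_or d with rfl | rfl <;>
    simp [sixForm, h0, h1, h2, h3] at this <;> norm_num at this

theorem datumSix_occursInDegree (d : ℤˣ) :
    OccursInDegree cs ((datumSix !![(d : ℤ)] !![-(d : ℤ)]).rep cs (datumSix_isValid d)) 6 := by
  refine InducedDatum.occursInDegree cs _ (fun _ => sixForm d)
    (datumSix_act cs (symRep cs) _ _ _ (fun b => ?_) (fun b => ?_) fun _ => sixForm_mem cs d)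
    (fun _ => sixForm_isHomogeneous d) (b := 0) (sixForm_ne_zero d)
  · obtain rfl : b = 0 := Subsingleton.elim _ _
    rw [Fin.sum_univ_one]
    exact sixForm_word_zero_three cs d
  · obtain rfl : b = 0 := Subsingleton.elim _ _
    rw [Fin.sum_univ_one, sixForm_word_one_two]
    congr 1
    exact (Int.cast_neg _).symm

/-- The polynomial generating the representation of degree `12`. -/
noncomputable def twelveForm : MvPolynomial (Fin 4) ℂ :=
  ortho 0 * ortho 1 * (ortho 2 ^ 2 - ortho 3 ^ 2) + ortho 2 * ortho 3 * (ortho 0 ^ 2 - ortho 1 ^ 2)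

theorem twelveForm_mem : twelveForm ∈ normalEigenspace cs (symRep cs) ![1, -1, -1, 1] := by
  obtain ⟨a0, a1, a2, a3⟩ := symAlg_normalWord_zero cs
  obtain ⟨b0, b1, b2, b3⟩ := symAlg_normalWord_one cs
  obtain ⟨c0, c1, c2, c3⟩ := symAlg_normalWord_two cs
  obtain ⟨d0, d1, d2, d3⟩ := symAlg_normalWord_three cs
  apply mem_normalEigenspace_of_ortho <;>
    simp [twelveForm, a0, a1, a2, a3, b0, b1, b2, b3, c0, c1, c2, c3, d0, d1, d2, d3] <;> ring

theorem twelveForm_isHomogeneous : twelveForm.IsHomogeneous 4 := by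
  have h := ortho_isHomogeneous
  have h2 : ∀ i, (ortho i ^ 2).IsHomogeneous 2 := fun i => (h i).pow 2
  have h11 : ∀ i j, (ortho i * ortho j).IsHomogeneous 2 := fun i j => (h i).mul (h j)
  exact ((h11 0 1).mul ((h2 2).sub (h2 3))).add ((h11 2 3).mul ((h2 0).sub (h2 1)))

theorem twelveForm_ne_zero : twelveForm ≠ 0 := by
  obtain ⟨h0, h1, h2, h3⟩ := eval_ortho_one
  intro h
  have := congrArg (eval (point (1, 1, 1, 1))) h
  simp [twelveForm, h0, h1, h2, h3] at this
  norm_num at this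

theorem twelveForm_word_one_two :
    symRep cs (cs.wordProd [1, 2]) twelveForm = -twelveForm := by
  obtain ⟨h0, h1, h2, h3⟩ := symAlg_word_one_two cs
  rw [symRep_eq]
  simp only [twelveForm, map_add, map_sub, map_mul, map_pow, h0, h1, h2, h3]
  ring

theorem symAlg_word_one_two_zero_three :
    symAlg cs (cs.wordProd [1, 2, 0, 3]) (ortho 0) = X 0 + 2 * X 1 + 2 * X 2 + X 3 ∧
    symAlg cs (cs.wordProd [1, 2, 0, 3]) (ortho 1) = X 0 ∧
    symAlg cs (cs.wordProd [1, 2, 0, 3]) (ortho 2) = X 0 + 2 * X 1 + X 2 + X 3 ∧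
    symAlg cs (cs.wordProd [1, 2, 0, 3]) (ortho 3) = X 0 + 2 * X 1 + X 2 := by
  refine ⟨?_, ?_, ?_, ?_⟩
  · rw [symAlg_ortho cs (p := (1, 2, 2, 1)) (by decide +kernel)]
    simp [lin]
  · rw [symAlg_ortho cs (p := (1, 0, 0, 0)) (by decide +kernel)]
    simp [lin]
  · rw [symAlg_ortho cs (p := (1, 2, 1, 1)) (by decide +kernel)]
    simp [lin]
  · rw [symAlg_ortho cs (p := (1, 2, 1, 0)) (by decide +kernel)]
    simp [lin]

theorem twelveForm_word_one_two_zero_three :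
    symRep cs (cs.wordProd [1, 2]) (symRep cs (cs.wordProd [0, 3]) twelveForm) =
      twelveForm + symRep cs (cs.wordProd [0, 3]) twelveForm := by
  obtain ⟨h0, h1, h2, h3⟩ := symAlg_word_zero_three cs
  obtain ⟨k0, k1, k2, k3⟩ := symAlg_word_one_two_zero_three cs
  obtain ⟨o0, o1, o2, o3⟩ := ortho_eq
  rw [← apply_append, symRep_eq, symRep_eq]
  simp only [List.cons_append, List.nil_append, twelveForm, map_add, map_sub, map_mul, map_pow, h0,
    h1, h2, h3, k0, k1, k2, k3]
  simp only [o0, o1, o2, o3]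
  ring1

theorem datumTwelve_occursInDegree :
    OccursInDegree cs ((datumSix twoDimU twoDimV).rep cs datumTwelve_isValid) 4 := by
  have hu : symRep cs (cs.wordProd [0, 3]) (symRep cs (cs.wordProd [0, 3]) twelveForm) =
      twelveForm := by
    rw [← apply_append, apply_congr cs _ (l' := []) (by decide +kernel)]
    simp
  have hmem := word_mem_normalEigenspace cs _ (twelveForm_mem cs) [0, 3]
  rw [show [0, 3].foldr charStep ![1, -1, -1, 1] = ![1, -1, -1, 1] by decide] at hmem
  refine InducedDatum.occursInDegree cs _ ![twelveForm, symRep cs (cs.wordProd [0, 3]) twelveForm]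
    (datumSix_act cs (symRep cs) _ _ _ ?_ ?_ ?_) ?_ (b := 0) twelveForm_ne_zero
  · rw [Fin.forall_fin_two, Fin.sum_univ_two, Fin.sum_univ_two]
    simp [twoDimU, hu]
  · rw [Fin.forall_fin_two, Fin.sum_univ_two, Fin.sum_univ_two]
    simp [twoDimV, twelveForm_word_one_two, twelveForm_word_one_two_zero_three]
  · rw [Fin.forall_fin_two]
    exact ⟨twelveForm_mem cs, hmem⟩
  · rw [Fin.forall_fin_two]
    exact ⟨twelveForm_isHomogeneous, symRep_isHomogeneous cs twelveForm_isHomogeneous _⟩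

/-- The sign of a root. -/
def rootSign (p : ℤ × ℤ × ℤ × ℤ) : ℤ :=
  if p.1 < 0 ∨ p.2.1 < 0 ∨ p.2.2.1 < 0 ∨ p.2.2.2 < 0 then -1 else 1

theorem lin_rootSign (p : ℤ × ℤ × ℤ × ℤ) : lin p = (rootSign p : ℂ) • lin (rootSign p • p) := by
  unfold rootSign
  split_ifs
  · rw [neg_one_smul, lin_neg]
    simp
  · simp

theorem prod_lin_of_perm {L L' : List (ℤ × ℤ × ℤ × ℤ)}
    (h : (L'.map fun p => rootSign p • p).Perm L) :
    (L'.map lin).prod = (((L'.map rootSign).prod : ℤ) : ℂ) • (L.map lin).prod := by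
  rw [← (h.map lin).prod_eq]
  clear h
  induction L' with
  | nil => simp
  | cons p L' ih =>
    simp only [List.map_cons, List.prod_cons, ih, Int.cast_mul]
    nth_rewrite 1 [lin_rootSign p]
    rw [smul_mul_smul_comm]

/-- The positive roots whose product transforms according to a linear character. -/
def oneRoots (d e : ℤˣ) : List (ℤ × ℤ × ℤ × ℤ) :=
  ((if d = 1 then [] else shortRefls) ++ if e = 1 then [] else longRefls).map wordRoot

/-- A simple reflection permutes the positive roots of each length, except that it negates its own
simple root. The product of the positive roots of one length therefore changes sign exactly under
the simple reflections of that length. -/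
theorem oneRoots_perm : ∀ (d e : ℤˣ) (i : Fin 4),
    (((oneRoots d e).map (rootWord [i])).map fun p => rootSign p • p).Perm (oneRoots d e) ∧
      (((oneRoots d e).map (rootWord [i])).map rootSign).prod = (![d, d, e, e] : Fin 4 → ℤˣ) i := by
  decide +kernel

theorem datumOne_occursInDegree (d e : ℤˣ) :
    OccursInDegree cs ((datumOne d e).rep cs (datumOne_isValid d e))
      ((if d = 1 then 0 else 12) + if e = 1 then 0 else 12) := by
  refine InducedDatum.occursInDegree cs _ (fun _ => ((oneRoots d e).map lin).prod)
    (datumOne_act cs (symRep cs) d e fun i => ?_) (fun _ => ?_) (b := 0) ?_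
  · obtain ⟨h1, h2⟩ := oneRoots_perm d e i
    rw [← cs.wordProd_singleton, symRep_prod_lin, prod_lin_of_perm h1, h2]
    rfl
  · have h : (oneRoots d e).length = (if d = 1 then 0 else 12) + if e = 1 then 0 else 12 := by
      revert d e
      decide
    rw [← h]
    exact prod_lin_isHomogeneous _
  · refine ne_zero_of_eval (eval_prod_lin _ (1, 1, 1, 1)) ?_
    revert d e
    decide +kernel

end MoreOccurrences

/-! ### The tensor square separates the two representations of degree 6. -/

section TensorSquare

open scoped TensorProduct

variable {W : Type*} [Group W] (cs : CoxeterSystem CoxeterMatrix.F₄ W)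

theorem reflectionRep_simple_apply (i k : Fin 4) (x : Fin 4 → ℂ) :
    reflectionRep cs (cs.simple i) x k =
      x k - if k = i then ∑ j, (CartanMatrix.F₄ i j : ℂ) * x j else 0 := by
  change Matrix.toLin' ((f4Mat cs (cs.simple i)).map (Int.cast : ℤ → ℂ)) x k = _
  rw [Matrix.toLin'_apply, f4Mat_simple, Matrix.mulVec, dotProduct]
  simp only [Matrix.map_apply, f4Refl, Matrix.of_apply, Int.cast_sub, sub_mul,
    Finset.sum_sub_distrib]
  split_ifs with h <;> simp

theorem reflectionRep_simple_point (i : Fin 4) (p : ℤ × ℤ × ℤ × ℤ) :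
    reflectionRep cs (cs.simple i) (point p) = point (rootStep i p) := by
  ext k
  rw [reflectionRep_simple_apply]
  fin_cases i <;> fin_cases k <;>
    simp [point, coord, rootStep, Fin.sum_univ_four, CartanMatrix.F₄] <;> ring

theorem reflectionRep_point (l : List (Fin 4)) (p : ℤ × ℤ × ℤ × ℤ) :
    reflectionRep cs (cs.wordProd l) (point p) = point (rootWord l p) := by
  induction l with
  | nil => simp [rootWord]
  | cons i l ih => rw [apply_cons, ih, reflectionRep_simple_point]; rfl

/-- The coordinates of a tensor. -/
noncomputable def entryMap (k l : Fin 4) : (Fin 4 → ℂ) ⊗[ℂ] (Fin 4 → ℂ) →ₗ[ℂ] ℂ :=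
  LinearMap.mul' ℂ ℂ ∘ₗ TensorProduct.map (LinearMap.proj k) (LinearMap.proj l)

theorem entryMap_tmul (k l : Fin 4) (x y : Fin 4 → ℂ) : entryMap k l (x ⊗ₜ y) = x k * y l := rfl

theorem entryMap_ext {t t' : (Fin 4 → ℂ) ⊗[ℂ] (Fin 4 → ℂ)}
    (h : ∀ k l, entryMap k l t = entryMap k l t') : t = t' := by
  have key : ∀ (t : (Fin 4 → ℂ) ⊗[ℂ] (Fin 4 → ℂ)) (k l : Fin 4),
      ((Pi.basisFun ℂ (Fin 4)).tensorProduct (Pi.basisFun ℂ (Fin 4))).repr t (k, l) =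
        entryMap k l t := by
    intro t k l
    induction t with
    | zero => simp
    | tmul x y => simp [entryMap_tmul, mul_comm]
    | add x y hx hy => rw [map_add, map_add, Finsupp.add_apply, hx, hy]
  refine ((Pi.basisFun ℂ (Fin 4)).tensorProduct (Pi.basisFun ℂ (Fin 4))).ext_elem fun p => ?_
  obtain ⟨k, l⟩ := p
  rw [key, key, h]

/-- The tensor given by a list of pairs of integer vectors. -/
noncomputable def tens (L : List ((ℤ × ℤ × ℤ × ℤ) × (ℤ × ℤ × ℤ × ℤ))) :
    (Fin 4 → ℂ) ⊗[ℂ] (Fin 4 → ℂ) := (L.map fun p => point p.1 ⊗ₜ point p.2).sum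

/-- The integer coordinates of a tensor. -/
def tensEntry (L : List ((ℤ × ℤ × ℤ × ℤ) × (ℤ × ℤ × ℤ × ℤ))) (k l : Fin 4) : ℤ :=
  (L.map fun p => coord p.1 k * coord p.2 l).sum

theorem entryMap_tens (L : List ((ℤ × ℤ × ℤ × ℤ) × (ℤ × ℤ × ℤ × ℤ))) (k l : Fin 4) :
    entryMap k l (tens L) = (tensEntry L k l : ℂ) := by
  rw [tens, tensEntry, map_list_sum, List.map_map, Int.cast_list_sum, List.map_map]
  congr 2
  funext p
  simp [entryMap_tmul, point]

theorem tprod_tens (w : List (Fin 4)) (L : List ((ℤ × ℤ × ℤ × ℤ) × (ℤ × ℤ × ℤ × ℤ))) :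
    (reflectionRep cs).tprod (reflectionRep cs) (cs.wordProd w) (tens L) =
      tens (L.map fun p => (rootWord w p.1, rootWord w p.2)) := by
  rw [tens, tens, map_list_sum, List.map_map, List.map_map]
  congr 2
  funext p
  simp [Representation.tprod_apply, reflectionRep_point]

/-- The exterior square of the reflection representation occurs in the tensor square. -/
theorem occursInTensorSquare_neg :
    OccursInTensorSquare cs ((datumSix !![((-1 : ℤˣ) : ℤ)] !![-((-1 : ℤˣ) : ℤ)]).rep cs
      (datumSix_isValid (-1))) := by
  -- This is the bivector o₀ ∧ o₁ + o₂ ∧ o₃ in the orthogonal basis; the inducing subgroup of index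
  -- 6 acts on it by the prescribed signs.
  let L : List ((ℤ × ℤ × ℤ × ℤ) × (ℤ × ℤ × ℤ × ℤ)) :=
    [(orthoVec 0, orthoVec 1), (-orthoVec 1, orthoVec 0), (orthoVec 2, orthoVec 3),
      (-orthoVec 3, orthoVec 2)]
  have act : ∀ (w : List (Fin 4)) (n : ℤ), (∀ k l,
      tensEntry (L.map fun p => (rootWord w p.1, rootWord w p.2)) k l = n * tensEntry L k l) →
      (reflectionRep cs).tprod (reflectionRep cs) (cs.wordProd w) (tens L) = (n : ℂ) • tens L := by
    intro w n h
    rw [tprod_tens]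
    refine entryMap_ext fun k l => ?_
    rw [map_smul, entryMap_tens, entryMap_tens, h, Int.cast_mul, smul_eq_mul]
  refine InducedDatum.exists_intertwining_ne_zero (datumSix_isValid (-1)) cs _ (fun _ => tens L)
    (datumSix_act cs _ _ _ _ (fun b => ?_) (fun b => ?_) fun _ k => ?_) (b := 0) fun h => ?_
  · obtain rfl : b = 0 := Subsingleton.elim _ _
    rw [Fin.sum_univ_one]
    exact act _ _ (by decide +kernel)
  · obtain rfl : b = 0 := Subsingleton.elim _ _
    rw [Fin.sum_univ_one]
    exact act _ _ (by decide +kernel)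
  · exact act _ _ (by revert k; decide +kernel)
  · have := congrArg (entryMap 0 1) h
    rw [entryMap_tens, map_zero] at this
    exact absurd (Int.cast_eq_zero.1 this) (by decide +kernel)

/-- A simple reflection changes only its own coordinate of a vector. -/
theorem entryMap_tprod_simple {i k l : Fin 4} (hk : k ≠ i) (hl : l ≠ i)
    (t : (Fin 4 → ℂ) ⊗[ℂ] (Fin 4 → ℂ)) :
    entryMap k l ((reflectionRep cs).tprod (reflectionRep cs) (cs.simple i) t) =
      entryMap k l t := by
  induction t with
  | zero => simp
  | tmul x y =>
    rw [Representation.tprod_apply, TensorProduct.map_tmul, entryMap_tmul, entryMap_tmul,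
      reflectionRep_simple_apply, reflectionRep_simple_apply, if_neg hk, if_neg hl, sub_zero,
      sub_zero]
  | add x y hx hy => rw [map_add, map_add, map_add, hx, hy]

/-- The representation contains a nonzero vector negated by s_0, s_1 and s_3. For any pair of
coordinates one of these reflections leaves both unchanged, so the corresponding entry of the image
tensor equals its negative; all entries vanish, against injectivity. -/
theorem not_occursInTensorSquare_one
    (irr : ((datumSix !![((1 : ℤˣ) : ℤ)] !![-((1 : ℤˣ) : ℤ)]).rep cs
      (datumSix_isValid 1)).IsIrreducible) :
    ¬OccursInTensorSquare cs ((datumSix !![((1 : ℤˣ) : ℤ)] !![-((1 : ℤˣ) : ℤ)]).rep cs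
      (datumSix_isValid 1)) := by
  rintro ⟨f, hf⟩
  have hinj := (Representation.IsIrreducible.injective_or_eq_zero f).resolve_right hf
  have hA := datumSix_isNegated_one
  set c : Fin 6 → Fin 1 → ℤ := ![![-1], ![1], ![1], ![-1], ![-1], ![1]]
  apply BlockMon.intVec_ne_zero hA.ne_zero
  apply hinj
  rw [map_zero]
  refine entryMap_ext fun k l => ?_
  have hs : ∀ i ∈ [0, 1, 3], (reflectionRep cs).tprod (reflectionRep cs) (cs.simple i)
      (f (BlockMon.intVec c)) = -f (BlockMon.intVec c) := by
    intro i hi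
    have h1 : ((datumSix !![((1 : ℤˣ) : ℤ)] !![-((1 : ℤˣ) : ℤ)]).wordMon [i]).mulVec c = -c := by
      revert i
      decide +kernel
    rw [← f.isIntertwining, ← cs.wordProd_singleton, InducedDatum.rep_intVec, h1,
      BlockMon.intVec_neg, map_neg]
  obtain ⟨i, hi, hk, hl⟩ : ∃ i ∈ [0, 1, 3], k ≠ i ∧ l ≠ i := by
    revert k l
    decide
  have h1 := entryMap_tprod_simple cs hk hl (f (BlockMon.intVec c))
  rw [hs i hi, map_neg, neg_eq_iff_add_eq_zero, ← two_smul ℂ] at h1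
  rw [map_zero]
  exact (smul_eq_zero.1 h1).resolve_left two_ne_zero

end TensorSquare

/-! ### Extensions to the semidirect product and their uniqueness up to sign. -/

section Extension

variable {W : Type*} [Group W] {cs : CoxeterSystem CoxeterMatrix.F₄ W} {σ : MulAut W}

/-- The nontrivial element of the group generated by `σ`. -/
def sigmaElt (σ : MulAut W) : Subgroup.zpowers σ := ⟨σ, Subgroup.mem_zpowers σ⟩

theorem sigma_mul_self (hσ2 : orderOf σ = 2) : σ * σ = 1 := by
  rw [← sq, ← hσ2, pow_orderOf_eq_one]

theorem sigmaElt_mul_self (hσ2 : orderOf σ = 2) : sigmaElt σ * sigmaElt σ = 1 :=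
  Subtype.ext (sigma_mul_self hσ2)

theorem sigmaElt_ne_one (hσ2 : orderOf σ = 2) : sigmaElt σ ≠ 1 := by
  intro h
  have h1 : σ = 1 := congrArg Subtype.val h
  rw [h1, orderOf_one] at hσ2
  omega

theorem eq_one_or_sigmaElt (hσ2 : orderOf σ = 2) (x : Subgroup.zpowers σ) :
    x = 1 ∨ x = sigmaElt σ := by
  obtain ⟨x, k, rfl⟩ := x
  have h2 : σ ^ (2 : ℤ) = 1 := by
    rw [zpow_two]
    exact sigma_mul_self hσ2
  rcases Int.even_or_odd' k with ⟨n, rfl | rfl⟩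
  · left
    apply Subtype.ext
    change σ ^ (2 * n) = 1
    rw [zpow_mul, h2, one_zpow]
  · right
    apply Subtype.ext
    change σ ^ (2 * n + 1) = σ
    rw [zpow_add, zpow_mul, h2, one_zpow, one_mul, zpow_one]

theorem nontrivial_of_isIrreducible {G U : Type*} [Group G] [AddCommGroup U] [Module ℂ U]
    {R : Representation ℂ G U} (hR : R.IsIrreducible) : Nontrivial U := by
  by_contra h
  rw [not_nontrivial_iff_subsingleton] at h
  exact bot_ne_top (Subrepresentation.toSubmodule_injective (Subsingleton.elim
    (⊥ : Subrepresentation R).toSubmodule (⊤ : Subrepresentation R).toSubmodule))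

variable {m q g : ℕ} [NeZero m] {D : InducedDatum m q g} (hD : D.IsValid) {T : BlockMon m q}

/-- An involution implementing the diagram automorphism. -/
structure IsTwist (D : InducedDatum m q g) (T : BlockMon m q) : Prop where
  mul_self : T * T = 1
  mul_simpleMon : ∀ s, T * D.simpleMon s = D.simpleMon s.rev * T

theorem IsTwist.mul_monHom (hT : IsTwist D T) (hσ : ∀ i, σ (cs.simple i) = cs.simple i.rev) (w : W) :
    T * D.monHom cs hD w = D.monHom cs hD (σ w) * T := by
  induction w using cs.simple_induction_left with
  | one => simp
  | mul_simple_left w i ih =>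
    have h : ∀ i, D.monHom cs hD (cs.simple i) = D.simpleMon i :=
      fun i => cs.lift_apply_simple hD.liftable i
    rw [map_mul, map_mul, map_mul, hσ, h, h, ← mul_assoc, hT.mul_simpleMon, mul_assoc, ih, mul_assoc]

open Classical in
/-- The extension of a block monomial representation. -/
noncomputable def extHom (hT : IsTwist D T) (hσ : ∀ i, σ (cs.simple i) = cs.simple i.rev)
    (hσ2 : orderOf σ = 2) : ExtGroup σ →* BlockMon m q where
  toFun x := D.monHom cs hD x.left * if x.right = 1 then 1 else T
  map_one' := by simp
  map_mul' x y := by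
    rw [SemidirectProduct.mul_left, SemidirectProduct.mul_right, map_mul]
    rcases eq_one_or_sigmaElt hσ2 x.right with hx | hx
    · simp [hx, mul_assoc]
    · have e : (Subgroup.zpowers σ).subtype (sigmaElt σ) = σ := rfl
      rcases eq_one_or_sigmaElt hσ2 y.right with hy | hy
      · simp only [hx, hy, mul_one, sigmaElt_ne_one hσ2, if_false, if_true, e]
        rw [mul_assoc, mul_assoc, hT.mul_monHom hD hσ]
      · simp only [hx, hy, sigmaElt_mul_self hσ2, sigmaElt_ne_one hσ2, if_false, if_true, e]
        rw [mul_one, mul_assoc, ← mul_assoc T, hT.mul_monHom hD hσ, mul_assoc _ T, hT.mul_self,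
          mul_one]

/-- The extended block monomial representation. -/
noncomputable def extRep (hT : IsTwist D T) (hσ : ∀ i, σ (cs.simple i) = cs.simple i.rev)
    (hσ2 : orderOf σ = 2) : Representation ℂ (ExtGroup σ) (Fin m × Fin q → ℂ) :=
  BlockMon.toEnd.comp (extHom hD hT hσ hσ2)

variable (hT : IsTwist D T) (hσ : ∀ i, σ (cs.simple i) = cs.simple i.rev) (hσ2 : orderOf σ = 2)

theorem extRep_inl (w : W) :
    extRep hD hT hσ hσ2 (SemidirectProduct.inl w) = D.rep cs hD w := by
  simp [extRep, extHom, InducedDatum.rep]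

theorem extRep_comp_inl : (extRep hD hT hσ hσ2).comp SemidirectProduct.inl = D.rep cs hD :=
  MonoidHom.ext (extRep_inl hD hT hσ hσ2)

theorem extRep_inr :
    extRep hD hT hσ hσ2 (SemidirectProduct.inr (sigmaElt σ)) = BlockMon.toEnd T := by
  simp [extRep, extHom, sigmaElt_ne_one hσ2]

theorem cosetElt_eq (w : W) :
    cosetElt σ w = SemidirectProduct.inl w * SemidirectProduct.inr (sigmaElt σ) := rfl

theorem character_extRep_coset (l : List (Fin 4)) :
    (extRep hD hT hσ hσ2).character (cosetElt σ (cs.wordProd l)) =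
      ((D.wordMon l * T).trace : ℂ) := by
  have h : extRep hD hT hσ hσ2 (cosetElt σ (cs.wordProd l)) =
      BlockMon.toEnd (D.wordMon l * T) := by
    rw [cosetElt_eq, map_mul, extRep_inl, extRep_inr, map_mul,
      ← InducedDatum.monHom_wordProd hD cs]
    rfl
  rw [Representation.character, h, BlockMon.trace_toEnd]

theorem inr_mul_inl (w : W) : (SemidirectProduct.inr (sigmaElt σ) : ExtGroup σ) *
    SemidirectProduct.inl w =
      SemidirectProduct.inl (σ w) * SemidirectProduct.inr (sigmaElt σ) := by
  have := SemidirectProduct.inl_aut (φ := (Subgroup.zpowers σ).subtype) (sigmaElt σ) w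
  rw [map_inv, eq_mul_inv_iff_mul_eq] at this
  exact this.symm

/-- Any other extension differs from the given one by a sign. -/
theorem exists_sign_apply_coset (irr : (D.rep cs hD).IsIrreducible)
    (r : Representation ℂ (ExtGroup σ) (Fin m × Fin q → ℂ))
    (hr : r.comp SemidirectProduct.inl = D.rep cs hD) :
    ∃ e : ℤˣ, ∀ w, r (cosetElt σ w) = signC e • extRep hD hT hσ hσ2 (cosetElt σ w) := by
  have hr' : ∀ w, r (SemidirectProduct.inl w) = D.rep cs hD w := fun w => by rw [← hr]; rfl
  set S := r (SemidirectProduct.inr (sigmaElt σ)) with hS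
  set R := extRep hD hT hσ hσ2 (SemidirectProduct.inr (sigmaElt σ)) with hR
  have hSS : S * S = 1 := by
    rw [hS, ← map_mul, ← map_mul, sigmaElt_mul_self hσ2, map_one, map_one]
  have hRR : R * R = 1 := by
    rw [hR, ← map_mul, ← map_mul, sigmaElt_mul_self hσ2, map_one, map_one]
  have hSw : ∀ w, S * D.rep cs hD w = D.rep cs hD (σ w) * S := by
    intro w
    rw [hS, ← hr', ← hr', ← map_mul, ← map_mul, inr_mul_inl]
  have hRw : ∀ w, R * D.rep cs hD w = D.rep cs hD (σ w) * R := by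
    intro w
    rw [hR, ← extRep_inl hD hT hσ hσ2, ← extRep_inl hD hT hσ hσ2, ← map_mul, ← map_mul, inr_mul_inl]
  have hσσ : ∀ w, σ (σ w) = w := fun w => by
    rw [← MulAut.mul_apply, sigma_mul_self hσ2, MulAut.one_apply]
  -- Both S and R intertwine the representation with its twist by σ, and σ has order 2, so SR
  -- commutes with W and is a scalar by Schur's lemma. Since S and R are involutions, the scalar is
  -- ±1.
  let N : Representation.IntertwiningMap (D.rep cs hD) (D.rep cs hD) := ⟨S * R, fun w => by
    change S * R * D.rep cs hD w = D.rep cs hD w * (S * R)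
    rw [mul_assoc, hRw, ← mul_assoc, hSw, hσσ, mul_assoc]⟩
  obtain ⟨c, hc⟩ :=
    Representation.IsIrreducible.algebraMap_intertwiningMap_bijective_of_isAlgClosed.2 N
  have hN : S * R = c • 1 := by
    have h1 : N.toLinearMap = S * R := rfl
    rw [← h1, ← hc]
    rfl
  have hSR : S = c • R := by
    rw [← mul_one S, ← hRR, ← mul_assoc, hN, smul_mul_assoc, one_mul]
  have : Nontrivial (Fin m × Fin q → ℂ) := nontrivial_of_isIrreducible irr
  have hc2 : c * c = 1 := by
    have h1 : (c * c) • (1 : Module.End ℂ (Fin m × Fin q → ℂ)) = 1 := by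
      rw [← hRR, ← smul_mul_smul_comm, ← hSR, hSS, hRR]
    exact smul_left_injective ℂ (one_ne_zero (α := Module.End ℂ (Fin m × Fin q → ℂ)))
      (h1.trans (one_smul ℂ _).symm)
  obtain ⟨e, he⟩ : ∃ e : ℤˣ, signC e = c := by
    rcases mul_self_eq_one_iff.1 hc2 with h | h
    · exact ⟨1, by rw [h, signC_one]⟩
    · exact ⟨-1, by rw [h, signC_neg_one]⟩
  refine ⟨e, fun w => ?_⟩
  rw [cosetElt_eq, map_mul, map_mul, hr', extRep_inl, ← hS, ← hR, hSR, he, mul_smul_comm]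

/-- The transport of a representation along a linear equivalence. -/
noncomputable def conjRep {G U U' : Type*} [Group G] [AddCommGroup U] [Module ℂ U]
    [AddCommGroup U'] [Module ℂ U'] (e : U ≃ₗ[ℂ] U') (r : Representation ℂ G U) :
    Representation ℂ G U' where
  toFun g := e.conj (r g)
  map_one' := by rw [map_one]; exact e.conj_id
  map_mul' g h := by rw [map_mul]; exact e.conj_comp _ _

/-- A representation is equivalent to its transport. -/
noncomputable def conjRepEquiv {G U U' : Type*} [Group G] [AddCommGroup U] [Module ℂ U]
    [AddCommGroup U'] [Module ℂ U'] (e : U ≃ₗ[ℂ] U') (r : Representation ℂ G U) :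
    r.Equiv (conjRep e r) :=
  Representation.Equiv.mk e fun g => by
    ext x
    simp [conjRep, LinearEquiv.conj_apply_apply]

/-- The characters of two extensions agree up to a sign on the nontrivial coset. -/
theorem exists_sign_character (irr : (D.rep cs hD).IsIrreducible) {U : Type*} [AddCommGroup U]
    [Module ℂ U] (r : Representation ℂ (ExtGroup σ) U)
    (φ : (D.rep cs hD).Equiv (r.comp SemidirectProduct.inl)) :
    ∃ e : ℤˣ, (∀ w, r.character (SemidirectProduct.inl w) =
        (extRep hD hT hσ hσ2).character (SemidirectProduct.inl w)) ∧
      ∀ w, r.character (cosetElt σ w) =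
        signC e * (extRep hD hT hσ hσ2).character (cosetElt σ w) := by
  have hr : (conjRep φ.symm.toLinearEquiv r).comp SemidirectProduct.inl = D.rep cs hD :=
    MonoidHom.ext fun w => Representation.Equiv.conj_apply_self w φ.symm
  obtain ⟨e, he⟩ := exists_sign_apply_coset hD hT hσ hσ2 irr _ hr
  rw [Representation.char_iso (conjRepEquiv φ.symm.toLinearEquiv r)]
  refine ⟨e, fun w => ?_, fun w => ?_⟩
  · rw [Representation.character, Representation.character, extRep_inl]
    exact congrArg _ (DFunLike.congr_fun hr w)
  · rw [Representation.character, Representation.character, he, map_smul, smul_eq_mul]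

end Extension

/-! ### Characterization of the labelled representations by degree and b-invariant. -/

section Labels

variable {W : Type*} [Group W] (cs : CoxeterSystem CoxeterMatrix.F₄ W)
variable {U U' : Type*} [AddCommGroup U] [Module ℂ U] [AddCommGroup U'] [Module ℂ U']

/-- The defining properties of a label, for a representation on an arbitrary space. -/
def HasLabelOn (l : Label) (R : Representation ℂ W U) : Prop :=
  R.IsIrreducible ∧ IsLeast {i | OccursInDegree cs R i} l.b ∧
    l.Primes (OccursInTensorSquare cs R)

variable {R : Representation ℂ W U} {R' : Representation ℂ W U'}

theorem isIrreducible_congr (φ : R.Equiv R') (hR : R.IsIrreducible) : R'.IsIrreducible := by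
  rw [Representation.irreducible_iff_isSimpleModule_asModule] at hR ⊢
  exact IsSimpleModule.congr (LinearEquiv.ofBijective
    (Representation.IntertwiningMap.equivLinearMapAsModule R' R φ.symm.toIntertwiningMap)
    φ.symm.toLinearEquiv.bijective)

theorem comp_equiv_ne_zero {V : Type*} [AddCommGroup V] [Module ℂ V] {S : Representation ℂ W V}
    (φ : R.Equiv R') {f : Representation.IntertwiningMap R' S} (hf : f ≠ 0) :
    f.comp φ.toIntertwiningMap ≠ 0 := by
  intro h
  refine hf (DFunLike.ext _ _ fun u => ?_)
  have := DFunLike.congr_fun h (φ.symm u)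
  rw [Representation.IntertwiningMap.comp_apply] at this
  simpa using this

theorem occursInDegree_congr (φ : R.Equiv R') {i : ℕ} :
    OccursInDegree cs R i ↔ OccursInDegree cs R' i :=
  ⟨fun ⟨f, hf, hi⟩ => ⟨f.comp φ.symm.toIntertwiningMap, comp_equiv_ne_zero φ.symm hf,
      fun _ => hi _⟩,
    fun ⟨f, hf, hi⟩ => ⟨f.comp φ.toIntertwiningMap, comp_equiv_ne_zero φ hf, fun _ => hi _⟩⟩

theorem occursInTensorSquare_congr (φ : R.Equiv R') :
    OccursInTensorSquare cs R ↔ OccursInTensorSquare cs R' :=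
  ⟨fun ⟨f, hf⟩ => ⟨f.comp φ.symm.toIntertwiningMap, comp_equiv_ne_zero φ.symm hf⟩,
    fun ⟨f, hf⟩ => ⟨f.comp φ.toIntertwiningMap, comp_equiv_ne_zero φ hf⟩⟩

variable {cs} in
theorem HasLabelOn.congr {l : Label} (h : HasLabelOn cs l R) (φ : R.Equiv R') :
    HasLabelOn cs l R' := by
  refine ⟨isIrreducible_congr φ h.1, ?_, ?_⟩
  · simpa only [← occursInDegree_congr cs φ] using h.2.1
  · simpa only [← occursInTensorSquare_congr cs φ] using h.2.2

theorem nonempty_equiv (hR : R.IsIrreducible) (hR' : R'.IsIrreducible)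
    {f : Representation.IntertwiningMap R R'} (hf : f ≠ 0) : Nonempty (R.Equiv R') :=
  ⟨f.ofBijective ((Representation.IsIrreducible.bijective_or_eq_zero f).resolve_right hf)⟩

theorem finrank_eq_of_equiv (φ : R.Equiv R') : Module.finrank ℂ U = Module.finrank ℂ U' :=
  φ.toLinearEquiv.finrank_eq

theorem finrank_block (m q : ℕ) : Module.finrank ℂ (Fin m × Fin q → ℂ) = m * q := by simp

theorem datumOne_isIrreducible (d e : ℤˣ) :
    ((datumOne d e).rep cs (datumOne_isValid d e)).IsIrreducible :=
  isIrreducible_of_isSeparated _ (datumOne_isSeparated d e) cs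

theorem datumNine_isIrreducible (d e : ℤˣ) :
    ((datumNine d e).rep cs (datumNine_isValid d e)).IsIrreducible :=
  isIrreducible_of_isSeparated _ (datumNine_isSeparated d e) cs

theorem datumSix_isIrreducible (d : ℤˣ) :
    ((datumSix !![(d : ℤ)] !![-(d : ℤ)]).rep cs (datumSix_isValid d)).IsIrreducible :=
  isIrreducible_of_isSeparated _ (datumSix_isSeparated d) cs

variable {cs} in
/-- Irreducible representations of degree `9` occurring in even degree. -/
theorem exists_equiv_nine (hR : R.IsIrreducible) (hU : Module.finrank ℂ U = 9) {n : ℕ}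
    (hn : OccursInDegree cs R n) (he : Even n) :
    ∃ d e : ℤˣ, Nonempty (((datumNine d e).rep cs (datumNine_isValid d e)).Equiv R) := by
  rcases exists_intertwining_of_irreducible cs R hR (central_eq_one_of_even hR hn he) (by omega)
    with ⟨d, e, f, hf⟩ | ⟨d, f, hf⟩ | ⟨f, hf⟩
  · exact ⟨d, e, nonempty_equiv
      (datumNine_isIrreducible cs d e) hR hf⟩
  · obtain ⟨φ⟩ := nonempty_equiv (datumSix_isIrreducible cs d) hR hf
    have := finrank_eq_of_equiv φ
    rw [finrank_block, hU] at this
    omega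
  · obtain ⟨φ⟩ := nonempty_equiv (datumTwelve_isIrreducible cs) hR hf
    have := finrank_eq_of_equiv φ
    rw [finrank_block, hU] at this
    omega

variable {cs} in
/-- Irreducible representations of degree `6` occurring in even degree. -/
theorem exists_equiv_six (hR : R.IsIrreducible) (hU : Module.finrank ℂ U = 6) {n : ℕ}
    (hn : OccursInDegree cs R n) (he : Even n) :
    ∃ d : ℤˣ, Nonempty (((datumSix !![(d : ℤ)] !![-(d : ℤ)]).rep cs (datumSix_isValid d)).Equiv
      R) := by
  rcases exists_intertwining_of_irreducible cs R hR (central_eq_one_of_even hR hn he) (by omega)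
    with ⟨d, e, f, hf⟩ | ⟨d, f, hf⟩ | ⟨f, hf⟩
  · obtain ⟨φ⟩ := nonempty_equiv
      (datumNine_isIrreducible cs d e) hR hf
    have := finrank_eq_of_equiv φ
    rw [finrank_block, hU] at this
    omega
  · exact ⟨d, nonempty_equiv (datumSix_isIrreducible cs d) hR hf⟩
  · obtain ⟨φ⟩ := nonempty_equiv (datumTwelve_isIrreducible cs) hR hf
    have := finrank_eq_of_equiv φ
    rw [finrank_block, hU] at this
    omega

variable {cs} in
/-- Irreducible representations of degree `12` occurring in even degree. -/
theorem exists_equiv_twelve (hR : R.IsIrreducible) (hU : Module.finrank ℂ U = 12) {n : ℕ}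
    (hn : OccursInDegree cs R n) (he : Even n) :
    Nonempty (((datumSix twoDimU twoDimV).rep cs datumTwelve_isValid).Equiv R) := by
  rcases exists_intertwining_of_irreducible cs R hR (central_eq_one_of_even hR hn he) (by omega)
    with ⟨d, e, f, hf⟩ | ⟨d, f, hf⟩ | ⟨f, hf⟩
  · obtain ⟨φ⟩ := nonempty_equiv
      (datumNine_isIrreducible cs d e) hR hf
    have := finrank_eq_of_equiv φ
    rw [finrank_block, hU] at this
    omega
  · obtain ⟨φ⟩ := nonempty_equiv (datumSix_isIrreducible cs d) hR hf
    have := finrank_eq_of_equiv φ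
    rw [finrank_block, hU] at this
    omega
  · exact nonempty_equiv (datumTwelve_isIrreducible cs) hR hf

/-- Representations of degree `1`. -/
theorem exists_equiv_one (hR : R.IsIrreducible) (hU : Module.finrank ℂ U = 1) :
    ∃ d e : ℤˣ, Nonempty (((datumOne d e).rep cs (datumOne_isValid d e)).Equiv R) := by
  obtain ⟨d, e, f, hf⟩ := exists_intertwining_of_finrank_eq_one cs R hU
  exact ⟨d, e, nonempty_equiv (datumOne_isIrreducible cs d e) hR hf⟩

theorem hasLabelOn_one_zero :
    HasLabelOn cs .phi_1_0 ((datumOne (1 : ℤˣ) (1 : ℤˣ)).rep cs (datumOne_isValid 1 1)) :=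
  ⟨datumOne_isIrreducible cs 1 1,
    ⟨datumOne_occursInDegree cs 1 1, fun _ _ => Nat.zero_le _⟩, trivial⟩

theorem hasLabelOn_one_twentyfour :
    HasLabelOn cs .phi_1_24 ((datumOne (-1 : ℤˣ) (-1 : ℤˣ)).rep cs (datumOne_isValid (-1) (-1))) :=
  have irr := datumOne_isIrreducible cs (-1) (-1)
  ⟨irr, ⟨datumOne_occursInDegree cs (-1) (-1), fun _ h =>
    InducedDatum.length_le_of_occursInDegree irr datumOne_isNegated_neg_neg h⟩, trivial⟩

theorem hasLabelOn_nine_two :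
    HasLabelOn cs .phi_9_2 ((datumNine (1 : ℤˣ) (1 : ℤˣ)).rep cs (datumNine_isValid 1 1)) :=
  have irr := datumNine_isIrreducible cs 1 1
  ⟨irr, ⟨datumNine_occursInDegree cs 1 1, fun _ h =>
    InducedDatum.length_le_of_occursInDegree irr datumNine_isNegated_one_one h⟩, trivial⟩

theorem hasLabelOn_nine_ten : HasLabelOn cs .phi_9_10
    ((datumNine (-1 : ℤˣ) (-1 : ℤˣ)).rep cs (datumNine_isValid (-1) (-1))) :=
  have irr := datumNine_isIrreducible cs (-1) (-1)
  ⟨irr, ⟨datumNine_occursInDegree cs (-1) (-1), fun _ h =>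
    InducedDatum.length_le_of_occursInDegree irr datumNine_isNegated_neg_neg h⟩, trivial⟩

theorem hasLabelOn_twelve :
    HasLabelOn cs .phi_12_4 ((datumSix twoDimU twoDimV).rep cs datumTwelve_isValid) :=
  ⟨datumTwelve_isIrreducible cs, ⟨datumTwelve_occursInDegree cs, fun _ h =>
    InducedDatum.length_le_of_occursInDegree (datumTwelve_isIrreducible cs) datumTwelve_isNegated
      h⟩, trivial⟩

theorem hasLabelOn_six_one : HasLabelOn cs .phi_6_6'
    ((datumSix !![((1 : ℤˣ) : ℤ)] !![-((1 : ℤˣ) : ℤ)]).rep cs (datumSix_isValid 1)) :=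
  have irr := datumSix_isIrreducible cs 1
  ⟨irr, ⟨datumSix_occursInDegree cs 1, fun _ h =>
    InducedDatum.length_le_of_occursInDegree irr datumSix_isNegated_one h⟩,
    not_occursInTensorSquare_one cs irr⟩

theorem datumSix_central (d : ℤˣ) :
    (datumSix !![(d : ℤ)] !![-(d : ℤ)]).rep cs (datumSix_isValid d)
      (cs.wordProd centralWord) = 1 := by
  have h : (datumSix !![(d : ℤ)] !![-(d : ℤ)]).wordMon centralWord = 1 := by
    revert d
    decide +kernel
  change BlockMon.toEnd (InducedDatum.monHom cs _ _) = 1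
  rw [InducedDatum.monHom_wordProd, h, map_one]

theorem hasLabelOn_six_neg : HasLabelOn cs .phi_6_6''
    ((datumSix !![((-1 : ℤˣ) : ℤ)] !![-((-1 : ℤˣ) : ℤ)]).rep cs (datumSix_isValid (-1))) := by
  have irr := datumSix_isIrreducible cs (-1)
  refine ⟨irr, ⟨datumSix_occursInDegree cs (-1), fun n h => ?_⟩, occursInTensorSquare_neg cs⟩
  have h4 := InducedDatum.length_le_of_occursInDegree irr datumSix_isNegated_neg h
  have hev := even_of_occursInDegree h (datumSix_central cs (-1))
  have hne : n ≠ 4 := by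
    rintro rfl
    exact not_occursInDegree_four cs (datumSix_isValid (-1)) irr h
  change 6 ≤ n
  change 4 ≤ n at h4
  obtain ⟨k, rfl⟩ := hev
  omega

variable {cs}

theorem nonempty_equiv_of_hasLabelOn_one_zero (h : HasLabelOn cs .phi_1_0 R)
    (hU : Module.finrank ℂ U = 1) :
    Nonempty (((datumOne (1 : ℤˣ) (1 : ℤˣ)).rep cs (datumOne_isValid 1 1)).Equiv R) := by
  obtain ⟨d, e, ⟨φ⟩⟩ := exists_equiv_one cs h.1 hU
  have irr := datumOne_isIrreducible cs d e
  by_cases hde : d = 1 ∧ e = 1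
  · obtain ⟨rfl, rfl⟩ := hde
    exact ⟨φ⟩
  · have h0 := (occursInDegree_congr cs φ).2 h.2.1.1
    have := InducedDatum.length_le_of_occursInDegree irr (datumOne_isNegated d e hde) h0
    exact absurd this (Nat.not_succ_le_zero 0)

theorem nonempty_equiv_of_hasLabelOn_one_twentyfour (h : HasLabelOn cs .phi_1_24 R)
    (hU : Module.finrank ℂ U = 1) :
    Nonempty (((datumOne (-1 : ℤˣ) (-1 : ℤˣ)).rep cs (datumOne_isValid (-1) (-1))).Equiv R) := by
  obtain ⟨d, e, ⟨φ⟩⟩ := exists_equiv_one cs h.1 hU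
  -- The other linear characters occur in degree at most 12, below 24.
  have h0 := h.2.1.2 ((occursInDegree_congr cs φ).1 (datumOne_occursInDegree cs d e))
  rcases Int.units_eq_one_or d with rfl | rfl <;> rcases Int.units_eq_one_or e with rfl | rfl
  · exact absurd h0 (by decide)
  · exact absurd h0 (by decide)
  · exact absurd h0 (by decide)
  · exact ⟨φ⟩

theorem nonempty_equiv_of_hasLabelOn_nine_two (h : HasLabelOn cs .phi_9_2 R)
    (hU : Module.finrank ℂ U = 9) :
    Nonempty (((datumNine (1 : ℤˣ) (1 : ℤˣ)).rep cs (datumNine_isValid 1 1)).Equiv R) := by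
  obtain ⟨d, e, ⟨φ⟩⟩ := exists_equiv_nine h.1 hU h.2.1.1 (by decide)
  have irr := datumNine_isIrreducible cs d e
  have h0 := (occursInDegree_congr cs φ).2 h.2.1.1
  rcases Int.units_eq_one_or d with rfl | rfl <;> rcases Int.units_eq_one_or e with rfl | rfl
  · exact ⟨φ⟩
  · exact absurd (InducedDatum.length_le_of_occursInDegree irr datumNine_isNegated_one_neg h0)
      (by decide)
  · exact absurd (InducedDatum.length_le_of_occursInDegree irr datumNine_isNegated_neg_one h0)
      (by decide)
  · exact absurd (InducedDatum.length_le_of_occursInDegree irr datumNine_isNegated_neg_neg h0)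
      (by decide)

theorem nonempty_equiv_of_hasLabelOn_nine_ten (h : HasLabelOn cs .phi_9_10 R)
    (hU : Module.finrank ℂ U = 9) :
    Nonempty (((datumNine (-1 : ℤˣ) (-1 : ℤˣ)).rep cs (datumNine_isValid (-1) (-1))).Equiv R) := by
  obtain ⟨d, e, ⟨φ⟩⟩ := exists_equiv_nine h.1 hU h.2.1.1 (by decide)
  -- The other three representations of degree 9 occur in degree 2 or 6, below 10.
  have h0 := h.2.1.2 ((occursInDegree_congr cs φ).1 (datumNine_occursInDegree cs d e))
  rcases Int.units_eq_one_or d with rfl | rfl <;> rcases Int.units_eq_one_or e with rfl | rfl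
  · exact absurd h0 (by decide)
  · exact absurd h0 (by decide)
  · exact absurd h0 (by decide)
  · exact ⟨φ⟩

theorem nonempty_equiv_of_hasLabelOn_twelve (h : HasLabelOn cs .phi_12_4 R)
    (hU : Module.finrank ℂ U = 12) :
    Nonempty (((datumSix twoDimU twoDimV).rep cs datumTwelve_isValid).Equiv R) :=
  exists_equiv_twelve h.1 hU h.2.1.1 (by decide)

theorem nonempty_equiv_of_hasLabelOn_six_one (h : HasLabelOn cs .phi_6_6' R)
    (hU : Module.finrank ℂ U = 6) : Nonempty (((datumSix !![((1 : ℤˣ) : ℤ)]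
      !![-((1 : ℤˣ) : ℤ)]).rep cs (datumSix_isValid 1)).Equiv R) := by
  obtain ⟨d, ⟨φ⟩⟩ := exists_equiv_six h.1 hU h.2.1.1 (by decide)
  rcases Int.units_eq_one_or d with rfl | rfl
  · exact ⟨φ⟩
  · exact absurd ((occursInTensorSquare_congr cs φ).1 (occursInTensorSquare_neg cs)) h.2.2

theorem nonempty_equiv_of_hasLabelOn_six_neg (h : HasLabelOn cs .phi_6_6'' R)
    (hU : Module.finrank ℂ U = 6) : Nonempty (((datumSix !![((-1 : ℤˣ) : ℤ)]
      !![-((-1 : ℤˣ) : ℤ)]).rep cs (datumSix_isValid (-1))).Equiv R) := by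
  obtain ⟨d, ⟨φ⟩⟩ := exists_equiv_six h.1 hU h.2.1.1 (by decide)
  rcases Int.units_eq_one_or d with rfl | rfl
  · exact absurd ((occursInTensorSquare_congr cs φ).2 h.2.2) (not_occursInTensorSquare_one cs
      (datumSix_isIrreducible cs 1))
  · exact ⟨φ⟩

end Labels

/-! ### Matrices for σ and the choice of sign. -/

section Normalization

/-- The twist of the characters of degree `9`. -/
def twistNine : BlockMon 9 1 := ⟨![0, 3, 6, 1, 4, 7, 2, 5, 8], fun j => if j = 8 then -1 else 1⟩

/-- The twist of the characters of degrees `6` and `12`. -/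
def twistSix {q : ℕ} (c : ℤ) (u v : Matrix (Fin q) (Fin q) ℤ) : BlockMon 6 q :=
  ⟨![0, 1, 2, 4, 3, 5], ![c • 1, c • u, c • v, c • (u * v), c • (v * u), c • (u * v * u)]⟩

theorem isTwist_one : ∀ d : ℤˣ, IsTwist (datumOne d d) 1 := fun d =>
  ⟨by decide +kernel, by revert d; decide +kernel⟩

/-- The nine coset representatives form a 3 × 3 array of products of a word in s_0, s_1 and a word
in s_2, s_3, which σ transposes; hence the two signs must agree. The entry -1 arises because s_1 and
s_2 do not commute: on the inducing vector, s_2s_3s_1s_0 acts as minus s_1s_0s_2s_3. -/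
theorem isTwist_nine : ∀ d : ℤˣ, IsTwist (datumNine d d) twistNine := fun d =>
  ⟨by decide +kernel, by revert d; decide +kernel⟩

/-- The twist is determined by its scalar c on block 0, since it must carry the j-th representative
to its image under σ. The trace at σ is c(1 + u + v + uvu), with c = -1: it is -2 for d = -1 and 0
for d = 1, where the normalization has to use another element. -/
theorem isTwist_six : ∀ d : ℤˣ, IsTwist (datumSix !![(d : ℤ)] !![-(d : ℤ)])
    (twistSix (-1) !![(d : ℤ)] !![-(d : ℤ)]) := fun d =>
  ⟨by revert d; decide +kernel, by revert d; decide +kernel⟩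

theorem isTwist_twelve : IsTwist (datumSix twoDimU twoDimV) (twistSix 1 twoDimU twoDimV) :=
  ⟨by decide +kernel, by decide +kernel⟩

variable {W : Type*} [Group W] {cs : CoxeterSystem CoxeterMatrix.F₄ W} {σ : MulAut W}
variable {m q g : ℕ} [NeZero m] {D : InducedDatum m q g} (hD : D.IsValid) {T : BlockMon m q}
variable (hT : IsTwist D T) (hσ : ∀ i, σ (cs.simple i) = cs.simple i.rev) (hσ2 : orderOf σ = 2)

/-- The classification fixes the restriction to W, Schur's lemma leaves one sign on the other coset,
and `hnorm` says that the normalization selects that sign. -/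
theorem isExtension_iff {l : Label} (hlab : HasLabelOn cs l (D.rep cs hD))
    (hclass : ∀ r : Representation ℂ W (Fin l.degree → ℂ), HasLabel cs l r →
      Nonempty ((D.rep cs hD).Equiv r))
    (hdim : m * q = l.degree)
    (hnorm : ∀ (e : ℤˣ) (ψ : ExtGroup σ → ℂ), (∀ w, ψ (cosetElt σ w) =
      signC e * (extRep hD hT hσ hσ2).character (cosetElt σ w)) →
      (l.Normalized cs σ ψ ↔ e = 1)) (ψ : ExtGroup σ → ℂ) :
    IsExtension cs σ l ψ ↔ ψ = (extRep hD hT hσ hσ2).character := by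
  constructor
  · rintro ⟨r, hl, hn, rfl⟩
    obtain ⟨φ⟩ := hclass _ hl
    obtain ⟨e, h1, h2⟩ := exists_sign_character hD hT hσ hσ2 hlab.1 r φ
    obtain rfl := (hnorm e _ h2).1 hn
    funext x
    rw [← SemidirectProduct.inl_left_mul_inr_right x]
    rcases eq_one_or_sigmaElt hσ2 x.right with hx | hx
    · rw [hx, map_one, mul_one, h1]
    · rw [hx, ← cosetElt_eq, h2, signC_one, one_mul]
  · rintro rfl
    have e : (Fin m × Fin q → ℂ) ≃ₗ[ℂ] (Fin l.degree → ℂ) :=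
      LinearEquiv.funCongrLeft ℂ ℂ ((finCongr hdim.symm).trans finProdFinEquiv.symm)
    have hrep : (conjRep e (extRep hD hT hσ hσ2)).comp SemidirectProduct.inl =
        conjRep e (D.rep cs hD) := by
      rw [← extRep_comp_inl hD hT hσ hσ2]
      rfl
    refine ⟨conjRep e (extRep hD hT hσ hσ2), ?_, (hnorm 1 _ fun w => by simp).2 rfl,
      Representation.char_iso (conjRepEquiv e _)⟩
    rw [hrep]
    exact hlab.congr (conjRepEquiv e _)

theorem signC_mul_re (e : ℤˣ) (n : ℤ) : (signC e * (n : ℂ)).re = ((e * n : ℤ) : ℝ) := by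
  rw [signC, ← Int.cast_mul, Complex.intCast_re]

theorem mul_pos_iff_eq_one {e : ℤˣ} {n : ℤ} (hn : 0 < n) :
    0 < (signC e * (n : ℂ)).re ↔ e = 1 := by
  rw [signC_mul_re, Int.cast_pos]
  rcases Int.units_eq_one_or e with rfl | rfl
  · simpa using hn
  · simpa using hn.le

theorem mul_neg_iff_eq_one {e : ℤˣ} {n : ℤ} (hn : n < 0) :
    (signC e * (n : ℂ)).re < 0 ↔ e = 1 := by
  rw [signC_mul_re, Int.cast_lt_zero]
  rcases Int.units_eq_one_or e with rfl | rfl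
  · simpa using hn
  · simpa using hn.le

end Normalization

/-! ### The normalized extensions and their uniqueness. -/

section MainTheorem

variable {W : Type*} [Group W] {cs : CoxeterSystem CoxeterMatrix.F₄ W} {σ : MulAut W}
variable (hσ : ∀ i, σ (cs.simple i) = cs.simple i.rev) (hσ2 : orderOf σ = 2)

/-- The normalized extended characters. -/
noncomputable def extChar (hσ : ∀ i, σ (cs.simple i) = cs.simple i.rev) (hσ2 : orderOf σ = 2) :
    Label → ExtGroup σ → ℂ
  | .phi_1_0 => (extRep (datumOne_isValid 1 1) (isTwist_one 1) hσ hσ2).character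
  | .phi_9_2 => (extRep (datumNine_isValid 1 1) (isTwist_nine 1) hσ hσ2).character
  | .phi_9_10 => (extRep (datumNine_isValid (-1) (-1)) (isTwist_nine (-1)) hσ hσ2).character
  | .phi_1_24 => (extRep (datumOne_isValid (-1) (-1)) (isTwist_one (-1)) hσ hσ2).character
  | .phi_12_4 => (extRep datumTwelve_isValid isTwist_twelve hσ hσ2).character
  | .phi_6_6'' => (extRep (datumSix_isValid (-1)) (isTwist_six (-1)) hσ hσ2).character
  | .phi_6_6' => (extRep (datumSix_isValid 1) (isTwist_six 1) hσ hσ2).character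

/-- The values of the normalized extended characters. -/
def extTrace (w : List (Fin 4)) : Label → ℤ
  | .phi_1_0 => ((datumOne 1 1).wordMon w * 1).trace
  | .phi_9_2 => ((datumNine 1 1).wordMon w * twistNine).trace
  | .phi_9_10 => ((datumNine (-1) (-1)).wordMon w * twistNine).trace
  | .phi_1_24 => ((datumOne (-1) (-1)).wordMon w * 1).trace
  | .phi_12_4 => ((datumSix twoDimU twoDimV).wordMon w * twistSix 1 twoDimU twoDimV).trace
  | .phi_6_6'' => ((datumSix !![-1] !![1]).wordMon w * twistSix (-1) !![-1] !![1]).trace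
  | .phi_6_6' => ((datumSix !![1] !![-1]).wordMon w * twistSix (-1) !![1] !![-1]).trace

theorem extChar_coset (w : List (Fin 4)) (l : Label) :
    extChar hσ hσ2 l (cosetElt σ (cs.wordProd w)) = (extTrace w l : ℂ) := by
  cases l <;> exact character_extRep_coset _ _ hσ hσ2 w

theorem normalized_iff (l : Label) (e : ℤˣ) (ψ : ExtGroup σ → ℂ)
    (h : ∀ w, ψ (cosetElt σ w) = signC e * extChar hσ hσ2 l (cosetElt σ w)) :
    l.Normalized cs σ ψ ↔ e = 1 := by
  -- The normalizations involve only the values at σ and at s_0s_1σ, which are explicit traces.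
  have h1 := h (cs.wordProd [])
  have h2 := h (cs.wordProd [0, 1])
  rw [extChar_coset] at h1 h2
  simp only [cs.wordProd_cons, cs.wordProd_nil, mul_one] at h1 h2
  cases l <;> simp only [Label.Normalized, h1, h2]
  all_goals first
    | exact mul_pos_iff_eq_one (by decide +kernel)
    | exact mul_neg_iff_eq_one (by decide +kernel)

theorem isExtension_iff_eq_extChar (l : Label) (ψ : ExtGroup σ → ℂ) :
    IsExtension cs σ l ψ ↔ ψ = extChar hσ hσ2 l := by
  have hn := normalized_iff (cs := cs) hσ hσ2 l
  cases l
  · exact isExtension_iff _ _ hσ hσ2 (hasLabelOn_one_zero cs)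
      (fun r h => nonempty_equiv_of_hasLabelOn_one_zero h (Module.finrank_fin_fun ℂ)) rfl hn ψ
  · exact isExtension_iff _ _ hσ hσ2 (hasLabelOn_nine_two cs)
      (fun r h => nonempty_equiv_of_hasLabelOn_nine_two h (Module.finrank_fin_fun ℂ)) rfl hn ψ
  · exact isExtension_iff _ _ hσ hσ2 (hasLabelOn_nine_ten cs)
      (fun r h => nonempty_equiv_of_hasLabelOn_nine_ten h (Module.finrank_fin_fun ℂ)) rfl hn ψ
  · exact isExtension_iff _ _ hσ hσ2 (hasLabelOn_one_twentyfour cs)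
      (fun r h => nonempty_equiv_of_hasLabelOn_one_twentyfour h (Module.finrank_fin_fun ℂ)) rfl hn ψ
  · exact isExtension_iff _ _ hσ hσ2 (hasLabelOn_twelve cs)
      (fun r h => nonempty_equiv_of_hasLabelOn_twelve h (Module.finrank_fin_fun ℂ)) rfl hn ψ
  · exact isExtension_iff _ _ hσ hσ2 (hasLabelOn_six_neg cs)
      (fun r h => nonempty_equiv_of_hasLabelOn_six_neg h (Module.finrank_fin_fun ℂ)) rfl hn ψ
  · exact isExtension_iff _ _ hσ hσ2 (hasLabelOn_six_one cs)
      (fun r h => nonempty_equiv_of_hasLabelOn_six_one h (Module.finrank_fin_fun ℂ)) rfl hn ψ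

end MainTheorem

/-! ### Comparison of the two sides on the coset W.σ. -/

section CharacterIdentity

variable {W : Type*} [Group W] {cs : CoxeterSystem CoxeterMatrix.F₄ W} {σ : MulAut W}

/-- The computational core: an equality of integers for each of the 96 representatives of the
twisted classes. -/
theorem involTrace_eq_extTrace : ∀ l ∈ kernelWords, ∀ c ∈ ([[], [0], [0, 1]] : List (List (Fin 4))),
    involTrace (l ++ c) = extTrace (l ++ c) .phi_1_0 + extTrace (l ++ c) .phi_9_2 +
      extTrace (l ++ c) .phi_9_10 + extTrace (l ++ c) .phi_1_24 + extTrace (l ++ c) .phi_12_4 -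
      2 * extTrace (l ++ c) .phi_6_6'' + extTrace (l ++ c) .phi_6_6' := by
  decide +kernel

theorem inl_mul_cosetElt_mul_inv (g w : W) :
    SemidirectProduct.inl g * cosetElt σ w * (SemidirectProduct.inl g)⁻¹ =
      cosetElt σ (g * w * (σ g)⁻¹) := by
  rw [cosetElt_eq, cosetElt_eq, ← mul_assoc, ← map_inv, mul_assoc, inr_mul_inl, ← mul_assoc,
    ← map_mul, ← map_mul, map_inv σ]

theorem extChar_conj (hσ : ∀ i, σ (cs.simple i) = cs.simple i.rev) (hσ2 : orderOf σ = 2)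
    (l : Label) (g h : ExtGroup σ) :
    extChar hσ hσ2 l (h * g * h⁻¹) = extChar hσ hσ2 l g := by
  cases l <;> exact Representation.char_conj _ _ _

theorem extInvChar_eq (hσ : σ ∈ coxeterAut cs) (hσ' : ∀ i, σ (cs.simple i) = cs.simple i.rev)
    (hσ2 : orderOf σ = 2) (w : W) :
    (extInvChar cs σ hσ (cosetElt σ w) : ℂ) =
      extChar hσ' hσ2 .phi_1_0 (cosetElt σ w) + extChar hσ' hσ2 .phi_9_2 (cosetElt σ w) +
      extChar hσ' hσ2 .phi_9_10 (cosetElt σ w) + extChar hσ' hσ2 .phi_1_24 (cosetElt σ w) +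
      extChar hσ' hσ2 .phi_12_4 (cosetElt σ w) - 2 * extChar hσ' hσ2 .phi_6_6'' (cosetElt σ w) +
      extChar hσ' hσ2 .phi_6_6' (cosetElt σ w) := by
  obtain ⟨g, l, hl, c, hc, h⟩ := exists_twisted_conj cs hσ' w
  have h1 : extInvChar cs σ hσ (cosetElt σ w) =
      extInvChar cs σ hσ (cosetElt σ (cs.wordProd (l ++ c))) := by
    rw [← h, ← inl_mul_cosetElt_mul_inv]
    exact (Representation.char_conj _ _ _).symm
  have h2 : ∀ k, extChar hσ' hσ2 k (cosetElt σ w) = (extTrace (l ++ c) k : ℂ) := by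
    intro k
    rw [← extChar_coset hσ' hσ2, ← h, ← inl_mul_cosetElt_mul_inv, extChar_conj]
  rw [h1, extInvChar_coset cs hσ hσ', involTrace_eq_extTrace l hl c hc]
  simp only [h2]
  push_cast
  ring

end CharacterIdentity
end InvolutionModule

theorem proposition4p4 {W : Type*} [Group W] (cs : CoxeterSystem CoxeterMatrix.F₄ W)
    (σ : MulAut W) (hσ : σ ∈ InvolutionModule.coxeterAut cs) (hσ2 : orderOf σ = 2) :
    ∃ φ : InvolutionModule.Label → InvolutionModule.ExtGroup σ → ℂ,
      (∀ l ψ, InvolutionModule.IsExtension cs σ l ψ ↔ ψ = φ l) ∧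
      ∀ w : W,
        (InvolutionModule.extInvChar cs σ hσ (InvolutionModule.cosetElt σ w) : ℂ) =
          φ .phi_1_0 (InvolutionModule.cosetElt σ w) + φ .phi_9_2 (InvolutionModule.cosetElt σ w)
          + φ .phi_9_10 (InvolutionModule.cosetElt σ w)
          + φ .phi_1_24 (InvolutionModule.cosetElt σ w)
          + φ .phi_12_4 (InvolutionModule.cosetElt σ w)
          - 2 * φ .phi_6_6'' (InvolutionModule.cosetElt σ w)
          + φ .phi_6_6' (InvolutionModule.cosetElt σ w) := by
  have hσ' := InvolutionModule.aut_simple cs hσ hσ2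
  exact ⟨InvolutionModule.extChar hσ' hσ2, InvolutionModule.isExtension_iff_eq_extChar hσ' hσ2,
    InvolutionModule.extInvChar_eq hσ hσ' hσ2⟩
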